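/- Write $e(w)=e^{2\pi i w}$. Let $\underline L=(L,\beta)$ be a positive-definite even lattice of rank $n$, with $\beta$ extended bilinearly to $L\otimes\mathbb Q$ and $L\otimes\mathbb C$, put $\beta(v)=\tfrac12\beta(v,v)$, let $L^\#=\{v\in L\otimes\mathbb Q:\beta(v,w)\in\mathbb Z\text{ for all }w\in L\}$ be the dual lattice, and for $x\in L^\#/L$ let $N_x$ denote the order of $x$. Let $k$ be an integer with $k>\frac n2+2$. *Jacobi forms.* For $\phi:\mathfrak H\times(L\otimes\mathbb C)\to\mathbb C$, $A=\left(\begin{smallmatrix}a&b\\c&d\end{smallmatrix}\right)\in\mathrm{SL}_2(\mathbb Z)$ and $h=(u,v)\in L\times L$ put $$\phi|_{k,\underline L}A(\tau,z)=\phi\Big(A\tau,\frac z{c\tau+d}\Big)(c\tau+d)^{-k}e\Big(\frac{-c\beta(z)}{c\tau+d}\Big),\qquad \phi|_{k,\underline L}h(\tau,z)=\phi(\tau,z+u\tau+v)\,e\big(\tau\beta(u)+\beta(u,z)\big),$$ and $\phi|_{k,\underline L}(A,h)=(\phi|_{k,\underline L}A)|_{k,\underline L}h$. The Jacobi group $J=\mathrm{SL}_2(\mathbb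 Z)\ltimes(L\times L)$ has the product $(A,h)(A',h')=(AA',h^{A'}+h')$ with $(u,v)^A=(au+cv,bu+dv)$. The space $J_{k,\underline L}$ consists of the holomorphic $\phi$ on $\mathfrak H\times(L\otimes\mathbb C)$ that are invariant under $|_{k,\underline L}\gamma$ for all $\gamma\in J$ and have an expansion $\phi(\tau,z)=\sum_{m\in\mathbb Z,\,r\in L^\#,\,m\ge\beta(r)}c(m,r)e(m\tau+\beta(r,z))$. The number $c(m,r)$ depends only on $D=\beta(r)-m$ and on $r$ mod $L$; write $h_{\phi,y}(\tau)=\sum_{D}c(\beta(r)-D,r)\,e(-D\tau)$ for $r\in L^\#$ in the class $y\in L^\#/L$, the sum being over the rational $D\le0$ with $D\equiv\beta(r)$ mod $\mathbb Z$. *Eisenstein series.* For $r\in L^\#$ with $\beta(r)\in\mathbb Z$ put $$E_r=\frac12\sum_{\gamma\in J_\infty\backslash J}g_r|_{k,\underline L}\gamma,\qquad g_r(\tau,z)=e\big(\tau\beta(r)+\beta(r,z)\big),\qquad J_\infty=\Big\{\big(\left(\begin{smallmatrix}1&m\\0&1\end{smallmatrix}\right),(0,v)\big):m\in\mathbb Z,\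 v\in L\Big\},$$ where one first sums over all cosets lying over the same class in $\Gamma_\infty\backslash\mathrm{SL}_2(\mathbb Z)$, $\Gamma_\infty=\{\left(\begin{smallmatrix}1&m\\0&1\end{smallmatrix}\right):m\in\mathbb Z\}$, and then over these classes. $E_r$ depends only on $r$ mod $L$. *Averaging operator.* Let $(\mathfrak e_y)$ be the standard basis of $\mathbb C[L^\#/L]$. Let $\varphi$ map $\phi\in J_{k,\underline L}$ to the function $\sum_y h_{\phi,y}\mathfrak e_y$ on $\mathfrak H$, and let $\varphi^{-1}$ map a function $\sum_y h_y\mathfrak e_y$ on $\mathfrak H$ to $\sum_y h_y(\tau)\vartheta_y(\tau,z)$, where $\vartheta_y(\tau,z)=\sum_{r\in L^\#,\,r+L=y}e(\tau\beta(r)+\beta(r,z))$. For $x\in L^\#/L$ let $\sigma_x(\lambda,\mu,t)\mathfrak e_y=e\big(\mu\beta(x,y)+(t-\lambda\mu)\beta(x)\big)\mathfrak e_{y-\lambda x}$ be the (unitary) Schrödinger representation twisted at $x$ and $\sigma_x^*$ its dual, given by the complex conjugate matrices. For $\phi\in J_{k,\underline L}$ put $$\mathrm{Av}_x\phi=\frac1{N_x^2}\sum_{\lambda,\mu\bmod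 N_x^2}\varphi^{-1}\,\sigma_x^*(\lambda,\mu,0)\,\varphi(\phi).$$ **Proposition.** For every isotropic $y\in L^\#/L$ (that is, $\beta(y)\in\mathbb Z$) the series defining $E_y$ converges absolutely at every point, both the sum over each class and the sum over the classes, and $E_0\in J_{k,\underline L}$. For every $x\in L^\#/L$, $$\mathrm{Av}_xE_0(\tau,z)=\sum_{\substack{\lambda\bmod N_x^2\\ \lambda\beta(x)\in\mathbb Z}}E_{\lambda x}(\tau,z)\qquad\text{for all }(\tau,z)\in\mathfrak H\times(L\otimes\mathbb C).$$ -/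

import Mathlib

open UpperHalfPlane
open scoped MatrixGroups

noncomputable section

/-- `e(w) = exp(2πiw)`. -/
def expTwoPiI (w : ℂ) : ℂ := Complex.exp (2 * Real.pi * Complex.I * w)

/-- A positive-definite even lattice `(L, β)` of rank `n`. The elements of `L` are identified with
their coefficient vectors in `ℤⁿ` with respect to a `ℤ`-basis, and `β(x, y) = xᵗ G y`
with `G` the Gram matrix. -/
structure EvenLattice (n : ℕ) where
  gram : Matrix (Fin n) (Fin n) ℤ
  symm : gram.IsSymm
  even : ∀ x : Fin n → ℤ, Even (x ⬝ᵥ gram.mulVec x)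
  pos : ∀ x : Fin n → ℤ, x ≠ 0 → 0 < x ⬝ᵥ gram.mulVec x

/-- The Jacobi group `SL₂(ℤ) ⋉ H_L(ℤ)`: its elements are the `(A, (x, y))` with `A ∈ SL₂(ℤ)` and
`x, y ∈ L = ℤⁿ`. -/
@[ext] structure JacobiGroup (n : ℕ) where
  mat : SL(2, ℤ)
  x : Fin n → ℤ
  y : Fin n → ℤ

namespace JacobiGroup

variable {n : ℕ}

/-- `(A, h)(A', h') = (AA', h^{A'} h')`, where `(x, y)^A = (ax + cy, bx + dy)`. -/
instance : Mul (JacobiGroup n) where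
  mul g g' :=
    ⟨g.mat * g'.mat, g'.mat 0 0 • g.x + g'.mat 1 0 • g.y + g'.x,
      g'.mat 0 1 • g.x + g'.mat 1 1 • g.y + g'.y⟩

instance : One (JacobiGroup n) where
  one := ⟨1, 0, 0⟩

instance : Inv (JacobiGroup n) where
  inv g :=
    ⟨g.mat⁻¹, -(g.mat⁻¹ 0 0 • g.x + g.mat⁻¹ 1 0 • g.y),
      -(g.mat⁻¹ 0 1 • g.x + g.mat⁻¹ 1 1 • g.y)⟩

theorem mul_def (g g' : JacobiGroup n) : g * g' =
    ⟨g.mat * g'.mat, g'.mat 0 0 • g.x + g'.mat 1 0 • g.y + g'.x,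
      g'.mat 0 1 • g.x + g'.mat 1 1 • g.y + g'.y⟩ := rfl

theorem one_def : (1 : JacobiGroup n) = ⟨1, 0, 0⟩ := rfl

theorem inv_def (g : JacobiGroup n) : g⁻¹ =
    ⟨g.mat⁻¹, -(g.mat⁻¹ 0 0 • g.x + g.mat⁻¹ 1 0 • g.y),
      -(g.mat⁻¹ 0 1 • g.x + g.mat⁻¹ 1 1 • g.y)⟩ := rfl

instance : Group (JacobiGroup n) :=
  Group.ofLeftAxioms
    (by
      intro a b c
      simp only [mul_def, JacobiGroup.mk.injEq]
      refine ⟨mul_assoc _ _ _, ?_, ?_⟩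
      · ext i
        simp [Matrix.mul_apply, Fin.sum_univ_two]
        ring
      · ext i
        simp [Matrix.mul_apply, Fin.sum_univ_two]
        ring)
    (by
      intro a
      ext <;> simp [mul_def, one_def])
    (by
      intro a
      have hd : a.mat 0 0 * a.mat 1 1 - a.mat 0 1 * a.mat 1 0 = 1 := by
        have := a.mat.det_coe
        rwa [Matrix.det_fin_two] at this
      simp only [mul_def, inv_def, one_def, JacobiGroup.mk.injEq]
      refine ⟨inv_mul_cancel a.mat, ?_, ?_⟩
      · ext i
        simp [Matrix.adjugate_fin_two]
        linear_combination (-(a.x i)) * hd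
      · ext i
        simp [Matrix.adjugate_fin_two]
        linear_combination (-(a.y i)) * hd)

/-- The subgroup `J_∞` of all `((1 m; 0 1), (0, μ))` with `m ∈ ℤ` and `μ ∈ L`. -/
def stab (n : ℕ) : Subgroup (JacobiGroup n) where
  carrier := {g | (∃ m : ℤ, g.mat = ModularGroup.T ^ m) ∧ g.x = 0}
  one_mem' := ⟨⟨0, by simp [one_def]⟩, rfl⟩
  mul_mem' := by
    rintro a b ⟨⟨m, hm⟩, hx⟩ ⟨⟨m', hm'⟩, hx'⟩
    refine ⟨⟨m + m', by rw [mul_def, zpow_add, hm, hm']⟩, ?_⟩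
    simp [mul_def, hx, hx', hm', ModularGroup.coe_T_zpow]
  inv_mem' := by
    rintro a ⟨⟨m, hm⟩, hx⟩
    refine ⟨⟨-m, by rw [inv_def, zpow_neg, hm]⟩, ?_⟩
    have h : (a.mat⁻¹ : SL(2, ℤ)) 1 0 = 0 := by
      rw [hm, ← zpow_neg, ModularGroup.coe_T_zpow]; simp
    simp [inv_def, hx, h]

/-- `J_∞ \ J`. -/
abbrev Cosets (n : ℕ) : Type := Quotient (QuotientGroup.rightRel (stab n))

/-- `Γ_∞ \ Γ`, with `Γ = SL₂(ℤ)` and `Γ_∞` the group of all `(1 m; 0 1)`, `m ∈ ℤ`. -/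
abbrev ModularCosets : Type :=
  Quotient (QuotientGroup.rightRel (Subgroup.zpowers ModularGroup.T))

/-- The projection `J_∞ \ J → Γ_∞ \ Γ` induced by `(A, h) ↦ A`. -/
def projCoset : Cosets n → ModularCosets :=
  Quotient.map' (fun g => g.mat) (by
    intro a b h
    rw [QuotientGroup.rightRel_apply] at h ⊢
    obtain ⟨⟨m, hm⟩, -⟩ := h
    exact ⟨m, hm.symm⟩)

end JacobiGroup

namespace EvenLattice

variable {n : ℕ} (L : EvenLattice n)

/-- The bilinear form `β(v, w) = vᵗ G w`, extended to `ℚⁿ`, `ℂⁿ`, .... -/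
def bil {R : Type*} [CommRing R] (v w : Fin n → R) : R :=
  v ⬝ᵥ (L.gram.map (Int.cast : ℤ → R)).mulVec w

/-- The quadratic form `β(v) = β(v, v) / 2`. -/
def quad {R : Type*} [Field R] (v : Fin n → R) : R := L.bil v v / 2

/-- The dual lattice `L^#`, consisting of all `v ∈ L ⊗ ℚ` with `β(v, w) ∈ ℤ` for all `w ∈ L`. -/
def dual : AddSubgroup (Fin n → ℚ) where
  carrier := {v | ∀ w : Fin n → ℤ, ∃ m : ℤ, L.bil v (fun i => (w i : ℚ)) = m}
  zero_mem' := fun w => ⟨0, by simp [bil]⟩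
  add_mem' := by
    intro a b ha hb w
    obtain ⟨m, hm⟩ := ha w
    obtain ⟨m', hm'⟩ := hb w
    refine ⟨m + m', ?_⟩
    simp only [bil, add_dotProduct] at *
    rw [hm, hm']
    push_cast
    rfl
  neg_mem' := by
    intro a ha w
    obtain ⟨m, hm⟩ := ha w
    refine ⟨-m, ?_⟩
    simp only [bil, neg_dotProduct] at *
    rw [hm]
    push_cast
    rfl

/-- `L = ℤⁿ` as a subgroup of `L ⊗ ℚ = ℚⁿ`. -/
def lat (n : ℕ) : AddSubgroup (Fin n → ℚ) where
  carrier := {v | ∃ w : Fin n → ℤ, v = fun i => (w i : ℚ)}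
  zero_mem' := ⟨0, by ext; simp⟩
  add_mem' := by
    rintro _ _ ⟨a, rfl⟩ ⟨b, rfl⟩
    exact ⟨a + b, by ext; simp⟩
  neg_mem' := by
    rintro _ ⟨a, rfl⟩
    exact ⟨-a, by ext; simp⟩

/-- The discriminant group `L^# / L`. -/
abbrev disc : Type := L.dual ⧸ (lat n).addSubgroupOf L.dual

/-- A representative in `L^#` of a class in `L^# / L`. -/
def rep (x : L.disc) : L.dual := Quotient.out x

theorem gram_det_ne_zero : L.gram.det ≠ 0 := by
  intro h
  obtain ⟨v, hv, hv0⟩ := Matrix.exists_mulVec_eq_zero_iff.mpr h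
  have := L.pos v hv
  simp [hv0] at this

theorem det_smul_mem_lat (v : Fin n → ℚ) (hv : v ∈ L.dual) :
    ∃ w : Fin n → ℤ, ∀ i, (L.gram.det : ℚ) * v i = w i := by
  choose m hm using fun j : Fin n => hv (Pi.single j 1)
  set GQ : Matrix (Fin n) (Fin n) ℚ := L.gram.map (Int.cast : ℤ → ℚ) with hGQ
  have h1 : Matrix.vecMul v GQ = fun j => (m j : ℚ) := by
    ext j
    rw [← hm j, bil, Matrix.dotProduct_mulVec]
    have : (fun i => ((Pi.single j (1 : ℤ) : Fin n → ℤ) i : ℚ)) = Pi.single j 1 := by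
      ext i
      by_cases h : i = j
      · subst h; simp
      · simp [h]
    rw [this, dotProduct_single, mul_one]
  have hdet : GQ.det = (L.gram.det : ℚ) := by
    rw [hGQ]; exact (Int.cast_det L.gram).symm
  have hadj : GQ.adjugate = L.gram.adjugate.map (Int.cast : ℤ → ℚ) := by
    rw [hGQ]; exact ((Int.castRingHom ℚ).map_adjugate L.gram).symm
  refine ⟨Matrix.vecMul m L.gram.adjugate, fun i => ?_⟩
  have h2 : Matrix.vecMul (Matrix.vecMul v GQ) GQ.adjugate = (L.gram.det : ℚ) • v := by
    rw [Matrix.vecMul_vecMul, Matrix.mul_adjugate, hdet, Matrix.vecMul_smul, Matrix.vecMul_one]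
  have h3 := congrFun h2 i
  rw [h1, hadj] at h3
  simp only [Pi.smul_apply, smul_eq_mul] at h3
  rw [← h3]
  simp [Matrix.vecMul, dotProduct]

instance : Finite L.disc := by
  choose w hw using fun x : L.disc => L.det_smul_mem_lat (L.rep x) (L.rep x).2
  have hd : NeZero L.gram.det.natAbs := ⟨Int.natAbs_ne_zero.mpr L.gram_det_ne_zero⟩
  refine Finite.of_injective (β := Fin n → ZMod L.gram.det.natAbs)
    (fun x i => (w x i : ZMod L.gram.det.natAbs)) ?_
  intro x y hxy
  have hdvd : ∀ i, ∃ c : ℤ, w y i - w x i = L.gram.det * c := by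
    intro i
    have h := (ZMod.intCast_eq_intCast_iff_dvd_sub _ _ _).mp (congrFun hxy i)
    exact (Int.natAbs_dvd.mp h)
  choose c hc using hdvd
  have hx : (QuotientAddGroup.mk (L.rep x) : L.disc) = x := Quotient.out_eq x
  have hy : (QuotientAddGroup.mk (L.rep y) : L.disc) = y := Quotient.out_eq y
  rw [← hx, ← hy, QuotientAddGroup.eq, AddSubgroup.mem_addSubgroupOf]
  refine ⟨c, ?_⟩
  ext i
  have hQ : (L.gram.det : ℚ) ≠ 0 := by exact_mod_cast L.gram_det_ne_zero
  have h1 := hw x i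
  have h2 := hw y i
  have h3 : ((w y i : ℚ) - w x i) = L.gram.det * c i := by exact_mod_cast hc i
  apply mul_left_cancel₀ hQ
  rw [← h3, ← h1, ← h2]
  simp
  ring

instance : Fintype L.disc := Fintype.ofFinite _

/-- The image of `r ∈ L^#` in `L ⊗ ℂ = ℂⁿ`. -/
def toC (r : L.dual) : Fin n → ℂ := fun i => ((r : Fin n → ℚ) i : ℂ)

/-- `x ∈ L^# / L` is isotropic: `β(x) ∈ ℤ`. -/
def IsIsotropic (x : L.disc) : Prop := ∃ m : ℤ, L.quad (L.rep x : Fin n → ℚ) = m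

/-! ### Jacobi forms -/

/-- `φ|_{k,L} A` for `A ∈ SL₂(ℤ)`. -/
def slashMat (k : ℤ) (φ : ℍ → (Fin n → ℂ) → ℂ) (A : SL(2, ℤ)) : ℍ → (Fin n → ℂ) → ℂ :=
  fun τ z =>
    let j : ℂ := (A 1 0 : ℂ) * τ + (A 1 1 : ℂ)
    φ (A • τ) (j⁻¹ • z) * j ^ (-k) * expTwoPiI (-(A 1 0 : ℂ) * L.quad z / j)

/-- `φ|_{k,L} (x, y)` for `(x, y) ∈ H_L(ℤ)`. -/
def slashHeis (φ : ℍ → (Fin n → ℂ) → ℂ) (x y : Fin n → ℤ) : ℍ → (Fin n → ℂ) → ℂ :=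
  fun τ z =>
    let x' : Fin n → ℂ := fun i => (x i : ℂ)
    let y' : Fin n → ℂ := fun i => (y i : ℂ)
    φ τ (z + (τ : ℂ) • x' + y') * expTwoPiI (τ * L.quad x' + L.bil x' z)

/-- `φ|_{k,L} (A, h) = (φ|_{k,L} A)|_{k,L} h`. -/
def slash (k : ℤ) (φ : ℍ → (Fin n → ℂ) → ℂ) (g : JacobiGroup n) : ℍ → (Fin n → ℂ) → ℂ :=
  L.slashHeis (L.slashMat k φ g.mat) g.x g.y

/-- `φ(τ, z) = ∑ c(m, r) e(mτ + β(r, z))`, the sum being over `m ∈ ℤ` and `r ∈ L^#` with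
`m ≥ β(r)`. -/
def HasFourierExpansion (φ : ℍ → (Fin n → ℂ) → ℂ) (c : ℤ → L.dual → ℂ) : Prop :=
  (∀ (m : ℤ) (r : L.dual), (m : ℚ) < L.quad (r : Fin n → ℚ) → c m r = 0) ∧
  ∀ (τ : ℍ) (z : Fin n → ℂ),
    HasSum (fun p : ℤ × L.dual => c p.1 p.2 * expTwoPiI (p.1 * τ + L.bil (L.toC p.2) z)) (φ τ z)

/-- `φ` is a Jacobi form of weight `k` and index `L`. -/
structure IsJacobiForm (k : ℤ) (φ : ℍ → (Fin n → ℂ) → ℂ) : Prop where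
  holo : DifferentiableOn ℂ (fun p : ℂ × (Fin n → ℂ) => φ (ofComplex p.1) p.2)
    {p | 0 < p.1.im}
  slash_eq : ∀ g : JacobiGroup n, L.slash k φ g = φ
  fourier : ∃ c : ℤ → L.dual → ℂ, L.HasFourierExpansion φ c

/-- The space `J_{k,L}` of Jacobi forms. -/
def JacobiForm (k : ℤ) : Type := {φ : ℍ → (Fin n → ℂ) → ℂ // L.IsJacobiForm k φ}

variable {L} in
/-- The Fourier coefficients `c(m, r)` of a Jacobi form. -/
def JacobiForm.coeff {k : ℤ} (φ : L.JacobiForm k) : ℤ → L.dual → ℂ :=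
  Classical.choose φ.2.fourier

/-! ### Theta expansion -/

/-- The Jacobi theta series `ϑ_{L,x}(τ, z) = ∑ e(τβ(r) + β(r, z))`, over the `r` in the class `x`. -/
def theta (x : L.disc) : ℍ → (Fin n → ℂ) → ℂ := fun τ z =>
  ∑' r : {r : L.dual // (QuotientAddGroup.mk r : L.disc) = x},
    expTwoPiI (τ * L.quad (L.toC r) + L.bil (L.toC r) z)

variable {L} in
/-- The map `φ ↦ ∑_x h_{φ,x} 𝔢_x` from Jacobi forms to functions `ℍ → ℂ[L^# / L]`, where
`h_{φ,x}(τ) = ∑_D C(D, r) e(-Dτ)` with `C(D, r) = c(β(r) - D, r)` and `r` in the class `x`. The sum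
is written over the integer `m = β(r) - D`; the terms with `D > 0` vanish. -/
def JacobiForm.toVec {k : ℤ} (φ : L.JacobiForm k) : ℍ → L.disc → ℂ := fun τ x =>
  ∑' m : ℤ, φ.coeff m (L.rep x) *
    expTwoPiI (((m : ℂ) - L.quad (L.toC (L.rep x))) * τ)

/-- The inverse map `∑_x h_x 𝔢_x ↦ ∑_x h_x ϑ_{L,x}`. -/
def ofVec (F : ℍ → L.disc → ℂ) : ℍ → (Fin n → ℂ) → ℂ := fun τ z =>
  ∑ x : L.disc, F τ x * L.theta x τ z

/-! ### The Schrödinger representation and the averaging operator -/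

open Classical in
/-- The matrix, in the basis `(𝔢_y)`, of `σ_x(λ, μ, t)`, which is given by
`σ_x(λ, μ, t) 𝔢_y = e(μβ(x, y) + (t - λμ)β(x)) 𝔢_{y - λx}`. -/
def schrodinger (x : L.disc) (l μ t : ℤ) : Matrix L.disc L.disc ℂ := fun w y =>
  if w = y - l • x then
    expTwoPiI (μ * L.bil (L.toC (L.rep x)) (L.toC (L.rep y)) +
      (t - l * μ) * L.quad (L.toC (L.rep x)))
  else 0

/-- The dual of the (unitary) Schrödinger representation: complex conjugate matrices. -/
def schrodingerDual (x : L.disc) (l μ t : ℤ) : Matrix L.disc L.disc ℂ :=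
  (L.schrodinger x l μ t).map (starRingEnd ℂ)

variable {L} in
/-- The averaging operator `Av_x`, where `N_x` is the order of `x` in `L^# / L`. -/
def averaging {k : ℤ} (x : L.disc) (φ : L.JacobiForm k) : ℍ → (Fin n → ℂ) → ℂ := fun τ z =>
  (1 / (addOrderOf x : ℂ) ^ 2) *
    ∑ l ∈ Finset.range (addOrderOf x ^ 2), ∑ μ ∈ Finset.range (addOrderOf x ^ 2),
      L.ofVec (fun τ' => (L.schrodingerDual x l μ 0).mulVec (φ.toVec τ')) τ z

/-! ### Eisenstein series -/

/-- `g_{D,r}(τ, z) = e(τ(β(r) - D) + β(r, z))`. -/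
def seed (D : ℚ) (r : L.dual) : ℍ → (Fin n → ℂ) → ℂ := fun τ z =>
  expTwoPiI (τ * (L.quad (L.toC r) - D) + L.bil (L.toC r) z)

/-- The term `g_{D,r}|_{k,L} γ` of the Poincaré series at a coset `J_∞ γ`. -/
def poincareTerm (k : ℤ) (D : ℚ) (r : L.dual) (γ : JacobiGroup.Cosets n) :
    ℍ → (Fin n → ℂ) → ℂ :=
  L.slash k (L.seed D r) (Quotient.out γ)

/-- The sum of the terms of the Poincaré series over the cosets in `J_∞ \ J` that lie over a
given class in `Γ_∞ \ Γ`. -/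
def poincareBlock (k : ℤ) (D : ℚ) (r : L.dual) (A : JacobiGroup.ModularCosets) :
    ℍ → (Fin n → ℂ) → ℂ := fun τ z =>
  ∑' γ : {γ : JacobiGroup.Cosets n // JacobiGroup.projCoset γ = A}, L.poincareTerm k D r γ τ z

/-- The series `P_{k,L,D,r} = ∑ g_{D,r}|_{k,L} γ` over `γ ∈ J_∞ \ J`, where one first sums over the
cosets that lie over the same class in `Γ_∞ \ Γ`. For `k > n + 2` the order of summation does not
matter; for `D = 0` and `n / 2 + 2 < k ≤ n + 2` only the sum in this order converges. -/
def poincare (k : ℤ) (D : ℚ) (r : L.dual) : ℍ → (Fin n → ℂ) → ℂ := fun τ z =>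
  ∑' A : JacobiGroup.ModularCosets, L.poincareBlock k D r A τ z

/-- The Eisenstein series `E_x = (1/2) P_{0,r}` with `r` in the (isotropic) class `x`. -/
def eisenstein (k : ℤ) (x : L.disc) : ℍ → (Fin n → ℂ) → ℂ := fun τ z =>
  (1 / 2) * L.poincare k 0 (L.rep x) τ z

/-- The series that defines `E_x` converges at every point. -/
def EisensteinConverges (k : ℤ) (x : L.disc) : Prop :=
  ∀ (τ : ℍ) (z : Fin n → ℂ),
    (∀ A : JacobiGroup.ModularCosets,
      Summable fun γ : {γ : JacobiGroup.Cosets n // JacobiGroup.projCoset γ = A} =>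
        L.poincareTerm k 0 (L.rep x) γ τ z) ∧
    Summable fun A : JacobiGroup.ModularCosets => L.poincareBlock k 0 (L.rep x) A τ z

open Classical in
/-- The `λ` modulo `N_x²` with `λβ(x) ∈ ℤ`. -/
def averagingIndex (x : L.disc) : Finset ℕ :=
  (Finset.range (addOrderOf x ^ 2)).filter
    fun l => ∃ m : ℤ, (l : ℚ) * L.quad (L.rep x : Fin n → ℚ) = m

end EvenLattice

end

noncomputable section

/-! ### The exponential function `e` -/

/-! The cosets over the class of `B` in `Γ_∞ \ SL₂(ℤ)` are represented by the `(1, (u, 0))(B, 0)`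
with `u ∈ L`, and slashing `g_r` by `(1, (u, 0))` gives the theta term at `r + u`. Each block of the
Eisenstein series is therefore a slashed theta series, and `E_x = ½ ∑_A ϑ_x|A`
(`hasSum_poincareTerm`, `eisenstein_apply`).

On theta expansions the dual Schrödinger operators are translations of `z` by `(-λr, -μr)`, with `r`
a representative of `x` (`ofVec_schrodingerDual`). Normalized by a symmetric cocycle, translations
are permuted by `SL₂(ℤ)` without any phase, and they depend only on residues mod `N_x²`. Hence the
averaging commutes with every `|A` (`slashMat_translationMean`), and only `ϑ_0` has to be averaged.
Its translate by `(lr, mr)` is `e(lmβ(x)) ϑ_{lx}`, and the sum over `m` vanishes unless `lβ(x) ∈ ℤ`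
(`translationMean_theta_zero`). Slashing by `A` and summing over `A` proves the formula.

The analytic part is the convergence for `k > n/2 + 2`. The theta series span an `SL₂(ℤ)`-stable
space on which the coefficient vector changes its norm only by `|cτ + d|^{n/2 - k}`
(`actsOnThetaExpansions`). For `S` this is Poisson summation (`theta_inversion`), Plancherel on `L^#
/ L`, and `|L^# / L| = det G` (`card_disc`). So the theta coefficients of `E_x` are dominated by an
Eisenstein series of exponent `k - n/2 > 2`; they are holomorphic and bounded near `i∞`, which
yields the Fourier expansion of a Jacobi form. Uniqueness of theta expansions
(`JacobiForm.toVec_eq`) identifies `φ(E_0)` with these coefficients. -/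

theorem expTwoPiI_add (a b : ℂ) : expTwoPiI (a + b) = expTwoPiI a * expTwoPiI b := by
  simp [expTwoPiI, mul_add, Complex.exp_add]

theorem expTwoPiI_zero : expTwoPiI 0 = 1 := by simp [expTwoPiI]

theorem expTwoPiI_ne_zero (a : ℂ) : expTwoPiI a ≠ 0 := Complex.exp_ne_zero _

theorem expTwoPiI_int (m : ℤ) : expTwoPiI m = 1 := by
  rw [expTwoPiI, Complex.exp_eq_one_iff]
  exact ⟨m, by ring⟩

theorem expTwoPiI_congr {a b : ℂ} (h : ∃ m : ℤ, a = b + m) : expTwoPiI a = expTwoPiI b := by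
  obtain ⟨m, rfl⟩ := h
  rw [expTwoPiI_add, expTwoPiI_int, mul_one]

theorem expTwoPiI_eq_one_iff (a : ℂ) : expTwoPiI a = 1 ↔ ∃ m : ℤ, a = m := by
  rw [expTwoPiI, Complex.exp_eq_one_iff]
  refine exists_congr fun m => ?_
  rw [mul_comm (m : ℂ), mul_right_inj' Complex.two_pi_I_ne_zero]

theorem expTwoPiI_neg (a : ℂ) : expTwoPiI (-a) = (expTwoPiI a)⁻¹ := by
  simp [expTwoPiI, Complex.exp_neg]

theorem expTwoPiI_int_mul (m : ℤ) (a : ℂ) : expTwoPiI (m * a) = expTwoPiI a ^ m := by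
  rw [expTwoPiI, expTwoPiI, ← Complex.exp_int_mul]
  ring_nf

theorem norm_expTwoPiI (a : ℂ) : ‖expTwoPiI a‖ = Real.exp (-(2 * Real.pi * a.im)) := by
  rw [expTwoPiI, Complex.norm_exp]
  congr 1
  simp

theorem conj_expTwoPiI (a : ℂ) :
    (starRingEnd ℂ) (expTwoPiI a) = expTwoPiI (-(starRingEnd ℂ a)) := by
  rw [expTwoPiI, ← Complex.exp_conj, expTwoPiI]
  congr 1
  simp only [map_mul, Complex.conj_I, Complex.conj_ofReal, map_ofNat]
  ring

theorem differentiable_expTwoPiI : Differentiable ℂ expTwoPiI := by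
  unfold expTwoPiI
  fun_prop

theorem continuous_expTwoPiI : Continuous expTwoPiI := differentiable_expTwoPiI.continuous

namespace EvenLattice

variable {n : ℕ} (L : EvenLattice n)

/-! ### The bilinear and the quadratic form -/

section Forms

variable {R : Type*} [CommRing R]

theorem bil_add_left (u v w : Fin n → R) : L.bil (u + v) w = L.bil u w + L.bil v w :=
  add_dotProduct _ _ _

theorem bil_add_right (u v w : Fin n → R) : L.bil u (v + w) = L.bil u v + L.bil u w := by
  simp [bil, Matrix.mulVec_add, dotProduct_add]

theorem bil_smul_left (c : R) (v w : Fin n → R) : L.bil (c • v) w = c * L.bil v w :=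
  smul_dotProduct _ _ _

theorem bil_smul_right (c : R) (v w : Fin n → R) : L.bil v (c • w) = c * L.bil v w := by
  simp [bil, Matrix.mulVec_smul, dotProduct_smul]

theorem bil_comm (v w : Fin n → R) : L.bil v w = L.bil w v := by
  have h : (L.gram.map (Int.cast : ℤ → R)).transpose = L.gram.map (Int.cast : ℤ → R) := by
    rw [← Matrix.transpose_map, L.symm.eq]
  rw [bil, bil, Matrix.dotProduct_mulVec, dotProduct_comm, ← Matrix.mulVec_transpose, h]

theorem bil_zero_left (w : Fin n → R) : L.bil 0 w = 0 := zero_dotProduct _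

theorem bil_zero_right (w : Fin n → R) : L.bil w 0 = 0 := by rw [bil_comm, bil_zero_left]

theorem bil_neg_left (v w : Fin n → R) : L.bil (-v) w = -L.bil v w := neg_dotProduct _ _

theorem bil_neg_right (v w : Fin n → R) : L.bil v (-w) = -L.bil v w := by
  rw [bil_comm, bil_neg_left, bil_comm]

theorem bil_sub_right (u v w : Fin n → R) : L.bil u (v - w) = L.bil u v - L.bil u w := by
  rw [sub_eq_add_neg, bil_add_right, bil_neg_right, sub_eq_add_neg]

theorem bil_sub_left (u v w : Fin n → R) : L.bil (u - v) w = L.bil u w - L.bil v w := by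
  rw [bil_comm, bil_sub_right, bil_comm, L.bil_comm w]

theorem map_bil {S : Type*} [CommRing S] (f : R →+* S) (v w : Fin n → R) :
    f (L.bil v w) = L.bil (fun i => f (v i)) (fun i => f (w i)) := by
  simp [bil, dotProduct, Matrix.mulVec]

end Forms

section Quad

variable {R : Type*} [Field R]

theorem quad_smul (c : R) (v : Fin n → R) : L.quad (c • v) = c ^ 2 * L.quad v := by
  rw [quad, bil_smul_left, bil_smul_right, quad]
  ring

theorem quad_zero : L.quad (0 : Fin n → R) = 0 := by simp [quad, bil_zero_left]

theorem quad_neg (v : Fin n → R) : L.quad (-v) = L.quad v := by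
  rw [quad, bil_neg_left, bil_neg_right, neg_neg, quad]

theorem map_quad {S : Type*} [Field S] (f : R →+* S) (v : Fin n → R) :
    f (L.quad v) = L.quad (fun i => f (v i)) := by
  rw [quad, quad, map_div₀, map_bil, map_ofNat]

variable [CharZero R]

theorem quad_add (v w : Fin n → R) : L.quad (v + w) = L.quad v + L.bil v w + L.quad w := by
  rw [quad, quad, quad, bil_add_left, bil_add_right, bil_add_right, L.bil_comm w v]
  ring

theorem quad_sub (v w : Fin n → R) : L.quad (v - w) = L.quad v - L.bil v w + L.quad w := by
  rw [sub_eq_add_neg, quad_add, quad_neg, bil_neg_right, sub_eq_add_neg]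

theorem bil_self (v : Fin n → R) : L.bil v v = 2 * L.quad v := by
  rw [quad]; field_simp

end Quad

/-- The vector in `ℂⁿ` with given integral coordinates. -/
def intC (u : Fin n → ℤ) : Fin n → ℂ := fun i => (u i : ℂ)

theorem intC_add (u v : Fin n → ℤ) : intC (u + v) = intC u + intC v := by
  ext; simp [intC]

theorem intC_zsmul (c : ℤ) (v : Fin n → ℤ) : intC (c • v) = (c : ℂ) • intC v := by
  ext; simp [intC]

theorem intC_zero : intC (0 : Fin n → ℤ) = 0 := by
  ext; simp [intC]

theorem bil_intC (u v : Fin n → ℤ) : L.bil (intC u) (intC v) = (L.bil u v : ℤ) :=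
  (L.map_bil (Int.castRingHom ℂ) u v).symm

/-- The only place where the evenness of the lattice enters; through it, phases such as `e(β(u))`
disappear. -/
theorem exists_quad_intC (u : Fin n → ℤ) : ∃ m : ℤ, L.quad (intC u) = m := by
  obtain ⟨m, hm⟩ := L.even u
  refine ⟨m, ?_⟩
  have : L.bil u u = m + m := by
    rw [← hm, bil]
    congr 2
  rw [quad, bil_intC, this]
  push_cast
  ring

theorem toC_add (r s : L.dual) : L.toC (r + s) = L.toC r + L.toC s := by
  ext; simp [toC]

theorem toC_neg (r : L.dual) : L.toC (-r) = -L.toC r := by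
  ext; simp [toC]

theorem toC_zero : L.toC 0 = 0 := by
  ext; simp [toC]

theorem toC_zsmul (c : ℤ) (r : L.dual) : L.toC (c • r) = (c : ℂ) • L.toC r := by
  ext; simp [toC]

theorem bil_toC (r s : L.dual) :
    L.bil (L.toC r) (L.toC s) = ((L.bil (r : Fin n → ℚ) (s : Fin n → ℚ) : ℚ) : ℂ) :=
  (L.map_bil (Rat.castHom ℂ) r s).symm

theorem quad_toC (r : L.dual) : L.quad (L.toC r) = ((L.quad (r : Fin n → ℚ) : ℚ) : ℂ) :=
  (L.map_quad (Rat.castHom ℂ) r).symm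

theorem exists_bil_toC_intC (r : L.dual) (u : Fin n → ℤ) :
    ∃ m : ℤ, L.bil (L.toC r) (intC u) = m := by
  obtain ⟨m, hm⟩ := r.2 u
  refine ⟨m, ?_⟩
  have := congrArg (Rat.castHom ℂ) hm
  rw [map_bil, map_intCast] at this
  rw [← this]
  congr 1

/-- The inclusion of `L` into `L^#`. -/
def ofInt (u : Fin n → ℤ) : L.dual :=
  ⟨fun i => (u i : ℚ), fun w => ⟨L.bil u w, (L.map_bil (Int.castRingHom ℚ) u w).symm⟩⟩

theorem toC_ofInt (u : Fin n → ℤ) : L.toC (L.ofInt u) = intC u := by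
  ext; simp [toC, ofInt, intC]

theorem ofInt_injective : Function.Injective L.ofInt := by
  intro u v h
  ext i
  have := congrArg (fun r : L.dual => (r : Fin n → ℚ) i) h
  simpa [ofInt] using this

theorem mk_eq_mk_iff (r s : L.dual) :
    (QuotientAddGroup.mk r : L.disc) = QuotientAddGroup.mk s ↔ ∃ u, s = r + L.ofInt u := by
  rw [QuotientAddGroup.eq, AddSubgroup.mem_addSubgroupOf]
  constructor
  · rintro ⟨u, hu⟩
    refine ⟨u, Subtype.ext ?_⟩
    have : (s : Fin n → ℚ) = r + (-r + s : L.dual) := by simp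
    rw [this, hu]
    rfl
  · rintro ⟨u, rfl⟩
    exact ⟨u, by simp [ofInt]⟩

theorem mk_rep (x : L.disc) : (QuotientAddGroup.mk (L.rep x) : L.disc) = x := Quotient.out_eq x

/-- A class `x ∈ L^# / L` is a translate of `L = ℤⁿ`. -/
def classEquiv (r : L.dual) (x : L.disc) (hx : QuotientAddGroup.mk r = x) :
    (Fin n → ℤ) ≃ {s : L.dual // (QuotientAddGroup.mk s : L.disc) = x} :=
  Equiv.ofBijective
    (fun u => ⟨r + L.ofInt u, by rw [← hx, eq_comm, mk_eq_mk_iff]; exact ⟨u, rfl⟩⟩) (by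
      constructor
      · intro u v h
        exact L.ofInt_injective (add_left_cancel (congrArg Subtype.val h))
      · rintro ⟨s, hs⟩
        rw [← hx, eq_comm, mk_eq_mk_iff] at hs
        obtain ⟨u, rfl⟩ := hs
        exact ⟨u, rfl⟩)

theorem classEquiv_coe (r : L.dual) (x : L.disc) (hx : QuotientAddGroup.mk r = x)
    (u : Fin n → ℤ) : (L.classEquiv r x hx u : L.dual) = r + L.ofInt u := rfl

/-! ### The pairing of the discriminant group -/

/-- `e(β(x, y))` for `x, y ∈ L^# / L`. -/
def pair (x y : L.disc) : ℂ := expTwoPiI (L.bil (L.toC (L.rep x)) (L.toC (L.rep y)))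

/-- Other representatives `r + u`, `s + v` change the exponent by `β(r, v) + β(s, u) + β(u, v) ∈ ℤ`.
Bilinearity of `pair` is then inherited from `β`. -/
theorem pair_mk (r s : L.dual) :
    L.pair (QuotientAddGroup.mk r) (QuotientAddGroup.mk s) =
      expTwoPiI (L.bil (L.toC r) (L.toC s)) := by
  obtain ⟨u, hu⟩ := (L.mk_eq_mk_iff r (L.rep (QuotientAddGroup.mk r))).mp (L.mk_rep _).symm
  obtain ⟨v, hv⟩ := (L.mk_eq_mk_iff s (L.rep (QuotientAddGroup.mk s))).mp (L.mk_rep _).symm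
  obtain ⟨a, ha⟩ := L.exists_bil_toC_intC r v
  obtain ⟨b, hb⟩ := L.exists_bil_toC_intC s u
  rw [pair, hu, hv]
  refine expTwoPiI_congr ⟨a + b + L.bil u v, ?_⟩
  rw [toC_add, toC_add, toC_ofInt, toC_ofInt, bil_add_left, bil_add_right, bil_add_right,
    ha, bil_intC, L.bil_comm (intC u), hb]
  push_cast
  ring

theorem pair_comm (x y : L.disc) : L.pair x y = L.pair y x := by
  rw [pair, pair, bil_comm]

theorem pair_add_right (x y z : L.disc) : L.pair x (y + z) = L.pair x y * L.pair x z := by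
  induction x using QuotientAddGroup.induction_on with | H r => ?_
  induction y using QuotientAddGroup.induction_on with | H s => ?_
  induction z using QuotientAddGroup.induction_on with | H t => ?_
  rw [← QuotientAddGroup.mk_add, pair_mk, pair_mk, pair_mk, toC_add, bil_add_right, expTwoPiI_add]

theorem pair_add_left (x y z : L.disc) : L.pair (x + y) z = L.pair x z * L.pair y z := by
  rw [pair_comm, pair_add_right, pair_comm, L.pair_comm z]

theorem pair_ne_zero (x y : L.disc) : L.pair x y ≠ 0 := expTwoPiI_ne_zero _

theorem pair_zero_right (x : L.disc) : L.pair x 0 = 1 := by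
  have := L.pair_add_right x 0 0
  rw [add_zero] at this
  exact (mul_eq_left₀ (L.pair_ne_zero x 0)).mp this.symm

theorem pair_neg_right (x y : L.disc) : L.pair x (-y) = (L.pair x y)⁻¹ := by
  refine eq_inv_of_mul_eq_one_left ?_
  rw [← pair_add_right, neg_add_cancel, pair_zero_right]

theorem pair_zsmul_right (x y : L.disc) (m : ℤ) : L.pair x (m • y) = L.pair x y ^ m := by
  induction y using QuotientAddGroup.induction_on with | H s => ?_
  induction x using QuotientAddGroup.induction_on with | H r => ?_
  rw [← QuotientAddGroup.mk_zsmul, pair_mk, pair_mk, toC_zsmul, bil_smul_right, expTwoPiI_int_mul]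

theorem conj_pair (x y : L.disc) : (starRingEnd ℂ) (L.pair x y) = (L.pair x y)⁻¹ := by
  rw [pair, conj_expTwoPiI, bil_toC, ← expTwoPiI_neg]
  simp

/-- The pairing of the discriminant group is non-degenerate. -/
theorem exists_pair_ne_one {x : L.disc} (hx : x ≠ 0) : ∃ y, L.pair x y ≠ 1 := by
  by_contra! h
  apply hx
  induction x using QuotientAddGroup.induction_on with | H r => ?_
  set GQ : Matrix (Fin n) (Fin n) ℚ := L.gram.map (Int.cast : ℤ → ℚ) with hGQ
  have hdet : IsUnit GQ.det := by
    have : GQ.det = (L.gram.det : ℚ) := by rw [hGQ]; exact (Int.cast_det L.gram).symm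
    rw [this, isUnit_iff_ne_zero]
    exact_mod_cast L.gram_det_ne_zero
  have hsymm : GQ.transpose = GQ := by rw [hGQ, ← Matrix.transpose_map, L.symm.eq]
  have key : ∀ i, ∃ m : ℤ, (r : Fin n → ℚ) i = m := by
    intro i
    -- The vector `G⁻¹eᵢ` lies in `L^#` and pairs with `v` to `vᵢ`, so trivial pairing with it
    -- forces the `i`-th coordinate to be integral.
    have hs : ∀ v, L.bil v (GQ⁻¹.mulVec (Pi.single i 1)) = v i := by
      intro v
      rw [bil, ← hGQ, Matrix.mulVec_mulVec, Matrix.mul_nonsing_inv _ hdet, Matrix.one_mulVec,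
        dotProduct_single, mul_one]
    have hmem : GQ⁻¹.mulVec (Pi.single i 1) ∈ L.dual := by
      intro w
      exact ⟨w i, by rw [bil_comm, hs]⟩
    have h1 := h (QuotientAddGroup.mk ⟨_, hmem⟩)
    rw [pair_mk, expTwoPiI_eq_one_iff] at h1
    obtain ⟨m, hm⟩ := h1
    rw [bil_toC] at hm
    simp only [hs] at hm
    exact ⟨m, by exact_mod_cast hm⟩
  choose m hm using key
  rw [QuotientAddGroup.eq_zero_iff, AddSubgroup.mem_addSubgroupOf]
  exact ⟨m, funext hm⟩

/-- Orthogonality of characters: shifting the summation variable by `z` multiplies the sum by `pair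
x z`, which can be chosen `≠ 1` when `x ≠ 0`. -/
theorem sum_pair (x : L.disc) [Decidable (x = 0)] :
    ∑ y, L.pair x y = if x = 0 then (Fintype.card L.disc : ℂ) else 0 := by
  split_ifs with hx
  · subst hx
    simp [L.pair_comm 0, pair_zero_right]
  · obtain ⟨z, hz⟩ := L.exists_pair_ne_one hx
    have h1 : ∑ y, L.pair x y = L.pair x z * ∑ y, L.pair x y := by
      conv_lhs => rw [← Equiv.sum_comp (Equiv.addRight z)]
      rw [Finset.mul_sum]
      refine Finset.sum_congr rfl fun y _ => ?_
      rw [Equiv.coe_addRight, pair_add_right, mul_comm]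
    have h2 : (L.pair x z - 1) * ∑ y, L.pair x y = 0 := by rw [sub_mul, one_mul, ← h1, sub_self]
    exact (mul_eq_zero.mp h2).resolve_left (sub_ne_zero.mpr hz)

/-- Plancherel's identity for the finite Fourier transform of the discriminant group. -/
theorem sum_normSq_fourier (F : L.disc → ℂ) :
    ∑ y, ‖∑ x, L.pair y (-x) * F x‖ ^ 2 = Fintype.card L.disc * ∑ x, ‖F x‖ ^ 2 := by
  classical
  have h : ((∑ y, ‖∑ x, L.pair y (-x) * F x‖ ^ 2 : ℝ) : ℂ) =
      ((Fintype.card L.disc * ∑ x, ‖F x‖ ^ 2 : ℝ) : ℂ) := by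
    push_cast
    have e1 : ∀ y, ((‖∑ x, L.pair y (-x) * F x‖ : ℝ) : ℂ) ^ 2 =
        ∑ x, ∑ x', L.pair (x - x') y * ((starRingEnd ℂ) (F x) * F x') := by
      intro y
      rw [← Complex.conj_mul', map_sum, Finset.sum_mul_sum]
      refine Finset.sum_congr rfl fun x _ => Finset.sum_congr rfl fun x' _ => ?_
      rw [map_mul, conj_pair, pair_neg_right, inv_inv, sub_eq_add_neg, pair_add_left,
        L.pair_comm x y, L.pair_comm (-x') y]
      ring
    rw [Finset.sum_congr rfl fun y _ => e1 y, Finset.sum_comm, Finset.mul_sum]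
    refine Finset.sum_congr rfl fun x _ => ?_
    rw [Finset.sum_comm]
    simp_rw [← Finset.sum_mul, sum_pair, sub_eq_zero, ite_mul, zero_mul]
    rw [Finset.sum_ite_eq]
    simp [Complex.conj_mul']
  exact_mod_cast h

end EvenLattice

/-! ### The actions of `SL₂(ℤ)` and of the Heisenberg group -/

/-- The factor of automorphy `cτ + d`. -/
def autFactor (A : SL(2, ℤ)) (τ : ℍ) : ℂ := (A 1 0 : ℂ) * τ + (A 1 1 : ℂ)

theorem sl_det (A : SL(2, ℤ)) :
    (A 0 0 : ℂ) * (A 1 1 : ℂ) - (A 0 1 : ℂ) * (A 1 0 : ℂ) = 1 := by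
  have := A.det_coe
  rw [Matrix.det_fin_two] at this
  exact_mod_cast this

theorem coe_sl_smul (A : SL(2, ℤ)) (τ : ℍ) :
    ((A • τ : ℍ) : ℂ) = ((A 0 0 : ℂ) * τ + (A 0 1 : ℂ)) / autFactor A τ := by
  rw [UpperHalfPlane.coe_specialLinearGroup_apply]
  simp [autFactor]

theorem autFactor_ne_zero (A : SL(2, ℤ)) (τ : ℍ) : autFactor A τ ≠ 0 := by
  intro h
  have him := congrArg Complex.im h
  have hre := congrArg Complex.re h
  simp only [autFactor, Complex.add_im, Complex.mul_im, Complex.intCast_re, Complex.intCast_im,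
    zero_mul, add_zero, Complex.zero_im, mul_eq_zero, Complex.add_re, Complex.mul_re, sub_zero,
    Complex.zero_re, UpperHalfPlane.coe_im, τ.im_ne_zero, or_false] at him hre
  have hd := sl_det A
  rw [him, zero_mul, zero_add] at hre
  have h1 : (A 1 0 : ℂ) = 0 := by exact_mod_cast him
  have h2 : (A 1 1 : ℂ) = 0 := by exact_mod_cast hre
  simp [h1, h2] at hd

theorem sl_mul_apply (A B : SL(2, ℤ)) (i j : Fin 2) :
    (A * B) i j = A i 0 * B 0 j + A i 1 * B 1 j := by
  simp [Matrix.mul_apply, Fin.sum_univ_two]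

theorem autFactor_mul (A B : SL(2, ℤ)) (τ : ℍ) :
    autFactor (A * B) τ = autFactor A (B • τ) * autFactor B τ := by
  have := autFactor_ne_zero B τ
  rw [autFactor, autFactor, coe_sl_smul, sl_mul_apply, sl_mul_apply]
  field_simp
  rw [autFactor]
  push_cast
  ring

namespace EvenLattice

variable {n : ℕ} (L : EvenLattice n) (k : ℤ)

theorem slashMat_apply (φ : ℍ → (Fin n → ℂ) → ℂ) (A : SL(2, ℤ)) (τ : ℍ) (z : Fin n → ℂ) :
    L.slashMat k φ A τ z = φ (A • τ) ((autFactor A τ)⁻¹ • z) * autFactor A τ ^ (-k) *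
      expTwoPiI (-(A 1 0 : ℂ) * L.quad z / autFactor A τ) := rfl

theorem slashHeis_apply (φ : ℍ → (Fin n → ℂ) → ℂ) (u v : Fin n → ℤ) (τ : ℍ) (z : Fin n → ℂ) :
    L.slashHeis φ u v τ z = φ τ (z + (τ : ℂ) • intC u + intC v) *
      expTwoPiI (τ * L.quad (intC u) + L.bil (intC u) z) := rfl

/-- The exponentials match because `c_{AB} j_B = c_A + c_B j_A j_B`, where `j_A` is taken at `Bτ`;
this uses `det B = 1`. -/
theorem slashMat_mul (φ : ℍ → (Fin n → ℂ) → ℂ) (A B : SL(2, ℤ)) :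
    L.slashMat k (L.slashMat k φ A) B = L.slashMat k φ (A * B) := by
  funext τ z
  simp only [slashMat_apply]
  have hA := autFactor_ne_zero A (B • τ)
  have hB := autFactor_ne_zero B τ
  rw [autFactor_mul, mul_inv, mul_smul A B τ, mul_smul (_⁻¹) _ z, mul_zpow, quad_smul]
  have : expTwoPiI (-((A * B) 1 0 : ℂ) * L.quad z / (autFactor A (B • τ) * autFactor B τ)) =
      expTwoPiI (-(A 1 0 : ℂ) * ((autFactor B τ)⁻¹ ^ 2 * L.quad z) / autFactor A (B • τ)) *
        expTwoPiI (-(B 1 0 : ℂ) * L.quad z / autFactor B τ) := by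
    rw [← expTwoPiI_add]
    congr 1
    field_simp
    have hJ : autFactor B τ = (B 1 0 : ℂ) * τ + (B 1 1 : ℂ) := rfl
    have hj : autFactor A (B • τ) * autFactor B τ =
        A 1 0 * ((B 0 0 : ℂ) * τ + (B 0 1 : ℂ)) + A 1 1 * autFactor B τ := by
      nth_rw 1 [autFactor]
      rw [coe_sl_smul]
      field_simp
    have hd := sl_det B
    rw [sl_mul_apply]
    push_cast
    linear_combination (L.quad z * B 1 0) * hj - (A 1 0 * B 0 0 * L.quad z) * hJ -
      (L.quad z * A 1 0) * hd
  rw [this]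
  ring

theorem slashMat_one (φ : ℍ → (Fin n → ℂ) → ℂ) : L.slashMat k φ 1 = φ := by
  funext τ z
  simp [slashMat_apply, autFactor, expTwoPiI_zero]

/-- The action of a pair of vectors of `L ⊗ ℂ`, normalized by a symmetric cocycle. -/
def translate (p q : Fin n → ℂ) (φ : ℍ → (Fin n → ℂ) → ℂ) : ℍ → (Fin n → ℂ) → ℂ := fun τ z =>
  φ τ (z + (τ : ℂ) • p + q) * expTwoPiI (τ * L.quad p + L.bil p z + L.bil p q / 2)

theorem slashHeis_eq_translate (φ : ℍ → (Fin n → ℂ) → ℂ) (u v : Fin n → ℤ) (τ : ℍ)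
    (z : Fin n → ℂ) : L.slashHeis φ u v τ z =
      expTwoPiI (-(L.bil (intC u) (intC v) / 2)) * L.translate (intC u) (intC v) φ τ z := by
  rw [slashHeis_apply, translate, expTwoPiI_add _ (_ / 2), expTwoPiI_neg]
  field_simp [expTwoPiI_ne_zero]

/-- The factor `e(β(p, q)/2)` in `translate` is chosen so that no phase remains here, for arbitrary
complex `p`, `q`. The identity serves both the Heisenberg action of `L × L` and the translations by
multiples of an element of `L^#`. -/
theorem slashMat_translate (φ : ℍ → (Fin n → ℂ) → ℂ) (A : SL(2, ℤ)) (p q : Fin n → ℂ) :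
    L.slashMat k (L.translate p q φ) A =
      L.translate ((A 0 0 : ℂ) • p + (A 1 0 : ℂ) • q) ((A 0 1 : ℂ) • p + (A 1 1 : ℂ) • q)
        (L.slashMat k φ A) := by
  funext τ z
  have hj := autFactor_ne_zero A τ
  have hd := sl_det A
  simp only [slashMat_apply, translate]
  have harg : (autFactor A τ)⁻¹ • (z + (τ : ℂ) • ((A 0 0 : ℂ) • p + (A 1 0 : ℂ) • q) +
      ((A 0 1 : ℂ) • p + (A 1 1 : ℂ) • q)) =
      (autFactor A τ)⁻¹ • z + ((A • τ : ℍ) : ℂ) • p + q := by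
    rw [coe_sl_smul]
    funext i
    simp only [Pi.smul_apply, Pi.add_apply, smul_eq_mul]
    field_simp
    rw [autFactor]
    ring
  rw [harg]
  have hexp : expTwoPiI (((A • τ : ℍ) : ℂ) * L.quad p + L.bil p ((autFactor A τ)⁻¹ • z) +
        L.bil p q / 2) * expTwoPiI (-(A 1 0 : ℂ) * L.quad z / autFactor A τ) =
      expTwoPiI (-(A 1 0 : ℂ) * L.quad (z + (τ : ℂ) • ((A 0 0 : ℂ) • p + (A 1 0 : ℂ) • q) +
        ((A 0 1 : ℂ) • p + (A 1 1 : ℂ) • q)) / autFactor A τ) *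
      expTwoPiI (τ * L.quad ((A 0 0 : ℂ) • p + (A 1 0 : ℂ) • q) +
        L.bil ((A 0 0 : ℂ) • p + (A 1 0 : ℂ) • q) z +
        L.bil ((A 0 0 : ℂ) • p + (A 1 0 : ℂ) • q) ((A 0 1 : ℂ) • p + (A 1 1 : ℂ) • q) / 2) := by
    rw [← expTwoPiI_add, ← expTwoPiI_add]
    congr 1
    rw [coe_sl_smul]
    simp only [quad_add, quad_smul, bil_add_left, bil_add_right, bil_smul_left, bil_smul_right,
      L.bil_comm q p, L.bil_comm z p, L.bil_comm z q, bil_self]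
    field_simp
    rw [autFactor]
    generalize L.quad p = P
    generalize L.quad q = Q
    generalize L.quad z = Z
    generalize L.bil p q = PQ
    generalize L.bil p z = PZ
    generalize L.bil q z = QZ
    linear_combination (-(2 * ((A 0 0 : ℂ) * τ + A 0 1) * P + 2 * PZ +
      ((A 1 0 : ℂ) * τ + A 1 1) * PQ)) * hd
  linear_combination (φ (A • τ) ((autFactor A τ)⁻¹ • z + ((A • τ : ℍ) : ℂ) • p + q) *
    autFactor A τ ^ (-k)) * hexp

/-- The phase between `slashHeis` and `translate` is the sign `e(-β(u, v)/2)`. It is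
`SL₂(ℤ)`-invariant: the exponent changes by `abβ(u) + cdβ(v) + bcβ(u, v)` up to sign, an integer
since `L` is even. -/
theorem exists_slash_phase (A : SL(2, ℤ)) (u v : Fin n → ℤ) : ∃ m : ℤ,
    L.bil (intC (A 0 0 • u + A 1 0 • v)) (intC (A 0 1 • u + A 1 1 • v)) / 2 =
      L.bil (intC u) (intC v) / 2 + m := by
  obtain ⟨a, ha⟩ := L.exists_quad_intC u
  obtain ⟨b, hb⟩ := L.exists_quad_intC v
  refine ⟨A 0 0 * A 0 1 * a + A 1 0 * A 1 1 * b + A 0 1 * A 1 0 * L.bil u v, ?_⟩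
  have hd := sl_det A
  simp only [intC_add, intC_zsmul, bil_add_left, bil_add_right, bil_smul_left, bil_smul_right,
    bil_self, ha, hb, L.bil_comm (intC v) (intC u), bil_intC]
  push_cast
  linear_combination (((L.bil u v : ℤ) : ℂ) / 2) * hd

theorem slashMat_const_mul (c : ℂ) (φ : ℍ → (Fin n → ℂ) → ℂ) (A : SL(2, ℤ)) :
    L.slashMat k (fun τ z => c * φ τ z) A = fun τ z => c * L.slashMat k φ A τ z := by
  funext τ z
  simp only [slashMat_apply]
  ring

theorem slashMat_slashHeis (φ : ℍ → (Fin n → ℂ) → ℂ) (A : SL(2, ℤ)) (u v : Fin n → ℤ) :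
    L.slashMat k (L.slashHeis φ u v) A =
      L.slashHeis (L.slashMat k φ A) (A 0 0 • u + A 1 0 • v) (A 0 1 • u + A 1 1 • v) := by
  have h1 : L.slashHeis φ u v = fun τ z => expTwoPiI (-(L.bil (intC u) (intC v) / 2)) *
      L.translate (intC u) (intC v) φ τ z := by
    funext τ z
    exact L.slashHeis_eq_translate φ u v τ z
  funext τ z
  obtain ⟨m, hm⟩ := L.exists_slash_phase A u v
  rw [h1, slashMat_const_mul, slashMat_translate, slashHeis_eq_translate,
    show expTwoPiI (-(L.bil (intC u) (intC v) / 2)) = expTwoPiI (-(L.bil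
      (intC (A 0 0 • u + A 1 0 • v)) (intC (A 0 1 • u + A 1 1 • v)) / 2)) from
      expTwoPiI_congr ⟨m, by rw [hm]; ring⟩]
  simp only [intC_add, intC_zsmul]

/-- The cocycle `e(β(u, v'))` is trivial on integral vectors, so the central part of the Heisenberg
group can be dropped. -/
theorem slashHeis_slashHeis (φ : ℍ → (Fin n → ℂ) → ℂ) (u v u' v' : Fin n → ℤ) :
    L.slashHeis (L.slashHeis φ u v) u' v' = L.slashHeis φ (u + u') (v + v') := by
  funext τ z
  rw [slashHeis_apply, slashHeis_apply, slashHeis_apply, mul_assoc, ← expTwoPiI_add]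
  congr 1
  · congr 1
    simp only [intC_add]
    module
  · refine expTwoPiI_congr ⟨L.bil u v', ?_⟩
    simp only [intC_add, bil_add_left, bil_add_right, quad_add, bil_smul_right, bil_intC]
    ring

theorem slash_slash (φ : ℍ → (Fin n → ℂ) → ℂ) (g h : JacobiGroup n) :
    L.slash k (L.slash k φ g) h = L.slash k φ (g * h) := by
  simp only [slash]
  rw [slashMat_slashHeis, slashMat_mul, slashHeis_slashHeis]
  rfl

end EvenLattice

/-! ### Gaussian sums over `ℤⁿ` and positivity of the form over `ℝ` -/

theorem summable_pi_prod {g : ℤ → ℝ} (hg : Summable g) (h0 : 0 ≤ g) (n : ℕ) :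
    Summable fun u : Fin n → ℤ => ∏ i, g (u i) := by
  induction n with
  | zero => exact (hasSum_fintype _).summable
  | succ n ih =>
    rw [← (Fin.consEquiv fun _ => ℤ).summable_iff]
    refine (hg.mul_of_nonneg ih h0 fun u => Finset.prod_nonneg fun i _ => h0 _).congr ?_
    rintro ⟨a, u⟩
    simp [Fin.consEquiv, Fin.prod_univ_succ]

theorem summable_exp_neg_mul_sq {a : ℝ} (ha : 0 < a) :
    Summable fun m : ℤ => Real.exp (-a * (m : ℝ) ^ 2) := by
  have hnat : Summable fun m : ℕ => Real.exp (-a * (m : ℝ) ^ 2) := by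
    refine Summable.of_nonneg_of_le (fun _ => (Real.exp_pos _).le) (fun m => ?_)
      (Real.summable_exp_nat_mul_iff.mpr (neg_lt_zero.mpr ha))
    rw [Real.exp_le_exp]
    have h : (m : ℝ) ≤ (m : ℝ) ^ 2 := by exact_mod_cast Nat.le_self_pow two_ne_zero m
    nlinarith
  refine Summable.of_nat_of_neg (by simpa using hnat) (by simpa using hnat)

theorem summable_exp_sum_sq {a : ℝ} (ha : 0 < a) (n : ℕ) :
    Summable fun u : Fin n → ℤ => Real.exp (-a * ∑ i, (u i : ℝ) ^ 2) := by
  refine (summable_pi_prod (summable_exp_neg_mul_sq ha) (fun _ => (Real.exp_pos _).le) n).congr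
    fun u => ?_
  rw [Finset.mul_sum, Real.exp_sum]

namespace EvenLattice

variable {n : ℕ} (L : EvenLattice n)

/-- The complexification of a real vector. -/
def realC (v : Fin n → ℝ) : Fin n → ℂ := fun i => (v i : ℂ)

theorem bil_realC (v w : Fin n → ℝ) : L.bil (realC v) (realC w) = (L.bil v w : ℝ) :=
  (L.map_bil Complex.ofRealHom v w).symm

theorem quad_realC (v : Fin n → ℝ) : L.quad (realC v) = (L.quad v : ℝ) :=
  (L.map_quad Complex.ofRealHom v).symm

theorem bil_int_nonneg (v : Fin n → ℤ) : 0 ≤ L.bil v v := by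
  have h : L.bil v v = v ⬝ᵥ L.gram.mulVec v := by
    rw [bil]
    congr 2
  by_cases hv : v = 0
  · simp [hv, bil_zero_left]
  · rw [h]
    exact (L.pos v hv).le

/-- Positivity passes from `ℤⁿ` to `ℚⁿ` by clearing denominators and then to `ℝⁿ` by density. The
limit only gives semidefiniteness; definiteness over `ℝ` returns through `det G ≠ 0`, which makes
the factor `M` in `G = MᵗM` invertible. -/
theorem bil_rat_nonneg (v : Fin n → ℚ) : 0 ≤ L.bil v v := by
  obtain ⟨d, hd, w, hw⟩ : ∃ d : ℤ, d ≠ 0 ∧ ∃ w : Fin n → ℤ, ∀ i, (d : ℚ) * v i = w i := by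
    refine ⟨∏ i, ((v i).den : ℤ), Finset.prod_ne_zero_iff.mpr fun i _ => by simp,
      fun i => (∏ j ∈ Finset.univ.erase i, ((v j).den : ℤ)) * (v i).num, fun i => ?_⟩
    rw [← Finset.prod_erase_mul _ _ (Finset.mem_univ i)]
    push_cast
    rw [mul_assoc, Rat.den_mul_eq_num]
  have h1 : (d : ℚ) * ((d : ℚ) * L.bil v v) = (L.bil w w : ℤ) := by
    rw [← bil_smul_right, ← bil_smul_left]
    have : (d : ℚ) • v = fun i => (Int.castRingHom ℚ) (w i) := funext hw
    rw [this, ← map_bil]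
    rfl
  have h2 : (0 : ℚ) ≤ (L.bil w w : ℤ) := by exact_mod_cast L.bil_int_nonneg w
  rw [← h1, ← mul_assoc] at h2
  exact nonneg_of_mul_nonneg_right h2 (mul_self_pos.mpr (by exact_mod_cast hd))

theorem bil_real_nonneg (v : Fin n → ℝ) : 0 ≤ L.bil v v := by
  have hd : DenseRange fun (v : Fin n → ℚ) (i : Fin n) => ((v i : ℚ) : ℝ) :=
    DenseRange.piMap fun _ => Rat.denseRange_cast
  refine hd.induction_on (p := fun v : Fin n → ℝ => 0 ≤ L.bil v v) v ?_ fun w => ?_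
  · refine isClosed_le continuous_const ?_
    unfold bil
    fun_prop
  · have := L.map_bil (Rat.castHom ℝ) w w
    have h2 := L.bil_rat_nonneg w
    rw [show L.bil (fun i => ((w i : ℚ) : ℝ)) (fun i => ((w i : ℚ) : ℝ)) =
      (Rat.castHom ℝ) (L.bil w w) from this.symm]
    simpa using h2

open scoped MatrixOrder in
theorem exists_gram_factor :
    ∃ M : Matrix (Fin n) (Fin n) ℝ, L.gram.map (Int.cast : ℤ → ℝ) = M.transpose * M := by
  have hpos : (L.gram.map (Int.cast : ℤ → ℝ)).PosSemidef := by
    rw [Matrix.posSemidef_iff_dotProduct_mulVec]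
    refine ⟨?_, fun v => by simpa [bil] using L.bil_real_nonneg v⟩
    rw [Matrix.IsHermitian, Matrix.conjTranspose_eq_transpose_of_trivial, ← Matrix.transpose_map,
      L.symm.eq]
  obtain ⟨M, hM⟩ := CStarAlgebra.nonneg_iff_eq_star_mul_self.mp hpos.nonneg
  exact ⟨M, by rw [hM, Matrix.star_eq_conjTranspose,
    Matrix.conjTranspose_eq_transpose_of_trivial]⟩

/-- A real matrix `M` with `G = Mᵗ M`. -/
def gramFactor : Matrix (Fin n) (Fin n) ℝ := Classical.choose L.exists_gram_factor

theorem gramFactor_spec :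
    L.gram.map (Int.cast : ℤ → ℝ) = L.gramFactor.transpose * L.gramFactor :=
  Classical.choose_spec L.exists_gram_factor

theorem det_gramFactor_sq : L.gramFactor.det ^ 2 = L.gram.det := by
  have h := congrArg Matrix.det L.gramFactor_spec
  rw [Matrix.det_mul, Matrix.det_transpose, ← sq] at h
  rw [← h]
  exact (Int.cast_det L.gram).symm

theorem det_gramFactor_ne_zero : L.gramFactor.det ≠ 0 := by
  have h := L.det_gramFactor_sq
  intro h0
  rw [h0, sq, zero_mul] at h
  exact L.gram_det_ne_zero (by exact_mod_cast h.symm)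

theorem bil_eq_gramFactor (v w : Fin n → ℝ) :
    L.bil v w = L.gramFactor.mulVec v ⬝ᵥ L.gramFactor.mulVec w := by
  rw [bil, gramFactor_spec, ← Matrix.mulVec_mulVec, Matrix.dotProduct_mulVec,
    Matrix.vecMul_transpose]

theorem exists_quad_lower_bound : ∃ c : ℝ, 0 < c ∧ ∀ v : Fin n → ℝ, c * ‖v‖ ^ 2 ≤ L.quad v := by
  set f := LinearMap.toContinuousLinearMap (Matrix.toLin' L.gramFactor⁻¹) with hf
  have h1 : ∀ v : Fin n → ℝ, ‖v‖ ≤ (‖f‖ + 1) * ‖L.gramFactor.mulVec v‖ := by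
    intro v
    have h2 : f (L.gramFactor.mulVec v) = v := by
      simp [hf, Matrix.toLin'_apply, Matrix.mulVec_mulVec,
        Matrix.nonsing_inv_mul _ (isUnit_iff_ne_zero.mpr L.det_gramFactor_ne_zero)]
    calc ‖v‖ = ‖f (L.gramFactor.mulVec v)‖ := by rw [h2]
      _ ≤ ‖f‖ * ‖L.gramFactor.mulVec v‖ := f.le_opNorm _
      _ ≤ _ := by nlinarith [norm_nonneg (L.gramFactor.mulVec v)]
  have hK : 0 < ‖f‖ + 1 := by positivity
  -- With `f = M⁻¹` one has `‖v‖ ≤ ‖f‖ ‖Mv‖` and `‖Mv‖² ≤ β(v, v) = 2β(v)`. The summand `1` keeps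
  -- the denominator positive even if `f = 0`, as for `n = 0`.
  refine ⟨1 / (2 * (‖f‖ + 1) ^ 2), by positivity, fun v => ?_⟩
  have h3 : ‖L.gramFactor.mulVec v‖ ^ 2 ≤ L.bil v v := by
    rw [bil_eq_gramFactor]
    set w := L.gramFactor.mulVec v
    have hw : 0 ≤ w ⬝ᵥ w := Finset.sum_nonneg fun i _ => mul_self_nonneg _
    have : ‖w‖ ≤ Real.sqrt (w ⬝ᵥ w) := by
      refine (pi_norm_le_iff_of_nonneg (Real.sqrt_nonneg _)).mpr fun i => ?_
      rw [Real.norm_eq_abs, ← Real.sqrt_sq_eq_abs]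
      refine Real.sqrt_le_sqrt ?_
      rw [sq]
      exact Finset.single_le_sum (f := fun i => w i * w i) (fun i _ => mul_self_nonneg _)
        (Finset.mem_univ i)
    calc ‖w‖ ^ 2 ≤ Real.sqrt (w ⬝ᵥ w) ^ 2 := by gcongr
      _ = _ := Real.sq_sqrt hw
  have h4 : ‖v‖ ^ 2 ≤ (‖f‖ + 1) ^ 2 * L.bil v v := by
    calc ‖v‖ ^ 2 ≤ ((‖f‖ + 1) * ‖L.gramFactor.mulVec v‖) ^ 2 := by gcongr; exact h1 v
      _ = (‖f‖ + 1) ^ 2 * ‖L.gramFactor.mulVec v‖ ^ 2 := by ring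
      _ ≤ _ := by gcongr
  rw [quad, div_mul_eq_mul_div, one_mul, div_le_div_iff₀ (by positivity) two_pos]
  nlinarith

theorem exists_bil_upper_bound :
    ∃ K : ℝ, 0 ≤ K ∧ ∀ v w : Fin n → ℝ, |L.bil v w| ≤ K * ‖v‖ * ‖w‖ := by
  set f := LinearMap.toContinuousLinearMap (Matrix.toLin' (L.gram.map (Int.cast : ℤ → ℝ))) with hf
  refine ⟨n * ‖f‖, by positivity, fun v w => ?_⟩
  calc |L.bil v w| = |∑ i, v i * f w i| := rfl
    _ ≤ ∑ i, |v i * f w i| := Finset.abs_sum_le_sum_abs _ _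
    _ ≤ ∑ _i : Fin n, ‖v‖ * (‖f‖ * ‖w‖) := by
        refine Finset.sum_le_sum fun i _ => ?_
        rw [abs_mul]
        gcongr
        · exact norm_le_pi_norm v i
        · exact (norm_le_pi_norm (f w) i).trans (f.le_opNorm w)
    _ = _ := by simp; ring

theorem im_gaussian (τ : ℂ) (r : Fin n → ℝ) (z : Fin n → ℂ) :
    (τ * L.quad (realC r) + L.bil (realC r) z).im =
      τ.im * L.quad r + L.bil r (fun i => (z i).im) := by
  have hz : z = realC (fun i => (z i).re) + Complex.I • realC (fun i => (z i).im) := by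
    funext i
    simp only [realC, Pi.add_apply, Pi.smul_apply, smul_eq_mul]
    rw [mul_comm]
    exact (Complex.re_add_im _).symm
  conv_lhs => rw [hz]
  rw [bil_add_right, bil_smul_right, bil_realC, bil_realC, quad_realC]
  simp

/-- The terms of the theta series are dominated by a summable sequence, uniformly for
`Im τ ≥ δ` and `|z| ≤ R`. -/
theorem exists_summable_bound (r : Fin n → ℝ) {δ R : ℝ} (hδ : 0 < δ) (hR : 0 ≤ R) :
    ∃ w : (Fin n → ℤ) → ℝ, Summable w ∧ ∀ (τ : ℂ) (z : Fin n → ℂ) (u : Fin n → ℤ),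
      δ ≤ τ.im → ‖z‖ ≤ R →
        ‖expTwoPiI (τ * L.quad (realC r + intC u) + L.bil (realC r + intC u) z)‖ ≤ w u := by
  obtain ⟨c, hc, hq⟩ := L.exists_quad_lower_bound
  obtain ⟨K, hK, hb⟩ := L.exists_bil_upper_bound
  set a : ℝ := 2 * Real.pi * (δ * c) with ha
  set b : ℝ := 2 * Real.pi * (K * R) with hbdef
  have ha0 : 0 < a := by positivity
  -- The exponent is at most `-a‖s‖² + b‖s‖ ≤ -(a/2)‖s‖² + b²/(2a)`, by completing the square. Since
  -- `‖u‖² ≤ 2‖s‖² + 2‖r‖²` and `∑ uᵢ² ≤ (n + 1)‖u‖²` for the sup norm, the rest of the Gaussian in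
  -- `s` dominates one in `u` at the cost of `(a/2)‖r‖²`.
  set C : ℝ := b ^ 2 / (2 * a) + a / 2 * ‖r‖ ^ 2 with hC
  refine ⟨fun u => Real.exp C * Real.exp (-(a / (4 * (n + 1))) * ∑ i, (u i : ℝ) ^ 2),
    (summable_exp_sum_sq (by positivity) n).mul_left _, fun τ z u hτ hz => ?_⟩
  set s : Fin n → ℝ := r + fun i => (u i : ℝ) with hs
  have hrs : realC r + intC u = realC s := by
    ext i; simp [hs, realC, intC]
  beta_reduce
  rw [hrs, norm_expTwoPiI, im_gaussian, ← Real.exp_add, Real.exp_le_exp]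
  have h1 : δ * (c * ‖s‖ ^ 2) ≤ τ.im * L.quad s :=
    mul_le_mul hτ (hq s) (by positivity) (hδ.le.trans hτ)
  have h2 : -(K * ‖s‖ * R) ≤ L.bil s (fun i => (z i).im) := by
    refine neg_le_of_abs_le ((hb _ _).trans ?_)
    gcongr
    refine (pi_norm_le_iff_of_nonneg hR).mpr fun i => ?_
    exact (Complex.abs_im_le_norm _).trans ((norm_le_pi_norm z i).trans hz)
  have h3 : -(2 * Real.pi * (τ.im * L.quad s + L.bil s fun i => (z i).im)) ≤
      -a * ‖s‖ ^ 2 + b * ‖s‖ := by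
    have := mul_le_mul_of_nonneg_left (add_le_add h1 h2) (by positivity : 0 ≤ 2 * Real.pi)
    rw [ha, hbdef]
    linarith
  have h4 : b * ‖s‖ ≤ b ^ 2 / (2 * a) + a / 2 * ‖s‖ ^ 2 := by
    have : b ^ 2 / (2 * a) + a / 2 * ‖s‖ ^ 2 - b * ‖s‖ = (b - a * ‖s‖) ^ 2 / (2 * a) := by
      field_simp
      ring
    have h5 : 0 ≤ (b - a * ‖s‖) ^ 2 / (2 * a) := by positivity
    linarith
  have h6 : ‖(fun i => (u i : ℝ))‖ ^ 2 ≤ 2 * ‖s‖ ^ 2 + 2 * ‖r‖ ^ 2 := by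
    have : ‖(fun i => (u i : ℝ))‖ ≤ ‖s‖ + ‖r‖ := by
      have h : (fun i => (u i : ℝ)) = s - r := by simp [hs]
      rw [h]
      exact norm_sub_le _ _
    nlinarith [norm_nonneg (fun i => (u i : ℝ)), sq_nonneg (‖s‖ - ‖r‖)]
  have h7 : ∑ i, (u i : ℝ) ^ 2 ≤ (n + 1) * ‖(fun i => (u i : ℝ))‖ ^ 2 := by
    calc ∑ i, (u i : ℝ) ^ 2 ≤ ∑ _i : Fin n, ‖(fun i => (u i : ℝ))‖ ^ 2 := by
          refine Finset.sum_le_sum fun i _ => ?_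
          rw [← sq_abs]
          gcongr
          exact norm_le_pi_norm (fun i => (u i : ℝ)) i
      _ ≤ _ := by simp; nlinarith [sq_nonneg ‖(fun i => (u i : ℝ))‖]
  have h8 : a / (4 * (n + 1)) * ∑ i, (u i : ℝ) ^ 2 ≤ a / 4 * (2 * ‖s‖ ^ 2 + 2 * ‖r‖ ^ 2) := by
    calc a / (4 * (n + 1)) * ∑ i, (u i : ℝ) ^ 2
        ≤ a / (4 * (n + 1)) * ((n + 1) * (2 * ‖s‖ ^ 2 + 2 * ‖r‖ ^ 2)) := by
          gcongr
          exact h7.trans (by gcongr)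
      _ = _ := by field_simp
  rw [hC]
  linarith

end EvenLattice

/-- A locally normally convergent series of holomorphic functions on an open subset of a complex
normed space is holomorphic. -/
theorem differentiableOn_tsum_of_locally_summable {ι V : Type*} [NormedAddCommGroup V]
    [NormedSpace ℂ V] {s : Set V} (hs : IsOpen s) {f : ι → V → ℂ}
    (hf : ∀ i, DifferentiableOn ℂ (f i) s)
    (hloc : ∀ x ∈ s, ∃ t ∈ nhds x, ∃ w : ι → ℝ, Summable w ∧ ∀ i, ∀ y ∈ t, ‖f i y‖ ≤ w i) :
    DifferentiableOn ℂ (fun y => ∑' i, f i y) s := by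
  intro x hx
  obtain ⟨t, ht, w, hw, hfw⟩ := hloc x hx
  obtain ⟨R, hR, hRst⟩ := Metric.mem_nhds_iff.mp (Filter.inter_mem (hs.mem_nhds hx) ht)
  have hball : ∀ y ∈ Metric.ball x (R / 2), Metric.ball y (R / 2) ⊆ s ∩ t := by
    intro y hy
    refine (Metric.ball_subset_ball' ?_).trans hRst
    have := Metric.mem_ball.mp hy
    linarith
  have hsub : Metric.ball x (R / 2) ⊆ s ∩ t :=
    hball x (Metric.mem_ball_self (half_pos hR))
  -- Cauchy estimate on the ball of radius `R / 2` about `y`, whose image under `f i` lies within `2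
  -- * w i` of `f i y`. The derivatives are thus normally summable too, and termwise differentiation
  -- applies.
  have hd : ∀ i, ∀ y ∈ Metric.ball x (R / 2), ‖fderiv ℂ (f i) y‖ ≤ (2 * w i) / (R / 2) := by
    intro i y hy
    refine Complex.norm_fderiv_le_div_of_mapsTo_ball
      ((hf i).mono fun v hv => (hball y hy hv).1) (fun v hv => ?_) (half_pos hR)
    rw [Metric.mem_closedBall, dist_eq_norm]
    have h1 := hfw i v (hball y hy hv).2
    have h2 := hfw i y (hsub hy).2
    linarith [norm_sub_le (f i v) (f i y)]
  have hx0 : x ∈ Metric.ball x (R / 2) := Metric.mem_ball_self (half_pos hR)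
  have hsum : Summable fun i => f i x :=
    Summable.of_norm_bounded hw fun i => hfw i x (hsub hx0).2
  exact (hasFDerivAt_tsum_of_isPreconnected (𝕜 := ℂ) ((hw.mul_left 2).div_const (R / 2))
    Metric.isOpen_ball (convex_ball x (R / 2)).isPreconnected
    (fun i y hy => ((hf i y (hsub hy).1).differentiableAt
      (hs.mem_nhds (hsub hy).1)).hasFDerivAt) hd hx0 hsum
    hx0).differentiableAt.differentiableWithinAt

/-! ### Theta series: convergence, holomorphy and translations -/

namespace EvenLattice

variable {n : ℕ} (L : EvenLattice n)

/-- The term `e(τβ(r) + β(r, z))` of a theta series. -/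
def thetaTerm (τ : ℂ) (z : Fin n → ℂ) (r : Fin n → ℂ) : ℂ :=
  expTwoPiI (τ * L.quad r + L.bil r z)

theorem toC_eq_realC (r : L.dual) : L.toC r = realC (fun i => ((r : Fin n → ℚ) i : ℝ)) := by
  ext i; simp [toC, realC]

theorem differentiable_thetaTerm (r : Fin n → ℂ) :
    Differentiable ℂ fun p : ℂ × (Fin n → ℂ) => L.thetaTerm p.1 p.2 r := by
  refine differentiable_expTwoPiI.comp ?_
  have : Differentiable ℂ fun z : Fin n → ℂ => L.bil r z := by
    unfold bil
    simp only [dotProduct, Matrix.mulVec]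
    fun_prop
  fun_prop

theorem summable_norm_thetaTerm (r : L.dual) {τ : ℂ} (hτ : 0 < τ.im) (z : Fin n → ℂ) :
    Summable fun u : Fin n → ℤ => ‖L.thetaTerm τ z (L.toC r + intC u)‖ := by
  obtain ⟨w, hw, hb⟩ := L.exists_summable_bound (fun i => ((r : Fin n → ℚ) i : ℝ)) hτ
    (norm_nonneg z)
  refine Summable.of_nonneg_of_le (fun _ => norm_nonneg _) (fun u => ?_) hw
  rw [toC_eq_realC]
  exact hb τ z u le_rfl le_rfl

theorem differentiableOn_tsum_thetaTerm (r : L.dual) :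
    DifferentiableOn ℂ (fun p : ℂ × (Fin n → ℂ) =>
      ∑' u : Fin n → ℤ, L.thetaTerm p.1 p.2 (L.toC r + intC u)) {p | 0 < p.1.im} := by
  refine differentiableOn_tsum_of_locally_summable
    (isOpen_lt continuous_const (Complex.continuous_im.comp continuous_fst))
    (fun u => (L.differentiable_thetaTerm _).differentiableOn) fun p hp => ?_
  have hp : 0 < p.1.im := hp
  obtain ⟨w, hw, hb⟩ := L.exists_summable_bound (fun i => ((r : Fin n → ℚ) i : ℝ)) (half_pos hp)
    (R := ‖p.2‖ + 1) (by positivity)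
  refine ⟨{q | p.1.im / 2 < q.1.im} ∩ {q | ‖q.2‖ < ‖p.2‖ + 1}, IsOpen.mem_nhds ?_ ?_, w, hw,
    fun u q hq => ?_⟩
  · refine IsOpen.inter (isOpen_lt continuous_const (Complex.continuous_im.comp continuous_fst))
      (isOpen_lt (continuous_norm.comp continuous_snd) continuous_const)
  · exact ⟨half_lt_self hp, lt_add_one ‖p.2‖⟩
  · rw [toC_eq_realC]
    exact hb q.1 q.2 u hq.1.le hq.2.le

theorem theta_apply (x : L.disc) (τ : ℍ) (z : Fin n → ℂ) : L.theta x τ z =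
    ∑' r : {r : L.dual // (QuotientAddGroup.mk r : L.disc) = x}, L.thetaTerm τ z (L.toC r) := rfl

theorem summable_norm_theta (x : L.disc) (τ : ℍ) (z : Fin n → ℂ) :
    Summable fun r : {r : L.dual // (QuotientAddGroup.mk r : L.disc) = x} =>
      ‖L.thetaTerm τ z (L.toC r)‖ := by
  rw [← (L.classEquiv (L.rep x) x (L.mk_rep x)).summable_iff]
  refine (L.summable_norm_thetaTerm (L.rep x) τ.im_pos z).congr fun u => ?_
  simp [classEquiv_coe, toC_add, toC_ofInt]

theorem hasSum_theta (x : L.disc) (τ : ℍ) (z : Fin n → ℂ) :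
    HasSum (fun r : {r : L.dual // (QuotientAddGroup.mk r : L.disc) = x} =>
      L.thetaTerm τ z (L.toC r)) (L.theta x τ z) :=
  (L.summable_norm_theta x τ z).of_norm.hasSum

theorem theta_mk (r : L.dual) (τ : ℍ) (z : Fin n → ℂ) : L.theta (QuotientAddGroup.mk r) τ z =
    ∑' u : Fin n → ℤ, L.thetaTerm τ z (L.toC r + intC u) := by
  rw [theta_apply, ← (L.classEquiv r _ rfl).tsum_eq]
  simp [classEquiv_coe, toC_add, toC_ofInt]

theorem differentiableOn_theta (x : L.disc) :
    DifferentiableOn ℂ (fun p : ℂ × (Fin n → ℂ) => L.theta x (ofComplex p.1) p.2)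
      {p | 0 < p.1.im} := by
  refine (L.differentiableOn_tsum_thetaTerm (L.rep x)).congr fun p hp => ?_
  rw [← L.mk_rep x, theta_mk, mk_rep, UpperHalfPlane.ofComplex_apply_of_im_pos hp]

/-- The class of `β(x)` modulo `ℤ`, exponentiated. -/
def quadChar (x : L.disc) : ℂ := expTwoPiI (L.quad (L.toC (L.rep x)))

theorem expTwoPiI_quad (r : L.dual) :
    expTwoPiI (L.quad (L.toC r)) = L.quadChar (QuotientAddGroup.mk r) := by
  obtain ⟨u, hu⟩ := (L.mk_eq_mk_iff r (L.rep (QuotientAddGroup.mk r))).mp (L.mk_rep _).symm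
  obtain ⟨a, ha⟩ := L.exists_bil_toC_intC r u
  obtain ⟨b, hb⟩ := L.exists_quad_intC u
  rw [quadChar, hu]
  refine (expTwoPiI_congr ⟨a + b, ?_⟩).symm
  rw [toC_add, toC_ofInt, quad_add, ha, hb]
  push_cast
  ring

theorem quadChar_ne_zero (x : L.disc) : L.quadChar x ≠ 0 := expTwoPiI_ne_zero _

theorem norm_quadChar (x : L.disc) : ‖L.quadChar x‖ = 1 := by
  rw [quadChar, norm_expTwoPiI, quad_toC]
  simp

theorem quadChar_eq_one_iff (x : L.disc) : L.quadChar x = 1 ↔ L.IsIsotropic x := by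
  rw [quadChar, expTwoPiI_eq_one_iff, quad_toC]
  exact exists_congr fun m => by norm_cast

theorem quadChar_zero : L.quadChar 0 = 1 := by
  rw [← QuotientAddGroup.mk_zero, ← expTwoPiI_quad, toC_zero, quad_zero, expTwoPiI_zero]

theorem theta_translate_int (x : L.disc) (m : ℤ) (τ τ' : ℍ) (h : (τ' : ℂ) = τ + m)
    (z : Fin n → ℂ) : L.theta x τ' z = L.quadChar x ^ m * L.theta x τ z := by
  rw [theta_apply, theta_apply, ← tsum_mul_left]
  refine tsum_congr fun r => ?_
  have hr : L.quadChar x = expTwoPiI (L.quad (L.toC r)) := by rw [expTwoPiI_quad, r.2]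
  rw [hr, ← expTwoPiI_int_mul, thetaTerm, thetaTerm, ← expTwoPiI_add, h]
  congr 1
  ring

/-- Translating by `(u, v)` shifts the summation index by `u`; the remaining phase `β(r + w, v)` is
integral. -/
theorem slashHeis_theta (x : L.disc) (u v : Fin n → ℤ) :
    L.slashHeis (L.theta x) u v = L.theta x := by
  funext τ z
  obtain ⟨r, rfl⟩ := QuotientAddGroup.mk_surjective x
  rw [slashHeis_apply, theta_mk, theta_mk, ← tsum_mul_right]
  conv_rhs => rw [← (Equiv.addRight u).tsum_eq]
  refine tsum_congr fun w => ?_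
  rw [thetaTerm, thetaTerm, ← expTwoPiI_add]
  obtain ⟨a, ha⟩ := L.exists_bil_toC_intC r v
  refine expTwoPiI_congr ⟨a + L.bil w v, ?_⟩
  simp only [Equiv.coe_addRight, intC_add, quad_add, bil_add_left, bil_add_right, bil_smul_right,
    ha, bil_intC]
  push_cast
  ring

/-- The action of `(lr, mr)`, `r ∈ L^#`, on theta series. -/
theorem translate_theta (r : L.dual) (l m : ℤ) (y : L.disc) :
    L.translate ((l : ℂ) • L.toC r) ((m : ℂ) • L.toC r) (L.theta y) = fun τ z =>
      L.pair (QuotientAddGroup.mk r) y ^ m * L.quadChar (QuotientAddGroup.mk r) ^ (l * m) *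
        L.theta (y + l • QuotientAddGroup.mk r) τ z := by
  funext τ z
  obtain ⟨s, rfl⟩ := QuotientAddGroup.mk_surjective y
  rw [← QuotientAddGroup.mk_zsmul, ← QuotientAddGroup.mk_add, translate, theta_mk, theta_mk,
    ← tsum_mul_right, ← tsum_mul_left]
  refine tsum_congr fun w => ?_
  rw [pair_mk, ← expTwoPiI_quad, ← expTwoPiI_int_mul, ← expTwoPiI_int_mul, thetaTerm, thetaTerm,
    ← expTwoPiI_add, ← expTwoPiI_add, ← expTwoPiI_add]
  obtain ⟨a, ha⟩ := L.exists_bil_toC_intC r w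
  refine expTwoPiI_congr ⟨m * a, ?_⟩
  simp only [toC_add, toC_zsmul, quad_add, bil_add_left, bil_add_right, bil_smul_right,
    bil_smul_left, quad_smul, bil_self, L.bil_comm (intC w) (L.toC r),
    L.bil_comm (L.toC s) (L.toC r), ha]
  push_cast
  ring

end EvenLattice

/-! ### Fourier series in several variables and Poisson summation -/

section Torus

open MeasureTheory

variable {n : ℕ}

/-- The projection `ℝⁿ → (ℝ/ℤ)ⁿ`. -/
def toTorus (t : Fin n → ℝ) : UnitAddTorus (Fin n) := fun i => (t i : UnitAddCircle)

theorem isOpenQuotientMap_toTorus : IsOpenQuotientMap (toTorus (n := n)) :=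
  IsOpenQuotientMap.piMap fun _ => QuotientAddGroup.isOpenQuotientMap_mk

theorem exists_int_of_toTorus_eq {s t : Fin n → ℝ} (h : toTorus s = toTorus t) :
    ∃ u : Fin n → ℤ, s = t + fun i => (u i : ℝ) := by
  have : ∀ i, ∃ m : ℤ, s i = t i + m := by
    intro i
    have h1 : ((s i : ℝ) : UnitAddCircle) = (t i : UnitAddCircle) := congrFun h i
    rw [eq_comm, QuotientAddGroup.eq, AddSubgroup.mem_zmultiples_iff] at h1
    obtain ⟨m, hm⟩ := h1
    exact ⟨m, by simp at hm; linarith⟩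
  choose u hu using this
  exact ⟨u, funext hu⟩

theorem mFourier_toTorus (m : Fin n → ℤ) (t : Fin n → ℝ) :
    UnitAddTorus.mFourier m (toTorus t) = expTwoPiI (∑ i, (m i : ℂ) * t i) := by
  rw [expTwoPiI, Finset.mul_sum, Complex.exp_sum]
  change ∏ i, fourier (m i) (t i : UnitAddCircle) = _
  refine Finset.prod_congr rfl fun i _ => ?_
  rw [fourier_coe_apply]
  congr 1
  push_cast
  ring

-- The normalized Haar measure, for which the characters of the torus are orthonormal.
local instance : MeasureSpace UnitAddCircle := ⟨AddCircle.haarAddCircle⟩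

local instance : IsProbabilityMeasure (volume : Measure UnitAddCircle) :=
  inferInstanceAs (IsProbabilityMeasure AddCircle.haarAddCircle)

/-- The coefficients of an absolutely convergent Fourier series are determined by its sum. -/
theorem coeff_eq_zero_of_hasSum_zero {c : (Fin n → ℤ) → ℂ}
    (h : ∀ t : Fin n → ℝ, HasSum (fun m => c m * expTwoPiI (∑ i, (m i : ℂ) * t i)) 0) : c = 0 := by
  -- At `t = 0` all exponentials equal `1`, so the hypothesis already contains absolute summability.
  have hc : Summable fun m => ‖c m‖ := by
    have := (h 0).summable.norm
    simpa [expTwoPiI_zero] using this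
  have hsum : Summable fun m => c m • UnitAddTorus.mFourier m := by
    refine Summable.of_norm ?_
    simpa [norm_smul, UnitAddTorus.mFourier_norm] using hc
  have hzero : ∑' m, c m • UnitAddTorus.mFourier m = 0 := by
    ext x
    obtain ⟨t, rfl⟩ := isOpenQuotientMap_toTorus.surjective x
    have h1 := (ContinuousMap.evalCLM ℂ (toTorus t)).hasSum hsum.hasSum
    refine h1.unique ?_
    simpa [mFourier_toTorus] using h t
  have h2 := hsum.hasSum
  rw [hzero] at h2
  -- The uniformly convergent series is carried to `L²`, where the inner product with the `m`-th
  -- character extracts `c m`.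
  have h3 := (ContinuousMap.toLp (E := ℂ) 2 (volume : Measure (UnitAddTorus (Fin n))) ℂ).hasSum h2
  funext m
  have h4 := (innerSL ℂ (UnitAddTorus.mFourierLp (d := Fin n) 2 m)).hasSum h3
  rw [map_zero, map_zero] at h4
  have h5 : HasSum (fun m' => if m' = m then c m else 0) (0 : ℂ) := by
    refine h4.congr_fun fun m' => ?_
    have ho : inner ℂ (UnitAddTorus.mFourierLp (d := Fin n) 2 m)
        (UnitAddTorus.mFourierLp (d := Fin n) 2 m') = if m = m' then (1 : ℂ) else 0 :=
      orthonormal_iff_ite.mp (UnitAddTorus.orthonormal_mFourier (d := Fin n)) m m'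
    rw [map_smul, map_smul, innerSL_apply_apply, smul_eq_mul]
    refine Eq.trans ?_ (congrArg (c m' * ·) ho.symm)
    by_cases hm : m' = m
    · simp [hm]
    · simp [hm, Ne.symm hm]
  exact (hasSum_ite_eq m (c m)).unique h5

/-- Poisson summation in several variables. -/
theorem hasSum_fourier_of_locally_summable {f : (Fin n → ℝ) → ℂ} (hf : Continuous f)
    (hloc : ∀ R : ℝ, ∃ w : (Fin n → ℤ) → ℝ, Summable w ∧ ∀ (t : Fin n → ℝ) (u : Fin n → ℤ),
      ‖t‖ ≤ R → ‖f (t + fun i => (u i : ℝ))‖ ≤ w u)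
    (hsum : Summable fun m : Fin n → ℤ => ∫ t, expTwoPiI (-∑ i, (m i : ℂ) * t i) * f t) :
    HasSum (fun m : Fin n → ℤ => ∫ t, expTwoPiI (-∑ i, (m i : ℂ) * t i) * f t)
      (∑' u : Fin n → ℤ, f (fun i => (u i : ℝ))) := by
  -- The periodization of `f`. It descends to a continuous function `g` on the torus, and the
  -- assertion is the Fourier series of `g` at `0`.
  set P : (Fin n → ℝ) → ℂ := fun t => ∑' u : Fin n → ℤ, f (t + fun i => (u i : ℝ)) with hP
  have hPcont : Continuous P := by
    rw [continuous_iff_continuousAt]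
    intro t
    obtain ⟨w, hw, hb⟩ := hloc (‖t‖ + 1)
    have hopen : IsOpen {s : Fin n → ℝ | ‖s‖ < ‖t‖ + 1} := isOpen_lt continuous_norm continuous_const
    refine ContinuousOn.continuousAt (s := {s : Fin n → ℝ | ‖s‖ < ‖t‖ + 1}) ?_
      (hopen.mem_nhds (lt_add_one ‖t‖))
    exact continuousOn_tsum (fun u => by fun_prop) hw fun u s hs => hb s u hs.le
  have hPper : ∀ (t : Fin n → ℝ) (u : Fin n → ℤ), P (t + fun i => (u i : ℝ)) = P t := by
    intro t u
    rw [hP]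
    beta_reduce
    rw [← (Equiv.addLeft u).tsum_eq (fun v : Fin n → ℤ => f (t + fun i => (v i : ℝ)))]
    refine tsum_congr fun v => congrArg f ?_
    ext i
    simp [add_assoc]
  set g : UnitAddTorus (Fin n) → ℂ :=
    fun x => P (Function.surjInv isOpenQuotientMap_toTorus.surjective x) with hg
  have hgP : ∀ t, g (toTorus t) = P t := by
    intro t
    obtain ⟨u, hu⟩ := exists_int_of_toTorus_eq
      (Function.surjInv_eq isOpenQuotientMap_toTorus.surjective (toTorus t))
    rw [hg]
    beta_reduce
    rw [hu, hPper]
  have hgcont : Continuous g := by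
    rw [← isOpenQuotientMap_toTorus.continuous_comp_iff]
    exact hPcont.congr fun t => (hgP t).symm
  have hcoeff : ∀ m : Fin n → ℤ, UnitAddTorus.mFourierCoeff g m =
      ∫ t, expTwoPiI (-∑ i, (m i : ℂ) * t i) * f t := by
    intro m
    rw [UnitAddTorus.mFourierCoeff_eq_integral g m 0]
    set h : (Fin n → ℝ) → ℂ := fun t => expTwoPiI (-∑ i, (m i : ℂ) * t i) * f t with hh
    have hhcont : Continuous h := by
      refine Continuous.mul (continuous_expTwoPiI.comp ?_) hf
      fun_prop
    have hhnorm : ∀ t, ‖h t‖ = ‖f t‖ := by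
      intro t
      rw [hh]
      beta_reduce
      rw [norm_mul, norm_expTwoPiI]
      simp
    -- Unfolding: the half-open unit cubes tile `ℝⁿ`, so the integral of the periodization over one
    -- cube is the integral of `f` over the whole space.
    set cube : (Fin n → ℤ) → Set (Fin n → ℝ) :=
      fun u => {x | ∀ i, x i ∈ Set.Ioc (u i : ℝ) (u i + 1)} with hcube
    have hcubepi : ∀ u, cube u = Set.pi Set.univ fun i => Set.Ioc (u i : ℝ) (u i + 1) := by
      intro u; ext x; simp [hcube]
    have hmeas : ∀ u, MeasurableSet (cube u) := fun u => by
      rw [hcubepi]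
      exact MeasurableSet.univ_pi fun i => measurableSet_Ioc
    have hvol : ∀ u, volume (cube u) = 1 := fun u => by
      rw [hcubepi, Real.volume_pi_Ioc]
      simp
    have hdisj : Pairwise (Function.onFun Disjoint cube) := by
      intro u v huv
      rw [Function.onFun, Set.disjoint_left]
      intro x hxu hxv
      apply huv
      ext i
      have h1 := hxu i
      have h2 := hxv i
      have h3 : (u i : ℝ) < v i + 1 := h1.1.trans_le h2.2
      have h4 : (v i : ℝ) < u i + 1 := h2.1.trans_le h1.2
      have h5 : u i < v i + 1 := by exact_mod_cast h3
      have h6 : v i < u i + 1 := by exact_mod_cast h4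
      omega
    have hunion : ⋃ u, cube u = Set.univ := by
      rw [Set.eq_univ_iff_forall]
      intro x
      rw [Set.mem_iUnion]
      refine ⟨fun i => ⌈x i⌉ - 1, fun i => ?_⟩
      push_cast
      exact ⟨by linarith [Int.ceil_lt_add_one (x i)], by linarith [Int.le_ceil (x i)]⟩
    have hzero : {x : Fin n → ℝ | ∀ i, x i ∈ Set.Ioc ((0 : Fin n → ℝ) i) ((0 : Fin n → ℝ) i + 1)} =
        cube 0 := by
      simp [hcube]
    have hshift : ∀ u : Fin n → ℤ,
        (fun x : Fin n → ℝ => x + fun i => (u i : ℝ)) ⁻¹' cube u = cube 0 := by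
      intro u
      ext x
      simp only [hcube, Set.mem_preimage, Set.mem_ofPred_eq, Pi.add_apply, Set.mem_Ioc,
        Pi.zero_apply, Int.cast_zero]
      refine forall_congr' fun i => ?_
      constructor <;> rintro ⟨h1, h2⟩ <;> constructor <;> linarith
    have htrans : ∀ u : Fin n → ℤ, MeasurePreserving
        (fun x : Fin n → ℝ => x + fun i => (u i : ℝ)) volume volume :=
      fun u => measurePreserving_add_right volume _
    have hemb : ∀ u : Fin n → ℤ, MeasurableEmbedding
        (fun x : Fin n → ℝ => x + fun i => (u i : ℝ)) :=
      fun u => measurableEmbedding_addRight _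
    obtain ⟨w, hw, hb⟩ := hloc 1
    have hb' : ∀ u, ∀ x ∈ cube 0, ‖h (x + fun i => (u i : ℝ))‖ ≤ w u := by
      intro u x hx
      rw [hhnorm]
      refine hb x u ((pi_norm_le_iff_of_nonneg zero_le_one).mpr fun i => ?_)
      have := hx i
      simp only [Pi.zero_apply, Int.cast_zero, Set.mem_Ioc] at this
      rw [Real.norm_eq_abs, abs_le]
      constructor <;> linarith [this.1, this.2]
    have hfin : volume (cube 0) ≠ ⊤ := by rw [hvol]; exact ENNReal.one_ne_top
    have hint : ∀ u : Fin n → ℤ, IntegrableOn (fun x => h (x + fun i => (u i : ℝ))) (cube 0) :=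
      fun u => IntegrableOn.of_bound hfin.lt_top
        ((hhcont.comp (continuous_add_const _)).aestronglyMeasurable) (w u)
        ((ae_restrict_iff' (hmeas 0)).mpr (Filter.Eventually.of_forall (hb' u)))
    have hnorm : ∀ u : Fin n → ℤ, ∫ x in cube 0, ‖h (x + fun i => (u i : ℝ))‖ ≤ w u := by
      intro u
      have := setIntegral_mono_on (hint u).norm (integrableOn_const (C := w u) hfin) (hmeas 0)
        fun x hx => hb' u x hx
      simpa [Measure.real, hvol] using this
    have hsumnorm : Summable fun u : Fin n → ℤ => ∫ x in cube 0, ‖h (x + fun i => (u i : ℝ))‖ :=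
      Summable.of_nonneg_of_le (fun u => integral_nonneg fun x => norm_nonneg _) hnorm hw
    have hsum1 := hasSum_integral_of_summable_integral_norm hint hsumnorm
    have hIon : IntegrableOn h (⋃ u, cube u) := by
      refine integrableOn_iUnion_of_summable_integral_norm (fun u => ?_) ?_
      · rw [← (htrans u).integrableOn_comp_preimage (hemb u), hshift]
        exact hint u
      · refine hsumnorm.congr fun u => ?_
        rw [← hshift u]
        exact (htrans u).setIntegral_preimage_emb (hemb u) (fun x => ‖h x‖) (cube u)
    have hsum2 := hasSum_integral_iUnion hmeas hdisj hIon
    rw [hunion, setIntegral_univ] at hsum2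
    rw [hzero]
    refine Eq.trans ?_ (hsum1.unique (hsum2.congr_fun fun u => ?_))
    · refine setIntegral_congr_fun (hmeas 0) fun x _ => ?_
      have e1 : (fun i => (x i : UnitAddCircle)) = toTorus x := rfl
      rw [e1, hgP, mFourier_toTorus, smul_eq_mul, hP]
      beta_reduce
      rw [← tsum_mul_left]
      refine tsum_congr fun u => ?_
      rw [hh]
      beta_reduce
      congr 1
      refine expTwoPiI_congr ⟨∑ i, m i * u i, ?_⟩
      push_cast
      simp only [Pi.neg_apply, Pi.add_apply, ← Finset.sum_neg_distrib, ← Finset.sum_add_distrib]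
      refine Finset.sum_congr rfl fun i _ => ?_
      push_cast
      ring
    · rw [← hshift u]
      exact (htrans u).setIntegral_preimage_emb (hemb u) h (cube u)
  have hfinal := UnitAddTorus.hasSum_mFourier_series_apply_of_summable (f := ⟨g, hgcont⟩)
    (hsum.congr fun m => (hcoeff m).symm) (toTorus 0)
  have e0 : (⟨g, hgcont⟩ : C(UnitAddTorus (Fin n), ℂ)) (toTorus 0) =
      ∑' u : Fin n → ℤ, f (fun i => (u i : ℝ)) := by
    rw [ContinuousMap.coe_mk, hgP, hP]
    simp
  rw [e0] at hfinal
  refine hfinal.congr_fun fun m => ?_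
  rw [mFourier_toTorus, ContinuousMap.coe_mk, hcoeff]
  simp [expTwoPiI_zero]

end Torus

namespace EvenLattice

open MeasureTheory

variable {n : ℕ} (L : EvenLattice n)

/-! ### Coordinates on the dual lattice -/

theorem gram_mulVec_toC (r : L.dual) : (L.gram.map (Int.cast : ℤ → ℂ)).mulVec (L.toC r) =
    fun i => (((L.gram.map (Int.cast : ℤ → ℚ)).mulVec (r : Fin n → ℚ) i : ℚ) : ℂ) := by
  ext i
  simp [Matrix.mulVec, dotProduct, toC]

theorem isUnit_det_gramQ : IsUnit (L.gram.map (Int.cast : ℤ → ℚ)).det := by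
  have : (L.gram.map (Int.cast : ℤ → ℚ)).det = (L.gram.det : ℚ) := (Int.cast_det L.gram).symm
  rw [this, isUnit_iff_ne_zero]
  exact_mod_cast L.gram_det_ne_zero

/-- The element of `L^#` that pairs with the standard basis to a given integral vector. -/
def ofCoord (m : Fin n → ℤ) : L.dual :=
  ⟨(L.gram.map (Int.cast : ℤ → ℚ))⁻¹.mulVec fun i => (m i : ℚ), fun w => ⟨m ⬝ᵥ w, by
    rw [bil_comm, bil, Matrix.mulVec_mulVec, Matrix.mul_nonsing_inv _ L.isUnit_det_gramQ,
      Matrix.one_mulVec]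
    simp [dotProduct, mul_comm]⟩⟩

theorem gram_mulVec_ofCoord (m : Fin n → ℤ) :
    (L.gram.map (Int.cast : ℤ → ℚ)).mulVec (L.ofCoord m : Fin n → ℚ) = fun i => (m i : ℚ) := by
  rw [ofCoord, Matrix.mulVec_mulVec, Matrix.mul_nonsing_inv _ L.isUnit_det_gramQ,
    Matrix.one_mulVec]

theorem bil_ofCoord (m : Fin n → ℤ) (w : Fin n → ℂ) :
    L.bil (L.toC (L.ofCoord m)) w = ∑ i, (m i : ℂ) * w i := by
  rw [bil_comm, bil, gram_mulVec_toC, gram_mulVec_ofCoord]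
  simp [dotProduct, mul_comm]

/-- The coordinates on `L^#` given by the pairing with the standard basis. -/
def coordEquiv : (Fin n → ℤ) ≃ L.dual :=
  Equiv.ofBijective L.ofCoord (by
    constructor
    · intro m m' h
      have h1 := L.gram_mulVec_ofCoord m
      rw [h, gram_mulVec_ofCoord] at h1
      ext i
      exact_mod_cast (congrFun h1 i).symm
    · intro r
      have key : ∀ i, ∃ m : ℤ, (L.gram.map (Int.cast : ℤ → ℚ)).mulVec (r : Fin n → ℚ) i = m := by
        intro i
        obtain ⟨m, hm⟩ := r.2 (Pi.single i 1)
        refine ⟨m, ?_⟩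
        rw [← hm, bil_comm, bil]
        have : (fun j => ((Pi.single i (1 : ℤ) : Fin n → ℤ) j : ℚ)) = Pi.single i 1 := by
          ext j
          by_cases h : j = i
          · subst h; simp
          · simp [h]
        rw [this, single_dotProduct, one_mul]
      choose m hm using key
      refine ⟨m, Subtype.ext ?_⟩
      have h1 := L.gram_mulVec_ofCoord m
      rw [← funext hm] at h1
      have h2 := congrArg ((L.gram.map (Int.cast : ℤ → ℚ))⁻¹.mulVec) h1
      rwa [Matrix.mulVec_mulVec, Matrix.mulVec_mulVec,
        Matrix.nonsing_inv_mul _ L.isUnit_det_gramQ, Matrix.one_mulVec, Matrix.one_mulVec] at h2)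

theorem coordEquiv_apply (m : Fin n → ℤ) : L.coordEquiv m = L.ofCoord m := rfl

/-- The coefficients of an expansion `∑ a(r) e(β(r, z))` over `L^#` are unique. -/
theorem fourier_coeff_unique {a b : L.dual → ℂ} {f : (Fin n → ℂ) → ℂ}
    (ha : ∀ z, HasSum (fun r => a r * expTwoPiI (L.bil (L.toC r) z)) (f z))
    (hb : ∀ z, HasSum (fun r => b r * expTwoPiI (L.bil (L.toC r) z)) (f z)) : a = b := by
  have h : (fun m => a (L.coordEquiv m) - b (L.coordEquiv m)) = 0 := by
    refine coeff_eq_zero_of_hasSum_zero fun t => ?_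
    -- Real `z` suffice: in the coordinates of `coordEquiv` this is an ordinary Fourier series on
    -- the torus.
    have h1 := (ha (realC t)).sub (hb (realC t))
    rw [sub_self, ← L.coordEquiv.hasSum_iff] at h1
    refine h1.congr_fun fun m => ?_
    rw [Function.comp_apply, coordEquiv_apply, bil_ofCoord, sub_mul]
    rfl
  funext r
  obtain ⟨m, rfl⟩ := L.coordEquiv.surjective r
  exact sub_eq_zero.mp (congrFun h m)

/-- A sum over `L^#` can be computed class by class. -/
theorem hasSum_dual_of_classes {f : L.dual → ℂ} {a : L.disc → ℂ}
    (h : ∀ y, HasSum (fun r : {r : L.dual // (QuotientAddGroup.mk r : L.disc) = y} => f r) (a y)) :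
    HasSum f (∑ y, a y) := by
  classical
  have h1 := hasSum_sum fun y (_ : y ∈ Finset.univ) =>
    (hasSum_subtype_iff_indicator (s := {r : L.dual | (QuotientAddGroup.mk r : L.disc) = y})).mp
      (h y)
  refine h1.congr_fun fun r => ?_
  rw [Finset.sum_eq_single (QuotientAddGroup.mk r : L.disc)]
  · exact (Set.indicator_of_mem (show r ∈ {s : L.dual | (QuotientAddGroup.mk s : L.disc) =
      QuotientAddGroup.mk r} from rfl) f).symm
  · intro y _ hy
    exact Set.indicator_of_notMem (show r ∉ {s : L.dual | (QuotientAddGroup.mk s : L.disc) = y} from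
      fun hr => hy hr.symm) f
  · exact fun h => absurd (Finset.mem_univ _) h

/-! ### The Gaussian integral and the inversion formula for theta series -/

/-- The factor `(τ/i)^{n/2} / √det G` of the inversion formula. -/
def inversionFactor (τ : ℂ) : ℂ :=
  ((|L.gramFactor.det|⁻¹ : ℝ) : ℂ) * (-Complex.I * τ) ^ ((n : ℂ) / 2)

theorem norm_inversionFactor_sq (τ : ℍ) :
    ‖L.inversionFactor τ‖ ^ 2 = ‖(τ : ℂ)‖ ^ n / |(L.gram.det : ℝ)| := by
  rw [inversionFactor, norm_mul, mul_pow, Complex.norm_real, Real.norm_eq_abs, sq_abs, inv_pow,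
    sq_abs, det_gramFactor_sq]
  have h : ((n : ℂ) / 2) = (((n : ℝ) / 2 : ℝ) : ℂ) := by push_cast; rfl
  have hdet : (0 : ℝ) ≤ L.gram.det := by rw [← det_gramFactor_sq]; positivity
  rw [h, Complex.norm_cpow_real, norm_mul, norm_neg, Complex.norm_I, one_mul, ← Real.rpow_natCast,
    ← Real.rpow_mul (norm_nonneg _), abs_of_nonneg hdet]
  rw [show (n : ℝ) / 2 * ((2 : ℕ) : ℝ) = n by push_cast; ring, Real.rpow_natCast]
  field_simp

theorem differentiableOn_inversionFactor :
    DifferentiableOn ℂ L.inversionFactor {τ | 0 < τ.im} := by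
  intro τ hτ
  have hτ : 0 < τ.im := hτ
  refine DifferentiableAt.differentiableWithinAt ?_
  unfold inversionFactor
  refine DifferentiableAt.const_mul ?_ _
  -- The real part of `-iτ` is `Im τ > 0`, so the principal branch of the power is holomorphic here.
  refine DifferentiableAt.cpow_const (by fun_prop) (Or.inl ?_)
  simpa using hτ

theorem bil_complex_eq_gramFactor (v w : Fin n → ℂ) : L.bil v w =
    (L.gramFactor.map Complex.ofRealHom).mulVec v ⬝ᵥ
      (L.gramFactor.map Complex.ofRealHom).mulVec w := by
  have h : L.gram.map (Int.cast : ℤ → ℂ) = (L.gramFactor.map Complex.ofRealHom).transpose *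
      L.gramFactor.map Complex.ofRealHom := by
    have h1 := congrArg (fun A : Matrix (Fin n) (Fin n) ℝ => A.map Complex.ofRealHom)
      L.gramFactor_spec
    simp only [Matrix.map_mul] at h1
    rw [← Matrix.transpose_map, ← h1]
    ext i j
    simp
  rw [bil, h, ← Matrix.mulVec_mulVec, Matrix.dotProduct_mulVec, Matrix.vecMul_transpose]

/-- The substitution `v = Mt` diagonalizes the form and produces `|det M|⁻¹`. Completing the square
cancels every term in `ω = Mζ` (this is `h5`), so the value does not depend on the complex shift
`ζ`. -/
theorem integral_gaussian (τ : ℍ) (ζ : Fin n → ℂ) :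
    ∫ t : Fin n → ℝ, expTwoPiI (-L.quad (realC t + ζ) / τ) = L.inversionFactor τ := by
  set ω := (L.gramFactor.map Complex.ofRealHom).mulVec ζ with hω
  set b : ℂ := Real.pi * Complex.I / τ with hb
  have hτ := τ.ne_zero
  have hb0 : 0 < b.re := by
    have : b = Real.pi * (Complex.I / τ) := by rw [hb]; ring
    rw [this, Complex.re_ofReal_mul, Complex.div_re]
    have h1 := τ.im_pos
    have h2 : 0 < Complex.normSq (τ : ℂ) := Complex.normSq_pos.mpr hτ
    have h3 := Real.pi_pos
    simp only [Complex.I_re, zero_mul, zero_div, Complex.I_im, one_mul, UpperHalfPlane.coe_im,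
      zero_add]
    positivity
  set F : (Fin n → ℝ) → ℂ := fun v =>
    Complex.exp (-b * ∑ i, (v i : ℂ) ^ 2 + ∑ i, (-2 * b * ω i) * v i) *
      Complex.exp (-b * ∑ i, ω i ^ 2) with hF
  have hFcont : Continuous F := by
    rw [hF]
    fun_prop
  have h1 : ∀ t : Fin n → ℝ, expTwoPiI (-L.quad (realC t + ζ) / τ) =
      F (Matrix.toLin' L.gramFactor t) := by
    intro t
    rw [hF]
    beta_reduce
    rw [← Complex.exp_add, expTwoPiI]
    congr 1
    have h2 : (L.gramFactor.map Complex.ofRealHom).mulVec (realC t + ζ) =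
        realC (Matrix.toLin' L.gramFactor t) + ω := by
      rw [Matrix.mulVec_add, hω]
      congr 1
      ext i
      simp [Matrix.mulVec, dotProduct, realC]
    rw [quad, bil_complex_eq_gramFactor, h2]
    generalize Matrix.toLin' L.gramFactor t = v
    simp only [dotProduct, realC, Pi.add_apply]
    have h3 : ∑ i, ((v i : ℂ) + ω i) * ((v i : ℂ) + ω i) =
        ∑ i, (v i : ℂ) ^ 2 + 2 * ∑ i, ω i * v i + ∑ i, ω i ^ 2 := by
      rw [Finset.mul_sum, ← Finset.sum_add_distrib, ← Finset.sum_add_distrib]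
      exact Finset.sum_congr rfl fun i _ => by ring
    have h4 : ∑ i, (-2 * b * ω i) * (v i : ℂ) = -2 * b * ∑ i, ω i * v i := by
      rw [Finset.mul_sum]
      exact Finset.sum_congr rfl fun i _ => by ring
    rw [h3, h4, hb]
    field_simp
    ring
  have hdet : L.gramFactor.det ≠ 0 := L.det_gramFactor_ne_zero
  have hmeas : Measurable (Matrix.toLin' L.gramFactor) :=
    (LinearMap.continuous_of_finiteDimensional _).measurable
  rw [integral_congr_ae (Filter.Eventually.of_forall h1),
    ← integral_map (f := F) hmeas.aemeasurable hFcont.aestronglyMeasurable,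
    Real.map_matrix_volume_pi_eq_smul_volume_pi hdet, integral_smul_measure, hF,
    integral_mul_const, GaussianFourier.integral_cexp_neg_mul_sum_add hb0, mul_assoc,
    ← Complex.exp_add]
  have h5 : (∑ i, (-2 * b * ω i) ^ 2) / (4 * b) + -b * ∑ i, ω i ^ 2 = 0 := by
    have hb1 : b ≠ 0 := fun h => by simp [h] at hb0
    have : ∑ i, (-2 * b * ω i) ^ 2 = 4 * b ^ 2 * ∑ i, ω i ^ 2 := by
      rw [Finset.mul_sum]
      exact Finset.sum_congr rfl fun i _ => by ring
    rw [this]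
    field_simp
    ring
  have h6 : (Real.pi : ℂ) / b = -Complex.I * τ := by
    rw [hb]
    have hpi : (Real.pi : ℂ) ≠ 0 := by exact_mod_cast Real.pi_ne_zero
    field_simp
    linear_combination Complex.I_sq
  rw [h5, Complex.exp_zero, mul_one, h6, inversionFactor, ENNReal.toReal_ofReal (abs_nonneg _),
    abs_inv, Complex.real_smul, Fintype.card_fin]

theorem autFactor_S (τ : ℍ) : autFactor ModularGroup.S τ = τ := by
  simp [autFactor, ModularGroup.S]

theorem coe_S_smul (τ : ℍ) : ((ModularGroup.S • τ : ℍ) : ℂ) = -1 / τ := by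
  rw [coe_sl_smul, autFactor_S]
  simp [ModularGroup.S]

/-- Poisson summation for `f(t) = e(-β(t + r - z)/τ)`. At integral vectors `f` gives the terms on
the left. By completing the square, the Fourier coefficient at `m` is the theta term at `-s`, with
`s ∈ L^#` of coordinates `m`; the sum over `L^#` is then sorted into classes. -/
theorem theta_inversion (x : L.disc) (τ : ℍ) (z : Fin n → ℂ) :
    L.theta x (ModularGroup.S • τ) ((τ : ℂ)⁻¹ • z) * expTwoPiI (-L.quad z / τ) =
      L.inversionFactor τ * ∑ y, L.pair y (-x) * L.theta y τ z := by
  obtain ⟨r, rfl⟩ := QuotientAddGroup.mk_surjective x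
  have hτ := τ.ne_zero
  set f : (Fin n → ℝ) → ℂ := fun t => expTwoPiI (-L.quad (realC t + (L.toC r - z)) / τ) with hf
  have hdual : HasSum (fun s : L.dual => L.inversionFactor τ *
      (expTwoPiI (-L.bil (L.toC s) (L.toC r)) * L.thetaTerm τ z (L.toC s)))
      (L.inversionFactor τ * ∑ y, L.pair y (-QuotientAddGroup.mk r) * L.theta y τ z) := by
    refine HasSum.mul_left _ (L.hasSum_dual_of_classes fun y => ?_)
    refine ((L.hasSum_theta y τ z).mul_left _).congr_fun ?_
    rintro ⟨s, rfl⟩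
    congr 1
    rw [← QuotientAddGroup.mk_neg, pair_mk, toC_neg, bil_neg_right]
  have hcoef : ∀ m : Fin n → ℤ, ∫ t : Fin n → ℝ, expTwoPiI (-∑ i, (m i : ℂ) * t i) * f t =
      L.inversionFactor τ * (expTwoPiI (-L.bil (L.toC (-L.ofCoord m)) (L.toC r)) *
        L.thetaTerm τ z (L.toC (-L.ofCoord m))) := by
    intro m
    set s := L.toC (L.ofCoord m) with hs
    rw [toC_neg, ← hs, thetaTerm, ← expTwoPiI_add,
      ← L.integral_gaussian τ (L.toC r - z + (τ : ℂ) • s), ← integral_mul_const]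
    refine integral_congr_ae (Filter.Eventually.of_forall fun t => ?_)
    beta_reduce
    rw [hf]
    beta_reduce
    have hm : ∑ i, (m i : ℂ) * t i = L.bil s (realC t) := (L.bil_ofCoord m (realC t)).symm
    rw [hm, ← expTwoPiI_add, ← expTwoPiI_add]
    congr 1
    rw [← add_assoc (realC t), L.quad_add _ ((τ : ℂ) • s), quad_smul, quad_neg, bil_neg_left,
      bil_neg_left, bil_smul_right, bil_add_left, bil_sub_left, L.bil_comm (realC t) s,
      L.bil_comm (L.toC r) s, L.bil_comm z s]
    field_simp
    ring
  have hcont : Continuous f := by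
    rw [hf]
    refine continuous_expTwoPiI.comp ?_
    have : Continuous fun t : Fin n → ℝ => L.quad (realC t + (L.toC r - z)) := by
      unfold quad bil realC
      simp only [dotProduct, Matrix.mulVec, Pi.add_apply]
      fun_prop
    fun_prop
  have hfterm : ∀ (t : Fin n → ℝ) (u : Fin n → ℤ), f (t + fun i => (u i : ℝ)) =
      L.thetaTerm ((ModularGroup.S • τ : ℍ) : ℂ) ((τ : ℂ)⁻¹ • (z - realC t)) (L.toC r + intC u) *
        expTwoPiI (-L.quad (z - realC t) / τ) := by
    intro t u
    rw [hf, thetaTerm, ← expTwoPiI_add]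
    beta_reduce
    congr 1
    have e1 : realC (t + fun i => (u i : ℝ)) + (L.toC r - z) =
        (L.toC r + intC u) - (z - realC t) := by
      ext i
      simp [realC, intC]
      ring
    rw [e1, L.quad_sub (L.toC r + intC u), coe_S_smul, bil_smul_right]
    field_simp
    ring
  -- For `t` in a bounded set the shifted argument of the theta term stays bounded and the remaining
  -- exponential is continuous, so the uniform theta bound applies.
  have hloc : ∀ R : ℝ, ∃ w : (Fin n → ℤ) → ℝ, Summable w ∧ ∀ (t : Fin n → ℝ) (u : Fin n → ℤ),
      ‖t‖ ≤ R → ‖f (t + fun i => (u i : ℝ))‖ ≤ w u := by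
    intro R
    have hcomp : IsCompact (Metric.closedBall (0 : Fin n → ℝ) R) := isCompact_closedBall _ _
    have hc1 : Continuous fun t : Fin n → ℝ => ‖(τ : ℂ)⁻¹ • (z - realC t)‖ := by
      unfold realC
      fun_prop
    have hc2 : Continuous fun t : Fin n → ℝ => expTwoPiI (-L.quad (z - realC t) / τ) := by
      refine continuous_expTwoPiI.comp ?_
      have : Continuous fun t : Fin n → ℝ => L.quad (z - realC t) := by
        unfold quad bil realC
        simp only [dotProduct, Matrix.mulVec, Pi.sub_apply]
        fun_prop
      fun_prop
    obtain ⟨B, hB⟩ := hcomp.exists_bound_of_continuousOn hc1.continuousOn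
    obtain ⟨C, hC⟩ := hcomp.exists_bound_of_continuousOn hc2.continuousOn
    obtain ⟨w, hw, hb⟩ := L.exists_summable_bound (fun i => ((r : Fin n → ℚ) i : ℝ))
      (ModularGroup.S • τ).im_pos (le_max_right B 0)
    refine ⟨fun u => w u * C, hw.mul_right C, fun t u ht => ?_⟩
    have ht' : t ∈ Metric.closedBall (0 : Fin n → ℝ) R := by simpa using ht
    have h1 := hB t ht'
    rw [norm_norm] at h1
    rw [hfterm, norm_mul, toC_eq_realC]
    have h2 := hb ((ModularGroup.S • τ : ℍ) : ℂ) _ u le_rfl (h1.trans (le_max_left B 0))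
    exact mul_le_mul h2 (hC t ht') (norm_nonneg _) ((norm_nonneg _).trans h2)
  have hE : HasSum (fun m : Fin n → ℤ => ∫ t : Fin n → ℝ,
      expTwoPiI (-∑ i, (m i : ℂ) * t i) * f t)
      (L.inversionFactor τ * ∑ y, L.pair y (-QuotientAddGroup.mk r) * L.theta y τ z) := by
    have h1 := (L.coordEquiv.trans (Equiv.neg L.dual)).hasSum_iff.mpr hdual
    refine h1.congr_fun fun m => ?_
    rw [hcoef]
    rfl
  rw [← (hasSum_fourier_of_locally_summable hcont hloc hE.summable).unique hE, theta_mk,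
    ← tsum_mul_right]
  refine tsum_congr fun u => ?_
  have h0 := hfterm 0 u
  rw [zero_add] at h0
  rw [h0]
  have : realC (0 : Fin n → ℝ) = 0 := by ext i; simp [realC]
  rw [this, sub_zero]

end EvenLattice

namespace EvenLattice

variable {n : ℕ} (L : EvenLattice n) (k : ℤ)

/-! ### Transformation of theta expansions under `SL₂(ℤ)` -/

/-- At `τ = i`, `z = 0` all terms are positive reals. This makes the vector of theta values nonzero,
so that its norm can be cancelled in `card_disc`. -/
theorem theta_zero_I_ne_zero : L.theta 0 UpperHalfPlane.I 0 ≠ 0 := by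
  have h1 : ∀ u : Fin n → ℤ, L.thetaTerm (UpperHalfPlane.I : ℂ) 0 (L.toC 0 + intC u) =
      ((Real.exp (-(2 * Real.pi * L.quad (fun i => (u i : ℝ)))) : ℝ) : ℂ) := by
    intro u
    have h2 : intC u = realC (fun i => (u i : ℝ)) := by ext i; simp [intC, realC]
    rw [thetaTerm, toC_zero, zero_add, bil_zero_right, add_zero, h2, quad_realC, expTwoPiI,
      Complex.ofReal_exp]
    congr 1
    push_cast
    linear_combination (2 * Real.pi * ((L.quad (fun i => (u i : ℝ)) : ℝ) : ℂ)) * Complex.I_sq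
  have hs := (L.summable_norm_thetaTerm 0 UpperHalfPlane.I.im_pos 0).of_norm
  rw [← QuotientAddGroup.mk_zero, theta_mk]
  simp only [h1] at hs ⊢
  rw [← Complex.ofReal_tsum, Complex.ofReal_ne_zero]
  exact ((Complex.summable_ofReal.mp hs).tsum_pos (fun u => (Real.exp_pos _).le) 0
    (Real.exp_pos _)).ne'

/-- The point `i` is fixed by `S`, so at `z = 0` the inversion formula says that the vector of theta
values is a multiple of its own finite Fourier transform. Comparing norms by Plancherel leaves `|L^#
/ L| / |det G| = 1`. -/
theorem card_disc : (Fintype.card L.disc : ℝ) = |(L.gram.det : ℝ)| := by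
  have hS : ModularGroup.S • UpperHalfPlane.I = UpperHalfPlane.I := by
    apply UpperHalfPlane.ext
    rw [coe_S_smul, UpperHalfPlane.coe_I]
    simp
  have h1 : ∀ x, L.theta x UpperHalfPlane.I 0 = L.inversionFactor UpperHalfPlane.I *
      ∑ y, L.pair x (-y) * L.theta y UpperHalfPlane.I 0 := by
    intro x
    have h := L.theta_inversion x UpperHalfPlane.I 0
    rw [hS, smul_zero, quad_zero, neg_zero, zero_div, expTwoPiI_zero, mul_one] at h
    rw [h]
    congr 1
    refine Finset.sum_congr rfl fun y _ => ?_
    rw [pair_neg_right, pair_neg_right, pair_comm]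
  have h2 : ∑ x, ‖L.theta x UpperHalfPlane.I 0‖ ^ 2 =
      ‖L.inversionFactor UpperHalfPlane.I‖ ^ 2 *
        (Fintype.card L.disc * ∑ x, ‖L.theta x UpperHalfPlane.I 0‖ ^ 2) := by
    conv_lhs => rw [Finset.sum_congr rfl fun x _ => by rw [h1 x, norm_mul, mul_pow]]
    rw [← Finset.mul_sum, sum_normSq_fourier]
  have h3 : 0 < ∑ x, ‖L.theta x UpperHalfPlane.I 0‖ ^ 2 :=
    Finset.sum_pos' (fun x _ => by positivity)
      ⟨0, Finset.mem_univ _, by have := norm_pos_iff.mpr L.theta_zero_I_ne_zero; positivity⟩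
  have hdet : (L.gram.det : ℝ) ≠ 0 := by exact_mod_cast L.gram_det_ne_zero
  rw [norm_inversionFactor_sq, UpperHalfPlane.coe_I, Complex.norm_I, one_pow, ← mul_assoc] at h2
  have h4 : 1 / |(L.gram.det : ℝ)| * Fintype.card L.disc = 1 := by
    have h5 := sub_eq_zero.mpr h2
    rw [← one_sub_mul, mul_eq_zero] at h5
    linarith [h5.resolve_right h3.ne']
  have hd := abs_pos.mpr hdet
  field_simp at h4
  exact h4

/-- A function `ℍ → ℂ[L^# / L]` with holomorphic components. -/
def IsHoloVec (F : ℍ → L.disc → ℂ) : Prop :=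
  ∀ y, DifferentiableOn ℂ (fun w => F (ofComplex w) y) {w | 0 < w.im}

/-- `A` acts on the functions `∑ h_y ϑ_y` with holomorphic `h_y`, and the norm of the vector
`(h_y)` transforms with weight `k - n / 2`. -/
def ActsOnThetaExpansions (A : SL(2, ℤ)) : Prop :=
  ∀ F : ℍ → L.disc → ℂ, L.IsHoloVec F → ∃ F' : ℍ → L.disc → ℂ, L.IsHoloVec F' ∧
    L.slashMat k (L.ofVec F) A = L.ofVec F' ∧
    ∀ τ, ∑ y, ‖F' τ y‖ ^ 2 = ‖autFactor A τ‖ ^ ((n : ℤ) - 2 * k) * ∑ y, ‖F (A • τ) y‖ ^ 2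

variable {L k} in
theorem ActsOnThetaExpansions.mul {A B : SL(2, ℤ)} (hA : L.ActsOnThetaExpansions k A)
    (hB : L.ActsOnThetaExpansions k B) : L.ActsOnThetaExpansions k (A * B) := by
  intro F hF
  obtain ⟨F', hF', h1, h2⟩ := hA F hF
  obtain ⟨F'', hF'', h3, h4⟩ := hB F' hF'
  refine ⟨F'', hF'', by rw [← slashMat_mul, h1, h3], fun τ => ?_⟩
  rw [h4, h2, autFactor_mul, norm_mul, mul_zpow, ← mul_assoc, mul_smul A B τ, mul_comm (‖_‖ ^ _)]

theorem autFactor_T_zpow (m : ℤ) (τ : ℍ) : autFactor (ModularGroup.T ^ m) τ = 1 := by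
  simp [autFactor, ModularGroup.coe_T_zpow]

theorem coe_T_zpow_smul (m : ℤ) (τ : ℍ) :
    ((ModularGroup.T ^ m • τ : ℍ) : ℂ) = τ + m := by
  rw [coe_sl_smul, autFactor_T_zpow]
  simp [ModularGroup.coe_T_zpow]

theorem slashMat_T_zpow (φ : ℍ → (Fin n → ℂ) → ℂ) (m : ℤ) (τ : ℍ) (z : Fin n → ℂ) :
    L.slashMat k φ (ModularGroup.T ^ m) τ z = φ (ModularGroup.T ^ m • τ) z := by
  rw [slashMat_apply, autFactor_T_zpow]
  simp [ModularGroup.coe_T_zpow, expTwoPiI_zero]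

theorem theta_T_zpow (x : L.disc) (m : ℤ) (τ : ℍ) (z : Fin n → ℂ) :
    L.theta x (ModularGroup.T ^ m • τ) z = L.quadChar x ^ m * L.theta x τ z :=
  L.theta_translate_int x m τ _ (coe_T_zpow_smul m τ) z

theorem actsOnThetaExpansions_T_zpow (m : ℤ) :
    L.ActsOnThetaExpansions k (ModularGroup.T ^ m) := by
  intro F hF
  refine ⟨fun τ y => F (ModularGroup.T ^ m • τ) y * L.quadChar y ^ m, fun y => ?_, ?_,
    fun τ => ?_⟩
  · refine DifferentiableOn.mul_const ?_ _
    have h : DifferentiableOn ℂ (fun w => F (ofComplex (w + m)) y) {w | 0 < w.im} :=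
      (hF y).comp (by fun_prop) fun w hw => by simpa using hw
    refine h.congr fun w hw => ?_
    have hw : 0 < w.im := hw
    have hw' : 0 < (w + m).im := by simpa using hw
    congr 1
    apply UpperHalfPlane.ext
    rw [coe_T_zpow_smul, UpperHalfPlane.ofComplex_apply_of_im_pos hw,
      UpperHalfPlane.ofComplex_apply_of_im_pos hw']
  · funext τ z
    rw [slashMat_T_zpow, ofVec, ofVec]
    refine Finset.sum_congr rfl fun y _ => ?_
    rw [theta_T_zpow, mul_assoc]
  · simp [autFactor_T_zpow, norm_quadChar]

/-- The new coefficients are read off from `theta_inversion`. In their norm the factor `|L^# / L|`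
of Plancherel cancels the determinant in the inversion factor, leaving `|τ|^n |τ|^{-2k}`. -/
theorem actsOnThetaExpansions_S : L.ActsOnThetaExpansions k ModularGroup.S := by
  intro F hF
  refine ⟨fun τ y => (τ : ℂ) ^ (-k) * L.inversionFactor τ *
    ∑ x, L.pair y (-x) * F (ModularGroup.S • τ) x, fun y => ?_, ?_, fun τ => ?_⟩
  · have h1 : ∀ x, DifferentiableOn ℂ (fun w => F (ofComplex (-1 / w)) x) {w | 0 < w.im} := by
      intro x
      refine (hF x).comp (DifferentiableOn.div (by fun_prop) differentiableOn_id fun w hw h => ?_)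
        fun w hw => ?_
      · have hw : 0 < w.im := hw
        rw [h] at hw
        simp at hw
      · have hw : 0 < w.im := hw
        have := (ModularGroup.S • (⟨w, hw⟩ : ℍ)).im_pos
        rw [← UpperHalfPlane.coe_im, coe_S_smul] at this
        exact this
    have h2 : DifferentiableOn ℂ (fun w : ℂ => w ^ (-k) * L.inversionFactor w *
        ∑ x, L.pair y (-x) * F (ofComplex (-1 / w)) x) {w | 0 < w.im} := by
      refine DifferentiableOn.mul (DifferentiableOn.mul ?_ L.differentiableOn_inversionFactor)
        (DifferentiableOn.fun_sum fun x _ => (h1 x).const_mul _)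
      intro w hw
      refine (differentiableAt_zpow.mpr (Or.inl fun h => ?_)).differentiableWithinAt
      have hw : 0 < w.im := hw
      simp [h] at hw
    refine h2.congr fun w hw => ?_
    have hw : 0 < w.im := hw
    have hS : ModularGroup.S • ofComplex w = ofComplex (-1 / w) := by
      have h3 := (ModularGroup.S • ofComplex w).im_pos
      rw [← UpperHalfPlane.coe_im, coe_S_smul, UpperHalfPlane.ofComplex_apply_of_im_pos hw] at h3
      apply UpperHalfPlane.ext
      rw [coe_S_smul, UpperHalfPlane.ofComplex_apply_of_im_pos hw,
        UpperHalfPlane.ofComplex_apply_of_im_pos h3]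
    beta_reduce
    rw [hS, UpperHalfPlane.ofComplex_apply_of_im_pos hw]
  · funext τ z
    have h10 : (ModularGroup.S 1 0 : ℤ) = 1 := by simp [ModularGroup.S]
    rw [slashMat_apply, autFactor_S, h10, ofVec, ofVec, Int.cast_one, neg_one_mul,
      Finset.sum_mul, Finset.sum_mul]
    have h1 : ∀ x, F (ModularGroup.S • τ) x * L.theta x (ModularGroup.S • τ) ((τ : ℂ)⁻¹ • z) *
        (τ : ℂ) ^ (-k) * expTwoPiI (-L.quad z / τ) =
        ∑ y, (τ : ℂ) ^ (-k) * L.inversionFactor τ * (L.pair y (-x) * F (ModularGroup.S • τ) x) *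
          L.theta y τ z := by
      intro x
      have h := L.theta_inversion x τ z
      rw [show ∀ a b c d : ℂ, a * b * c * d = c * a * (b * d) by intros; ring, h, Finset.mul_sum,
        Finset.mul_sum]
      refine Finset.sum_congr rfl fun y _ => ?_
      ring
    rw [Finset.sum_congr rfl fun x _ => h1 x, Finset.sum_comm]
    refine Finset.sum_congr rfl fun y _ => ?_
    rw [← Finset.sum_mul, ← Finset.mul_sum]
  · have hτ : ‖(τ : ℂ)‖ ≠ 0 := norm_ne_zero_iff.mpr τ.ne_zero
    have hdet : |(L.gram.det : ℝ)| ≠ 0 := abs_ne_zero.mpr (by exact_mod_cast L.gram_det_ne_zero)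
    simp only [norm_mul, mul_pow]
    rw [← Finset.mul_sum, sum_normSq_fourier, norm_inversionFactor_sq, card_disc, autFactor_S,
      norm_zpow, zpow_sub₀ hτ, zpow_natCast, zpow_neg, inv_pow, ← zpow_natCast (_ ^ k),
      ← zpow_mul, mul_comm k]
    field_simp
    push_cast
    ring

/-- The property is stable under products, so the generators suffice; `S⁻¹ = S³` takes care of the
inverse of `S`. -/
theorem actsOnThetaExpansions (A : SL(2, ℤ)) : L.ActsOnThetaExpansions k A := by
  have hA : A ∈ Subgroup.closure {ModularGroup.S, ModularGroup.T} := by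
    rw [SpecialLinearGroup.SL2Z_generators]
    trivial
  have hT : ∀ m : ℤ, L.ActsOnThetaExpansions k (ModularGroup.T ^ m) :=
    L.actsOnThetaExpansions_T_zpow k
  have hS := L.actsOnThetaExpansions_S k
  induction hA using Subgroup.closure_induction'' with
  | mem x hx =>
    rcases hx with rfl | rfl
    · exact hS
    · simpa using hT 1
  | inv_mem x hx =>
    rcases hx with rfl | rfl
    · have : ModularGroup.S⁻¹ = ModularGroup.S * ModularGroup.S * ModularGroup.S := by
        decide
      rw [this]
      exact (hS.mul hS).mul hS
    · simpa using hT (-1)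
  | one => simpa using hT 0
  | mul x y _ _ hx hy => exact hx.mul hy

end EvenLattice

/-! ### Cosets -/

namespace JacobiGroup

variable {n : ℕ}

theorem mk_eq_mk_iff (g h : JacobiGroup n) :
    (Quotient.mk'' g : Cosets n) = Quotient.mk'' h ↔ h * g⁻¹ ∈ stab n := by
  rw [Quotient.eq'', QuotientGroup.rightRel_apply]

theorem mk_modular_eq_mk_iff (A B : SL(2, ℤ)) :
    (Quotient.mk'' A : ModularCosets) = Quotient.mk'' B ↔ ∃ m : ℤ, ModularGroup.T ^ m * A = B := by
  rw [Quotient.eq'', QuotientGroup.rightRel_apply, Subgroup.mem_zpowers_iff]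
  exact exists_congr fun m => eq_mul_inv_iff_mul_eq

theorem mem_stab_iff (g : JacobiGroup n) :
    g ∈ stab n ↔ (∃ m : ℤ, g.mat = ModularGroup.T ^ m) ∧ g.x = 0 := Iff.rfl

theorem mk_out (A : ModularCosets) : (Quotient.mk'' (Quotient.out A) : ModularCosets) = A :=
  Quotient.out_eq' A

theorem one_mul_inv (u v : Fin n → ℤ) :
    (⟨1, u, 0⟩ : JacobiGroup n) * (⟨1, v, 0⟩ : JacobiGroup n)⁻¹ = ⟨1, u - v, 0⟩ := by
  rw [mul_inv_eq_iff_eq_mul, mul_def]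
  ext <;> simp

/-- The cosets in `J_∞ \ J` over the class of `B` in `Γ_∞ \ Γ`. -/
def fiberEquiv (B : SL(2, ℤ)) :
    (Fin n → ℤ) ≃ {γ : Cosets n // projCoset γ = Quotient.mk'' B} :=
  Equiv.ofBijective
    (fun u => ⟨Quotient.mk'' ((⟨1, u, 0⟩ : JacobiGroup n) * ⟨B, 0, 0⟩),
      congrArg Quotient.mk'' (one_mul B)⟩) (by
      constructor
      · intro u v h
        have h1 := congrArg Subtype.val h
        rw [mk_eq_mk_iff, mul_inv_rev, mul_assoc, mul_inv_cancel_left, one_mul_inv,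
          mem_stab_iff] at h1
        exact (sub_eq_zero.mp h1.2).symm
      · rintro ⟨γ, hγ⟩
        induction γ using Quotient.inductionOn' with | h g => ?_
        have hγ' : (Quotient.mk'' g.mat : ModularCosets) = Quotient.mk'' B := hγ
        obtain ⟨m, hm⟩ := (mk_modular_eq_mk_iff _ _).mp hγ'.symm
        set p := g * (⟨B, 0, 0⟩ : JacobiGroup n)⁻¹ with hp
        have hg : g = p * ⟨B, 0, 0⟩ := by rw [hp, inv_mul_cancel_right]
        have hpm : p.mat = ModularGroup.T ^ m := by
          rw [hp, mul_def, inv_def, ← hm, mul_inv_cancel_right]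
        -- The first factor lies in `J_∞`, so the coset is determined by `p.x`.
        have hp2 : p = ⟨ModularGroup.T ^ m, 0, p.y⟩ * ⟨1, p.x, 0⟩ := by
          rw [mul_def]
          ext <;> simp [hpm]
        refine ⟨p.x, Subtype.ext ?_⟩
        change (Quotient.mk'' _ : Cosets n) = Quotient.mk'' g
        rw [mk_eq_mk_iff, hg, mul_inv_rev, mul_assoc, mul_inv_cancel_left, hp2, mul_assoc,
          one_mul_inv, mem_stab_iff]
        refine ⟨⟨m, ?_⟩, ?_⟩
        · rw [mul_def, mul_one]
        · simp [mul_def])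

theorem fiberEquiv_coe (B : SL(2, ℤ)) (u : Fin n → ℤ) :
    (fiberEquiv B u : Cosets n) = Quotient.mk'' ((⟨1, u, 0⟩ : JacobiGroup n) * ⟨B, 0, 0⟩) := rfl

/-- Right multiplication on `Γ_∞ \ Γ`. -/
def mulRight (B : SL(2, ℤ)) : ModularCosets → ModularCosets :=
  Quotient.map' (· * B) (by
    intro a b h
    rw [QuotientGroup.rightRel_apply] at h ⊢
    simpa [mul_assoc] using h)

theorem mulRight_mk (A B : SL(2, ℤ)) :
    mulRight B (Quotient.mk'' A) = Quotient.mk'' (A * B) := rfl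

/-- Right multiplication as a permutation of `Γ_∞ \ Γ`. -/
def mulRightEquiv (B : SL(2, ℤ)) : ModularCosets ≃ ModularCosets where
  toFun := mulRight B
  invFun := mulRight B⁻¹
  left_inv A := by
    rw [← mk_out A, mulRight_mk, mulRight_mk, mul_inv_cancel_right]
  right_inv A := by
    rw [← mk_out A, mulRight_mk, mulRight_mk, inv_mul_cancel_right]

/-- A class in `Γ_∞ \ Γ` is determined by the bottom row of its elements. -/
theorem bottomRow_injective :
    Function.Injective fun A : ModularCosets => (Quotient.out A : SL(2, ℤ)) 1 := by
  intro A B h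
  rw [← mk_out A, ← mk_out B, mk_modular_eq_mk_iff]
  set a := Quotient.out A
  set b := Quotient.out B
  have h0 : a 1 0 = b 1 0 := congrFun h 0
  have h1 : a 1 1 = b 1 1 := congrFun h 1
  have ha := a.det_coe
  have hb := b.det_coe
  rw [Matrix.det_fin_two] at ha hb
  rw [← h0, ← h1] at hb
  -- If the top row of `b` is that of `a` plus `m` times the common bottom row, this expression
  -- equals `m · det a = m`.
  refine ⟨b 0 1 * a 0 0 - b 0 0 * a 0 1, ?_⟩
  ext i j
  rw [sl_mul_apply, ModularGroup.coe_T_zpow]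
  fin_cases i <;> fin_cases j
  · simp
    linear_combination b 0 0 * ha - a 0 0 * hb
  · simp
    linear_combination b 0 1 * ha - a 0 1 * hb
  · simpa using h0
  · simpa using h1

end JacobiGroup

namespace EvenLattice

open JacobiGroup

variable {n : ℕ} (L : EvenLattice n) (k : ℤ)

/-! ### The blocks of the Eisenstein series -/

theorem seed_zero_apply (r : L.dual) (τ : ℍ) (z : Fin n → ℂ) :
    L.seed 0 r τ z = L.thetaTerm τ z (L.toC r) := by
  simp [seed, thetaTerm]

/-- `T^m` contributes `e(mβ(r)) = 1` because `r` is isotropic, and `(0, v)` contributes `e(β(r, v))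
= 1` because `r ∈ L^#`. This makes the terms of the series independent of the coset representatives.
-/
theorem slash_seed_of_mem_stab {r : L.dual} (hr : L.quadChar (QuotientAddGroup.mk r) = 1)
    {g : JacobiGroup n} (hg : g ∈ stab n) : L.slash k (L.seed 0 r) g = L.seed 0 r := by
  obtain ⟨⟨m, hm⟩, hx⟩ := hg
  obtain ⟨a, ha⟩ := L.exists_bil_toC_intC r g.y
  funext τ z
  rw [slash, slashHeis_apply, hm, slashMat_T_zpow, hx, intC_zero, quad_zero, bil_zero_left,
    mul_zero, add_zero, expTwoPiI_zero, mul_one, smul_zero, add_zero, seed_zero_apply,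
    seed_zero_apply, coe_T_zpow_smul, thetaTerm, thetaTerm, bil_add_right, ha, add_mul,
    show ∀ a b c d : ℂ, a + b + (c + d) = a + c + b + d by intros; ring, expTwoPiI_add,
    expTwoPiI_int, mul_one, expTwoPiI_add, expTwoPiI_int_mul, expTwoPiI_quad, hr, one_zpow,
    mul_one]

theorem poincareTerm_mk {r : L.dual} (hr : L.quadChar (QuotientAddGroup.mk r) = 1)
    (g : JacobiGroup n) : L.poincareTerm k 0 r (Quotient.mk'' g) = L.slash k (L.seed 0 r) g := by
  set o := Quotient.out (Quotient.mk'' g : Cosets n) with ho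
  have h1 : (Quotient.mk'' o : Cosets n) = Quotient.mk'' g := Quotient.out_eq' _
  rw [JacobiGroup.mk_eq_mk_iff] at h1
  have h2 : g = g * o⁻¹ * o := by group
  rw [poincareTerm, ← ho]
  conv_rhs => rw [h2, ← slash_slash, L.slash_seed_of_mem_stab k hr h1]

theorem poincareTerm_fiberEquiv {r : L.dual} (hr : L.quadChar (QuotientAddGroup.mk r) = 1)
    (B : SL(2, ℤ)) (u : Fin n → ℤ) (τ : ℍ) (z : Fin n → ℂ) :
    L.poincareTerm k 0 r (fiberEquiv B u) τ z =
      L.thetaTerm ((B • τ : ℍ) : ℂ) ((autFactor B τ)⁻¹ • z) (L.toC r + intC u) *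
        autFactor B τ ^ (-k) * expTwoPiI (-(B 1 0 : ℂ) * L.quad z / autFactor B τ) := by
  have h0 : ∀ φ : ℍ → (Fin n → ℂ) → ℂ, L.slashHeis φ 0 0 = φ := by
    intro φ
    funext τ z
    simp [slashHeis_apply, intC_zero, quad_zero, bil_zero_left, expTwoPiI_zero]
  rw [fiberEquiv_coe, L.poincareTerm_mk k hr, ← slash_slash, slash, h0, slashMat_apply]
  congr 2
  rw [slash, slashMat_one, slashHeis_apply, intC_zero, add_zero, seed_zero_apply, thetaTerm,
    thetaTerm, ← expTwoPiI_add]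
  congr 1
  simp only [quad_add, bil_add_left, bil_add_right, bil_smul_right]
  ring

/-- `fiberEquiv` turns the block into a sum over `L`, whose terms are those of the theta series of
`r + L`, slashed by `B`. So the inner sum converges like a Gaussian, for every `k`. -/
theorem hasSum_poincareTerm {r : L.dual} (hr : L.quadChar (QuotientAddGroup.mk r) = 1)
    (B : SL(2, ℤ)) (τ : ℍ) (z : Fin n → ℂ) :
    HasSum (fun γ : {γ : Cosets n // projCoset γ = Quotient.mk'' B} =>
        L.poincareTerm k 0 r γ τ z)
      (L.slashMat k (L.theta (QuotientAddGroup.mk r)) B τ z) := by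
  rw [← (fiberEquiv B).hasSum_iff, slashMat_apply, theta_mk]
  have h := (L.summable_norm_thetaTerm r (B • τ).im_pos ((autFactor B τ)⁻¹ • z)).of_norm.hasSum
  refine ((h.mul_right (autFactor B τ ^ (-k))).mul_right
    (expTwoPiI (-(B 1 0 : ℂ) * L.quad z / autFactor B τ))).congr_fun fun u => ?_
  exact L.poincareTerm_fiberEquiv k hr B u τ z

theorem poincareBlock_mk {x : L.disc} (hx : L.IsIsotropic x) (B : SL(2, ℤ)) (τ : ℍ)
    (z : Fin n → ℂ) :
    L.poincareBlock k 0 (L.rep x) (Quotient.mk'' B) τ z = L.slashMat k (L.theta x) B τ z := by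
  have hr : L.quadChar (QuotientAddGroup.mk (L.rep x)) = 1 := by
    rw [mk_rep, quadChar_eq_one_iff]
    exact hx
  have h := (L.hasSum_poincareTerm k hr B τ z).tsum_eq
  rw [mk_rep] at h
  exact h

theorem poincareBlock_eq {x : L.disc} (hx : L.IsIsotropic x) (A : ModularCosets) (τ : ℍ)
    (z : Fin n → ℂ) : L.poincareBlock k 0 (L.rep x) A τ z =
      L.slashMat k (L.theta x) (Quotient.out A) τ z := by
  rw [← L.poincareBlock_mk k hx, mk_out]

theorem eisenstein_apply {x : L.disc} (hx : L.IsIsotropic x) (τ : ℍ) (z : Fin n → ℂ) :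
    L.eisenstein k x τ z =
      (1 / 2) * ∑' A : ModularCosets, L.slashMat k (L.theta x) (Quotient.out A) τ z := by
  rw [eisenstein, poincare]
  congr 1
  exact tsum_congr fun A => L.poincareBlock_eq k hx A τ z

/-! ### The theta coefficients of the blocks -/

theorem ofVec_apply (F : ℍ → L.disc → ℂ) (τ : ℍ) (z : Fin n → ℂ) :
    L.ofVec F τ z = ∑ y, F τ y * L.theta y τ z := rfl

-- `ϑ_x` has the constant coefficient vector `𝔢_x` of norm one, so only the automorphy factor
-- remains in the norm.
open Classical in
theorem ofVec_single (x : L.disc) : L.ofVec (fun _ => Pi.single x 1) = L.theta x := by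
  funext τ z
  simp [ofVec_apply, Pi.single_apply]

open Classical in
theorem exists_thetaCoeff (x : L.disc) (A : SL(2, ℤ)) : ∃ F : ℍ → L.disc → ℂ, L.IsHoloVec F ∧
    L.slashMat k (L.theta x) A = L.ofVec F ∧
    ∀ τ, ∑ y, ‖F τ y‖ ^ 2 = ‖autFactor A τ‖ ^ ((n : ℤ) - 2 * k) := by
  obtain ⟨F', h1, h2, h3⟩ := L.actsOnThetaExpansions k A (fun _ => Pi.single x 1)
    fun y => differentiableOn_const _
  rw [ofVec_single] at h2
  refine ⟨F', h1, h2, fun τ => ?_⟩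
  rw [h3, Finset.sum_eq_single x]
  · simp
  · intro y _ hy
    simp [hy]
  · simp

/-- The coefficients of `ϑ_x|_{k,L} A` with respect to the theta series. -/
def thetaCoeff (x : L.disc) (A : SL(2, ℤ)) : ℍ → L.disc → ℂ :=
  Classical.choose (L.exists_thetaCoeff k x A)

theorem isHoloVec_thetaCoeff (x : L.disc) (A : SL(2, ℤ)) : L.IsHoloVec (L.thetaCoeff k x A) :=
  (Classical.choose_spec (L.exists_thetaCoeff k x A)).1

theorem slashMat_theta (x : L.disc) (A : SL(2, ℤ)) :
    L.slashMat k (L.theta x) A = L.ofVec (L.thetaCoeff k x A) :=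
  (Classical.choose_spec (L.exists_thetaCoeff k x A)).2.1

/-- One coordinate is bounded by the norm of the vector. The exponent `k - n/2` is the reason why `k
> n/2 + 2` suffices for convergence. -/
theorem norm_thetaCoeff_le (x : L.disc) (A : SL(2, ℤ)) (τ : ℍ) (y : L.disc) :
    ‖L.thetaCoeff k x A τ y‖ ≤ ‖autFactor A τ‖ ^ (-((k : ℝ) - n / 2)) := by
  have h1 : ‖L.thetaCoeff k x A τ y‖ ^ 2 ≤ ‖autFactor A τ‖ ^ ((n : ℤ) - 2 * k) := by
    rw [← (Classical.choose_spec (L.exists_thetaCoeff k x A)).2.2 τ]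
    exact Finset.single_le_sum (f := fun y => ‖L.thetaCoeff k x A τ y‖ ^ 2)
      (fun _ _ => sq_nonneg _) (Finset.mem_univ y)
  have h2 : ‖autFactor A τ‖ ^ ((n : ℤ) - 2 * k) =
      (‖autFactor A τ‖ ^ (-((k : ℝ) - n / 2))) ^ 2 := by
    rw [← Real.rpow_natCast, ← Real.rpow_mul (norm_nonneg _), ← Real.rpow_intCast]
    congr 1
    push_cast
    ring
  rw [h2] at h1
  exact le_of_sq_le_sq h1 (by positivity)

variable {k}

/-- On a vertical strip `|cτ + d|` is bounded below by a constant times the norm of `(c, d)`. The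
classes inject into `ℤ²` by their bottom rows, and the resulting sum converges for exponents above
`2`. -/
theorem exists_summable_autFactor_bound (hk : (n : ℤ) + 4 < 2 * k) (a : ℝ) {b : ℝ} (hb : 0 < b) :
    ∃ w : ModularCosets → ℝ, Summable w ∧ ∀ τ : ℍ, τ ∈ verticalStrip a b → ∀ A : ModularCosets,
      ‖autFactor (Quotient.out A) τ‖ ^ (-((k : ℝ) - n / 2)) ≤ w A := by
  have hs : 2 < (k : ℝ) - n / 2 := by
    have : (n : ℝ) + 4 < 2 * k := by exact_mod_cast hk
    linarith
  refine ⟨fun A => EisensteinSeries.r ⟨⟨a, b⟩, hb⟩ ^ (-((k : ℝ) - n / 2)) *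
    ‖(Quotient.out A : SL(2, ℤ)) 1‖ ^ (-((k : ℝ) - n / 2)), ?_, fun τ hτ A => ?_⟩
  · exact ((EisensteinSeries.summable_one_div_norm_rpow hs).comp_injective
      bottomRow_injective).mul_left _
  · exact EisensteinSeries.summand_bound_of_mem_verticalStrip (by linarith)
      ((Quotient.out A : SL(2, ℤ)) 1) hb hτ

theorem summable_thetaCoeff (hk : (n : ℤ) + 4 < 2 * k) (x : L.disc) (τ : ℍ) (y : L.disc) :
    Summable fun A : ModularCosets => L.thetaCoeff k x (Quotient.out A) τ y := by
  obtain ⟨w, hw, hb⟩ := exists_summable_autFactor_bound hk |τ.re| τ.im_pos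
  exact Summable.of_norm_bounded hw fun A =>
    (L.norm_thetaCoeff_le k x _ τ y).trans (hb τ ⟨le_rfl, le_rfl⟩ A)

theorem hasSum_slashMat_theta (hk : (n : ℤ) + 4 < 2 * k) (x : L.disc) (τ : ℍ) (z : Fin n → ℂ) :
    HasSum (fun A : ModularCosets => L.slashMat k (L.theta x) (Quotient.out A) τ z)
      (∑ y, (∑' A : ModularCosets, L.thetaCoeff k x (Quotient.out A) τ y) * L.theta y τ z) := by
  simp only [slashMat_theta, ofVec_apply]
  exact hasSum_sum fun y _ => (L.summable_thetaCoeff hk x τ y).hasSum.mul_right _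

theorem eisensteinConverges (hk : (n : ℤ) + 4 < 2 * k) {x : L.disc} (hx : L.IsIsotropic x) :
    L.EisensteinConverges k x := by
  intro τ z
  constructor
  · intro A
    have hr : L.quadChar (QuotientAddGroup.mk (L.rep x)) = 1 := by
      rw [mk_rep, quadChar_eq_one_iff]
      exact hx
    rw [← mk_out A]
    exact (L.hasSum_poincareTerm k hr _ τ z).summable
  · exact (L.hasSum_slashMat_theta hk x τ z).summable.congr fun A =>
      (L.poincareBlock_eq k hx A τ z).symm

/-- The theta coefficients of the Eisenstein series. -/
def eisVec (k : ℤ) (x : L.disc) : ℍ → L.disc → ℂ := fun τ y =>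
  (1 / 2) * ∑' A : ModularCosets, L.thetaCoeff k x (Quotient.out A) τ y

theorem eisenstein_eq_ofVec (hk : (n : ℤ) + 4 < 2 * k) {x : L.disc} (hx : L.IsIsotropic x) :
    L.eisenstein k x = L.ofVec (L.eisVec k x) := by
  funext τ z
  rw [L.eisenstein_apply k hx, (L.hasSum_slashMat_theta hk x τ z).tsum_eq, ofVec_apply,
    Finset.mul_sum]
  exact Finset.sum_congr rfl fun y _ => (mul_assoc _ _ _).symm

theorem isHoloVec_eisVec (hk : (n : ℤ) + 4 < 2 * k) (x : L.disc) :
    L.IsHoloVec (L.eisVec k x) := by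
  intro y
  refine DifferentiableOn.const_mul (differentiableOn_tsum_of_locally_summable
    (isOpen_lt continuous_const Complex.continuous_im)
    (fun A => L.isHoloVec_thetaCoeff k x (Quotient.out A) y) fun τ hτ => ?_) _
  have hτ : 0 < τ.im := hτ
  obtain ⟨w, hw, hb⟩ := exists_summable_autFactor_bound hk (|τ.re| + 1) (half_pos hτ)
  refine ⟨{v | |v.re| < |τ.re| + 1} ∩ {v | τ.im / 2 < v.im}, IsOpen.mem_nhds ?_ ?_, w, hw,
    fun A v hv => ?_⟩
  · exact (isOpen_lt (continuous_abs.comp Complex.continuous_re) continuous_const).inter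
      (isOpen_lt continuous_const Complex.continuous_im)
  · exact ⟨lt_add_one |τ.re|, half_lt_self hτ⟩
  · have hv0 : 0 < v.im := (half_pos hτ).trans hv.2
    refine (L.norm_thetaCoeff_le k x _ _ y).trans (hb _ ?_ A)
    rw [UpperHalfPlane.ofComplex_apply_of_im_pos hv0]
    exact ⟨hv.1.le, hv.2.le⟩

/-- Boundedness up to `i∞` is what excludes Fourier coefficients with `m < β(r)`. -/
theorem exists_bound_eisVec (hk : (n : ℤ) + 4 < 2 * k) (x : L.disc) (a : ℝ) {b : ℝ} (hb : 0 < b) :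
    ∃ C : ℝ, ∀ τ : ℍ, τ ∈ verticalStrip a b → ∀ y, ‖L.eisVec k x τ y‖ ≤ C := by
  obtain ⟨w, hw, hb⟩ := exists_summable_autFactor_bound hk a hb
  refine ⟨‖(1 / 2 : ℂ)‖ * ∑' A, w A, fun τ hτ y => ?_⟩
  rw [eisVec, norm_mul]
  gcongr
  exact tsum_of_norm_bounded hw.hasSum fun A =>
    (L.norm_thetaCoeff_le k x _ τ y).trans (hb τ hτ A)

/-! ### Invariance -/

theorem slashHeis_ofVec (F : ℍ → L.disc → ℂ) (u v : Fin n → ℤ) :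
    L.slashHeis (L.ofVec F) u v = L.ofVec F := by
  funext τ z
  rw [slashHeis_apply, ofVec_apply, ofVec_apply, Finset.sum_mul]
  refine Finset.sum_congr rfl fun y _ => ?_
  have h := congrFun (congrFun (L.slashHeis_theta y u v) τ) z
  rw [slashHeis_apply] at h
  rw [mul_assoc, h]

/-- Right multiplication by `B` permutes `Γ_∞ \ SL₂(ℤ)` and hence the blocks. -/
theorem slashMat_eisenstein {x : L.disc} (hx : L.IsIsotropic x) (B : SL(2, ℤ)) :
    L.slashMat k (L.eisenstein k x) B = L.eisenstein k x := by
  funext τ z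
  rw [slashMat_apply, L.eisenstein_apply k hx, mul_assoc, mul_assoc, ← tsum_mul_right, eisenstein,
    poincare]
  conv_rhs => rw [← (mulRightEquiv B).tsum_eq]
  congr 1
  refine tsum_congr fun A => ?_
  have h : mulRightEquiv B A = Quotient.mk'' (Quotient.out A * B) := by
    conv_lhs => rw [← mk_out A]
    rfl
  rw [h, L.poincareBlock_mk k hx, ← slashMat_mul, L.slashMat_apply k _ B, mul_assoc]

theorem slash_eisenstein (hk : (n : ℤ) + 4 < 2 * k) {x : L.disc} (hx : L.IsIsotropic x)
    (g : JacobiGroup n) : L.slash k (L.eisenstein k x) g = L.eisenstein k x := by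
  rw [slash, L.slashMat_eisenstein hx, L.eisenstein_eq_ofVec hk hx, slashHeis_ofVec]

theorem differentiableOn_ofVec {F : ℍ → L.disc → ℂ} (hF : L.IsHoloVec F) :
    DifferentiableOn ℂ (fun p : ℂ × (Fin n → ℂ) => L.ofVec F (ofComplex p.1) p.2)
      {p | 0 < p.1.im} := by
  simp only [ofVec_apply]
  refine DifferentiableOn.fun_sum fun y _ => DifferentiableOn.mul ?_ (L.differentiableOn_theta y)
  exact (hF y).comp (t := {w : ℂ | 0 < w.im}) differentiableOn_fst fun p hp => hp

end EvenLattice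

/-! ### Fourier expansions in one variable -/

theorem norm_eq_of_T_zpow {f : ℍ → ℂ} {u : ℂ} (hu : ‖u‖ = 1)
    (hT : ∀ τ, f (ModularGroup.T • τ) * u = f τ) (m : ℤ) (τ : ℍ) :
    ‖f (ModularGroup.T ^ m • τ)‖ = ‖f τ‖ := by
  have h1 : ∀ τ, ‖f (ModularGroup.T • τ)‖ = ‖f τ‖ := by
    intro τ
    rw [← hT τ, norm_mul, hu, mul_one]
  induction m using Int.induction_on with
  | zero => simp
  | succ m ih => rw [add_comm, zpow_add, zpow_one, mul_smul, h1, ih]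
  | pred m ih =>
    rw [← ih, ← h1 (ModularGroup.T ^ (-(m : ℤ) - 1) • τ), ← mul_smul, ← zpow_one_add]
    congr 3
    ring_nf

theorem exists_T_zpow_smul_mem_verticalStrip (τ : ℍ) :
    ∃ m : ℤ, ModularGroup.T ^ m • τ ∈ verticalStrip 1 τ.im := by
  refine ⟨-⌊τ.re⌋, ?_⟩
  have h := EvenLattice.coe_T_zpow_smul (-⌊τ.re⌋) τ
  have h1 : (ModularGroup.T ^ (-⌊τ.re⌋) • τ).re = τ.re - ⌊τ.re⌋ := by
    have := congrArg Complex.re h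
    simpa [sub_eq_add_neg] using this
  have h2 : (ModularGroup.T ^ (-⌊τ.re⌋) • τ).im = τ.im := by
    have := congrArg Complex.im h
    simpa using this
  refine ⟨?_, h2.ge⟩
  rw [h1, abs_le]
  constructor <;> linarith [Int.floor_le τ.re, Int.lt_floor_add_one τ.re]

-- Twisting `f` by `e((b - M)τ)` with an integer `M < b` makes it 1-periodic and forces decay at
-- `i∞`. Its `q`-expansion has no constant term, and undoing the twist gives the expansion of `f`.
open scoped Manifold in
theorem exists_fourier_expansion {f : ℍ → ℂ} {b : ℝ}
    (hf : DifferentiableOn ℂ (fun w => f (ofComplex w)) {w | 0 < w.im})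
    (hT : ∀ τ, f (ModularGroup.T • τ) * expTwoPiI b = f τ) {C : ℝ}
    (hC : ∀ τ ∈ verticalStrip 1 1, ‖f τ‖ ≤ C) :
    ∃ a : ℤ → ℂ, (∀ m : ℤ, (m : ℝ) < b → a m = 0) ∧
      ∀ τ : ℍ, HasSum (fun m => a m * expTwoPiI ((m - b) * τ)) (f τ) := by
  -- The largest integer strictly below `b`, also when `b` is an integer. Thus `m < b` means `m ≤
  -- M`, and the coefficient at `m = M` is the vanishing constant term.
  set M : ℤ := ⌈b⌉ - 1 with hM
  set G : ℍ → ℂ := fun τ => f τ * expTwoPiI ((b - M) * τ) with hG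
  have hb : 0 < b - M := by
    rw [hM]
    push_cast
    linarith [Int.ceil_lt_add_one b]
  have hCn : ∀ τ : ℍ, 1 ≤ τ.im → ‖f τ‖ ≤ C := by
    intro τ hτ
    obtain ⟨m, hm⟩ := exists_T_zpow_smul_mem_verticalStrip τ
    rw [← norm_eq_of_T_zpow (by simp [norm_expTwoPiI]) hT m τ]
    exact hC _ ⟨hm.1, hτ.trans hm.2⟩
  have hGn : ∀ τ : ℍ, 1 ≤ τ.im →
      ‖G τ‖ ≤ C * Real.exp (-(2 * Real.pi * ((b - M) * τ.im))) := by
    intro τ hτ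
    rw [hG, norm_mul, norm_expTwoPiI]
    have : ((b - M : ℂ) * τ).im = (b - M) * τ.im := by
      have : (b - M : ℂ) = ((b - M : ℝ) : ℂ) := by push_cast; rfl
      rw [this, Complex.im_ofReal_mul, coe_im]
    rw [this]
    gcongr
    exact hCn τ hτ
  have hG0 : IsZeroAtImInfty G := by
    have h1 : Filter.Tendsto (fun τ : ℍ => C * Real.exp (-(2 * Real.pi * ((b - M) * τ.im))))
        atImInfty (nhds (C * 0)) := by
      refine Filter.Tendsto.const_mul _ (Real.tendsto_exp_neg_atTop_nhds_zero.comp ?_)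
      exact ((Filter.tendsto_comap (f := UpperHalfPlane.im)).const_mul_atTop hb).const_mul_atTop
        Real.two_pi_pos
    rw [mul_zero] at h1
    refine squeeze_zero_norm' ?_ h1
    exact (atImInfty_mem _).mpr ⟨1, hGn⟩
  have hper : Function.Periodic (G ∘ ofComplex) (1 : ℝ) := by
    intro w
    rcases le_or_gt w.im 0 with hw | hw
    · have hw' : (w + (1 : ℝ)).im ≤ 0 := by simpa using hw
      simp only [Function.comp_apply, ofComplex_apply_eq_of_im_nonpos hw' hw]
    · have hw' : 0 < (w + (1 : ℝ)).im := by simpa using hw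
      have h1 : ofComplex (w + (1 : ℝ)) = ModularGroup.T • ofComplex w := by
        ext1
        have := EvenLattice.coe_T_zpow_smul 1 (ofComplex w)
        rw [zpow_one] at this
        rw [this, ofComplex_apply_of_im_pos hw', ofComplex_apply_of_im_pos hw]
        simp
      have h2 : ((ModularGroup.T • ofComplex w : ℍ) : ℂ) = ofComplex w + 1 := by
        have := EvenLattice.coe_T_zpow_smul 1 (ofComplex w)
        simpa using this
      simp only [Function.comp_apply, hG, h1, h2]
      rw [← hT (ofComplex w), mul_assoc, ← expTwoPiI_add]
      congr 1
      exact expTwoPiI_congr ⟨-M, by push_cast; ring⟩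
  have hhol : MDiff G := by
    rw [UpperHalfPlane.mdifferentiable_iff]
    refine DifferentiableOn.mul hf ?_
    have h : DifferentiableOn ℂ (fun w : ℂ => expTwoPiI ((b - M) * w)) {w | 0 < w.im} := by
      have := differentiable_expTwoPiI
      exact Differentiable.differentiableOn (by fun_prop)
    refine h.congr fun w hw => ?_
    rw [ofComplex_apply_of_im_pos hw]
  have hq := hasSum_qExpansion one_pos hper hhol hG0.isBoundedAtImInfty
  have hq0 : (qExpansion 1 G).coeff 0 = 0 := by
    rw [qExpansion_coeff_zero one_pos (analyticAt_cuspFunction_zero one_pos hper hhol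
      hG0.isBoundedAtImInfty) hper, hG0.valueAtInfty_eq_zero]
  refine ⟨fun m => if M ≤ m then (qExpansion 1 G).coeff (m - M).toNat else 0, fun m hm => ?_,
    fun τ => ?_⟩
  · have h1 : m ≤ M := by
      have : m < ⌈b⌉ := Int.lt_ceil.mpr hm
      omega
    rcases h1.eq_or_lt with rfl | h1
    · simpa using hq0
    · exact if_neg (not_le.mpr h1)
  · have hinj : Function.Injective fun j : ℕ => (j : ℤ) + M := fun i j h => by simpa using h
    rw [← hinj.hasSum_iff]
    · have h1 := (hq τ).mul_right (expTwoPiI (-((b - M) * τ)))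
      have h2 : G τ * expTwoPiI (-((b - M) * τ)) = f τ := by
        rw [hG, mul_assoc, ← expTwoPiI_add, add_neg_cancel, expTwoPiI_zero, mul_one]
      rw [h2] at h1
      refine h1.congr_fun fun j => ?_
      have h3 : Function.Periodic.qParam 1 τ ^ j = expTwoPiI (j * τ) := by
        rw [Function.Periodic.qParam, expTwoPiI, ← Complex.exp_nat_mul]
        congr 1
        push_cast
        ring
      simp only [Function.comp_apply, le_add_iff_nonneg_left, Nat.cast_nonneg, if_true,
        add_sub_cancel_right, Int.toNat_natCast, smul_eq_mul]
      rw [h3, mul_assoc, ← expTwoPiI_add]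
      congr 2
      push_cast
      ring
    · intro m hm
      have : ¬ M ≤ m := fun h => hm ⟨(m - M).toNat, by simp [h]⟩
      simp [this]

namespace EvenLattice

variable {n : ℕ} (L : EvenLattice n) {k : ℤ}

/-! ### Uniqueness of the theta expansion -/

theorem hasSum_ofVec (F : ℍ → L.disc → ℂ) (τ : ℍ) (z : Fin n → ℂ) :
    HasSum (fun r : L.dual => F τ (QuotientAddGroup.mk r) * expTwoPiI (τ * L.quad (L.toC r)) *
      expTwoPiI (L.bil (L.toC r) z)) (L.ofVec F τ z) := by
  rw [ofVec_apply]
  refine L.hasSum_dual_of_classes fun y => ?_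
  refine ((L.hasSum_theta y τ z).mul_left (F τ y)).congr_fun fun r => ?_
  rw [r.2, thetaTerm, mul_assoc, ← expTwoPiI_add]

/-- For fixed `τ` the coefficient of `e(β(r, z))` is `F τ (r + L)` times the nonzero number
`e(τβ(r))`. -/
theorem ofVec_injective {F G : ℍ → L.disc → ℂ} {τ : ℍ}
    (h : ∀ z, L.ofVec F τ z = L.ofVec G τ z) : F τ = G τ := by
  have h1 := L.fourier_coeff_unique (L.hasSum_ofVec F τ) fun z => by
    rw [h]
    exact L.hasSum_ofVec G τ z
  funext y
  have h2 := congrFun h1 (L.rep y)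
  rw [mk_rep] at h2
  exact mul_right_cancel₀ (expTwoPiI_ne_zero _) h2

theorem T_smul_of_slashMat_ofVec {F : ℍ → L.disc → ℂ}
    (h : L.slashMat k (L.ofVec F) ModularGroup.T = L.ofVec F) (τ : ℍ) (y : L.disc) :
    F (ModularGroup.T • τ) y * L.quadChar y = F τ y := by
  refine congrFun (L.ofVec_injective (τ := τ)
    (F := fun τ y => F (ModularGroup.T • τ) y * L.quadChar y) fun z => ?_) y
  have h1 := L.slashMat_T_zpow k (L.ofVec F) 1 τ z
  rw [zpow_one, h] at h1
  rw [h1, ofVec_apply, ofVec_apply]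
  refine Finset.sum_congr rfl fun y _ => ?_
  have h2 := L.theta_T_zpow y 1 τ z
  rw [zpow_one, zpow_one] at h2
  rw [h2, mul_assoc]

-- `toVec` rests on a choice of Fourier coefficients. Grouping the double series by `r` for fixed
-- `τ` and comparing with the theta expansion shows that the choice does not matter.
variable {L} in
theorem JacobiForm.toVec_eq (φ : L.JacobiForm k) {F : ℍ → L.disc → ℂ} (h : φ.1 = L.ofVec F) :
    φ.toVec = F := by
  have hc := (Classical.choose_spec φ.2.fourier).2
  change ∀ (τ : ℍ) z, HasSum (fun p : ℤ × L.dual =>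
    φ.coeff p.1 p.2 * expTwoPiI (p.1 * τ + L.bil (L.toC p.2) z)) (φ.1 τ z) at hc
  funext τ
  have h1 : ∀ z, HasSum (fun r : L.dual => (∑' m : ℤ, φ.coeff m r * expTwoPiI (m * τ)) *
      expTwoPiI (L.bil (L.toC r) z)) (φ.1 τ z) := by
    intro z
    have h2 := (Equiv.prodComm L.dual ℤ).hasSum_iff.mpr (hc τ z)
    refine h2.prod_fiberwise fun r => ?_
    have h3 : (fun m : ℤ => ((fun p : ℤ × L.dual =>
        φ.coeff p.1 p.2 * expTwoPiI (p.1 * τ + L.bil (L.toC p.2) z)) ∘ Equiv.prodComm L.dual ℤ)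
          (r, m)) =
        fun m : ℤ => φ.coeff m r * expTwoPiI (m * τ) * expTwoPiI (L.bil (L.toC r) z) := by
      funext m
      rw [mul_assoc, ← expTwoPiI_add]
      rfl
    rw [h3, ← tsum_mul_right, ← h3]
    exact (h2.summable.prod_factor r).hasSum
  have h3 := L.fourier_coeff_unique h1 fun z => by
    rw [h]
    exact L.hasSum_ofVec F τ z
  funext x
  have h4 := congrFun h3 (L.rep x)
  rw [mk_rep] at h4
  rw [toVec]
  have h5 : F τ x = F τ x * expTwoPiI (τ * L.quad (L.toC (L.rep x))) *
      expTwoPiI (-(L.quad (L.toC (L.rep x)) * τ)) := by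
    rw [mul_assoc, ← expTwoPiI_add, mul_comm (τ : ℂ), add_neg_cancel, expTwoPiI_zero, mul_one]
  rw [h5, ← h4, ← tsum_mul_right]
  refine tsum_congr fun m => ?_
  rw [mul_assoc, ← expTwoPiI_add]
  congr 2
  ring

/-! ### The Fourier expansion -/

theorem exists_quad_eq_quad_rep_add (r : L.dual) : ∃ s : ℤ, L.quad (r : Fin n → ℚ) =
    L.quad (L.rep (QuotientAddGroup.mk r) : Fin n → ℚ) + s := by
  have h : expTwoPiI (L.quad (L.toC r) - L.quad (L.toC (L.rep (QuotientAddGroup.mk r)))) = 1 := by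
    rw [sub_eq_add_neg, expTwoPiI_add, expTwoPiI_neg, expTwoPiI_quad, expTwoPiI_quad, mk_rep,
      mul_inv_cancel₀ (L.quadChar_ne_zero _)]
  obtain ⟨s, hs⟩ := (expTwoPiI_eq_one_iff _).mp h
  refine ⟨s, ?_⟩
  rw [quad_toC, quad_toC, sub_eq_iff_eq_add'] at hs
  exact_mod_cast hs

/-- The expansions of the `F_y` are multiplied by the theta series. For `r` in the class `y`, `β(r)`
exceeds the value at the representative by an integer `s r`, which accounts for the shift of `m`. -/
theorem exists_hasFourierExpansion_ofVec {F : ℍ → L.disc → ℂ} {a : L.disc → ℤ → ℂ}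
    (ha0 : ∀ y (m : ℤ), (m : ℚ) < L.quad (L.rep y : Fin n → ℚ) → a y m = 0)
    (ha : ∀ y (τ : ℍ), HasSum (fun m => a y m * expTwoPiI ((m - L.quad (L.toC (L.rep y))) * τ))
      (F τ y)) :
    ∃ c, L.HasFourierExpansion (L.ofVec F) c := by
  choose s hs using L.exists_quad_eq_quad_rep_add
  have hsC : ∀ r : L.dual, L.quad (L.toC r) =
      L.quad (L.toC (L.rep (QuotientAddGroup.mk r))) + s r := by
    intro r
    rw [quad_toC, quad_toC, hs r]
    push_cast
    rfl
  refine ⟨fun m r => a (QuotientAddGroup.mk r) (m - s r), fun m r hm => ha0 _ _ ?_,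
    fun τ z => ?_⟩
  · rw [hs r] at hm
    push_cast
    linarith
  · rw [← (Equiv.prodComm L.dual ℤ).hasSum_iff]
    set T : L.dual → ℂ := fun r => expTwoPiI (τ * L.quad (L.toC r)) *
      expTwoPiI (L.bil (L.toC r) z) with hT
    set t : L.disc → ℤ → ℂ := fun y m =>
      a y m * expTwoPiI ((m - L.quad (L.toC (L.rep y))) * τ) with ht
    have hf : ∀ p : L.dual × ℤ, ((fun p : ℤ × L.dual => a (QuotientAddGroup.mk p.2) (p.1 - s p.2) *
        expTwoPiI (p.1 * τ + L.bil (L.toC p.2) z)) ∘ Equiv.prodComm L.dual ℤ) p =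
        t (QuotientAddGroup.mk p.1) (p.2 - s p.1) * T p.1 := by
      intro p
      simp only [Function.comp_apply, Equiv.prodComm_apply, Prod.fst_swap, Prod.snd_swap, ht, hT]
      rw [mul_assoc, ← expTwoPiI_add, ← expTwoPiI_add, hsC p.1]
      congr 2
      push_cast
      ring
    have hfib : ∀ r : L.dual, HasSum (fun m : ℤ => t (QuotientAddGroup.mk r) (m - s r) * T r)
        (F τ (QuotientAddGroup.mk r) * T r) := fun r =>
      ((Equiv.subRight (s r)).hasSum_iff.mpr (ha (QuotientAddGroup.mk r) τ)).mul_right _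
    have hfibn : ∀ r : L.dual, HasSum (fun m : ℤ => ‖t (QuotientAddGroup.mk r) (m - s r) * T r‖)
        ((∑' m, ‖t (QuotientAddGroup.mk r) m‖) * ‖T r‖) := by
      intro r
      simp only [norm_mul]
      exact ((Equiv.subRight (s r)).hasSum_iff.mpr
        (ha (QuotientAddGroup.mk r) τ).summable.norm.hasSum).mul_right _
    have hsum : Summable fun p : L.dual × ℤ =>
        t (QuotientAddGroup.mk p.1) (p.2 - s p.1) * T p.1 := by
      refine Summable.of_norm ((summable_prod_of_nonneg fun _ => norm_nonneg _).mpr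
        ⟨fun r => (hfibn r).summable, ?_⟩)
      simp only [fun r => (hfibn r).tsum_eq]
      -- Absolute convergence of the double series: the sums over `m` of the absolute values depend
      -- only on the class of `r`, so they serve as coefficients of another theta expansion.
      have h := (L.hasSum_ofVec (fun _ y => ((∑' m, ‖t y m‖ : ℝ) : ℂ)) τ z).summable.norm
      refine h.congr fun r => ?_
      rw [mul_assoc, norm_mul, Complex.norm_real, Real.norm_of_nonneg
        (tsum_nonneg fun _ => norm_nonneg _)]
    rw [funext hf]
    have h1 := hsum.hasSum.prod_fiberwise hfib
    have h2 := L.hasSum_ofVec F τ z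
    simp only [mul_assoc] at h2
    rw [← h1.unique h2]
    exact hsum.hasSum

/-! ### The Eisenstein series as a Jacobi form -/

theorem isIsotropic_zero : L.IsIsotropic 0 := (L.quadChar_eq_one_iff 0).mp L.quadChar_zero

theorem isJacobiForm_eisenstein (hk : (n : ℤ) + 4 < 2 * k) {x : L.disc} (hx : L.IsIsotropic x) :
    L.IsJacobiForm k (L.eisenstein k x) where
  holo := by
    rw [L.eisenstein_eq_ofVec hk hx]
    exact L.differentiableOn_ofVec (L.isHoloVec_eisVec hk x)
  slash_eq := L.slash_eisenstein hk hx
  fourier := by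
    have hT := L.slashMat_eisenstein (k := k) hx ModularGroup.T
    rw [L.eisenstein_eq_ofVec hk hx] at hT ⊢
    obtain ⟨C, hC⟩ := L.exists_bound_eisVec hk x 1 one_pos
    have hq : ∀ y, (((L.quad (L.rep y : Fin n → ℚ) : ℚ) : ℝ) : ℂ) = L.quad (L.toC (L.rep y)) := by
      intro y
      rw [quad_toC]
      push_cast
      rfl
    have h : ∀ y, ∃ a : ℤ → ℂ, (∀ m : ℤ, (m : ℝ) < (L.quad (L.rep y : Fin n → ℚ) : ℚ) → a m = 0) ∧
        ∀ τ : ℍ, HasSum (fun m => a m * expTwoPiI ((m - ((L.quad (L.rep y : Fin n → ℚ) : ℚ) : ℝ)) * τ))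
          (L.eisVec k x τ y) := fun y =>
      exists_fourier_expansion (L.isHoloVec_eisVec hk x y)
        (fun τ => by rw [hq]; exact L.T_smul_of_slashMat_ofVec hT τ y) fun τ hτ => hC τ hτ y
    choose a ha0 ha using h
    refine L.exists_hasFourierExpansion_ofVec (a := a) (fun y m hm => ha0 y m ?_) fun y τ => ?_
    · exact_mod_cast hm
    · simpa only [hq] using ha y τ

end EvenLattice

/-! ### Averaging over translations -/

theorem ZMod.sum_range_natCast {M : ℕ} [NeZero M] {R : Type*} [AddCommMonoid R] (h : ZMod M → R) :
    ∑ l ∈ Finset.range M, h l = ∑ a, h a :=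
  Finset.sum_nbij' (fun l : ℕ => (l : ZMod M)) ZMod.val (fun _ _ => Finset.mem_univ _)
    (fun a _ => Finset.mem_range.mpr (ZMod.val_lt a))
    (fun _ hl => ZMod.val_cast_of_lt (Finset.mem_range.mp hl)) (fun a _ => ZMod.natCast_zmod_val a)
    fun _ _ => rfl

theorem zpow_eq_zpow_of_pow_eq_one {M : ℕ} {u : ℂ} (hu0 : u ≠ 0) (hu : u ^ M = 1) {l m : ℤ}
    (h : (l : ZMod M) = m) : u ^ l = u ^ m := by
  obtain ⟨c, hc⟩ := (ZMod.intCast_eq_intCast_iff_dvd_sub _ _ _).mp h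
  rw [show m = l + M * c by rw [← hc]; ring, zpow_add₀ hu0, zpow_mul, zpow_natCast, hu, one_zpow,
    mul_one]

/-- The action of `SL₂(ℤ)` on pairs of residue classes from the right. -/
def slEquiv (M : ℕ) (A : SL(2, ℤ)) : ZMod M × ZMod M ≃ ZMod M × ZMod M where
  toFun p := (A 0 0 * p.1 + A 1 0 * p.2, A 0 1 * p.1 + A 1 1 * p.2)
  invFun p := (A 1 1 * p.1 - A 1 0 * p.2, A 0 0 * p.2 - A 0 1 * p.1)
  left_inv p := by
    have hd : (A 0 0 : ZMod M) * A 1 1 - A 0 1 * A 1 0 = 1 := by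
      have := A.det_coe
      rw [Matrix.det_fin_two] at this
      exact_mod_cast congrArg (Int.cast : ℤ → ZMod M) this
    ext
    · linear_combination p.1 * hd
    · linear_combination p.2 * hd
  right_inv p := by
    have hd : (A 0 0 : ZMod M) * A 1 1 - A 0 1 * A 1 0 = 1 := by
      have := A.det_coe
      rw [Matrix.det_fin_two] at this
      exact_mod_cast congrArg (Int.cast : ℤ → ZMod M) this
    ext
    · linear_combination p.1 * hd
    · linear_combination p.2 * hd

namespace EvenLattice

open JacobiGroup

variable {n : ℕ} (L : EvenLattice n) {k : ℤ}

instance (x : L.disc) : NeZero (addOrderOf x ^ 2) :=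
  ⟨pow_ne_zero 2 (addOrderOf_pos x).ne'⟩

theorem quadChar_zsmul (x : L.disc) (m : ℤ) : L.quadChar (m • x) = L.quadChar x ^ (m * m) := by
  obtain ⟨r, rfl⟩ := QuotientAddGroup.mk_surjective x
  rw [← QuotientAddGroup.mk_zsmul, ← expTwoPiI_quad, ← expTwoPiI_quad, ← expTwoPiI_int_mul,
    toC_zsmul, quad_smul]
  congr 1
  push_cast
  ring

/-- `N_x² β(x) ≡ β(N_x x) ≡ 0` mod `ℤ`, which explains the modulus `N_x²`. -/
theorem quadChar_pow_addOrderOf_sq (x : L.disc) : L.quadChar x ^ (addOrderOf x ^ 2) = 1 := by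
  have h := L.quadChar_zsmul x (addOrderOf x)
  rw [natCast_zsmul, addOrderOf_nsmul_eq_zero, quadChar_zero, ← Nat.cast_mul, zpow_natCast,
    ← sq] at h
  exact h.symm

theorem pair_pow_addOrderOf_sq (x y : L.disc) : L.pair x y ^ (addOrderOf x ^ 2) = 1 := by
  have h := L.pair_zsmul_right y x (addOrderOf x ^ 2 : ℕ)
  rw [natCast_zsmul, sq, mul_nsmul, addOrderOf_nsmul_eq_zero, nsmul_zero, pair_zero_right,
    zpow_natCast, pair_comm, ← sq] at h
  exact h.symm

theorem zsmul_eq_zsmul_of_eq {x : L.disc} {l m : ℤ} (h : (l : ZMod (addOrderOf x ^ 2)) = m) :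
    l • x = m • x := by
  obtain ⟨c, hc⟩ := (ZMod.intCast_eq_intCast_iff_dvd_sub _ _ _).mp h
  rw [show m = l + c * addOrderOf x * addOrderOf x by rw [← sub_eq_iff_eq_add', hc]; push_cast; ring,
    add_zsmul, mul_zsmul, natCast_zsmul, addOrderOf_nsmul_eq_zero, zsmul_zero, add_zero]

theorem translate_ofVec (F : ℍ → L.disc → ℂ) (p q : Fin n → ℂ) (τ : ℍ) (z : Fin n → ℂ) :
    L.translate p q (L.ofVec F) τ z = ∑ y, F τ y * L.translate p q (L.theta y) τ z := by
  simp only [translate, ofVec_apply, Finset.sum_mul, mul_assoc]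

/-- By `translate_theta` the integers `l`, `m` enter only through `lx` and powers of roots of unity
of order dividing `N_x²`. So the averaging is a sum over pairs of residue classes, on which `SL₂(ℤ)`
acts. -/
theorem translate_ofVec_congr (F : ℍ → L.disc → ℂ) {x : L.disc} {l l' m m' : ℤ}
    (hl : (l : ZMod (addOrderOf x ^ 2)) = l') (hm : (m : ZMod (addOrderOf x ^ 2)) = m') :
    L.translate ((l : ℂ) • L.toC (L.rep x)) ((m : ℂ) • L.toC (L.rep x)) (L.ofVec F) =
      L.translate ((l' : ℂ) • L.toC (L.rep x)) ((m' : ℂ) • L.toC (L.rep x)) (L.ofVec F) := by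
  funext τ z
  rw [translate_ofVec, translate_ofVec]
  refine Finset.sum_congr rfl fun y _ => ?_
  have h : ((l * m : ℤ) : ZMod (addOrderOf x ^ 2)) = (l' * m' : ℤ) := by
    push_cast
    rw [hl, hm]
  rw [translate_theta, translate_theta, mk_rep,
    zpow_eq_zpow_of_pow_eq_one (L.pair_ne_zero x y) (L.pair_pow_addOrderOf_sq x y) hm,
    zpow_eq_zpow_of_pow_eq_one (L.quadChar_ne_zero x) (L.quadChar_pow_addOrderOf_sq x) h,
    L.zsmul_eq_zsmul_of_eq hl]

/-- The mean over the translations by the multiples of a representative of `x`. -/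
def translationMean (x : L.disc) (φ : ℍ → (Fin n → ℂ) → ℂ) : ℍ → (Fin n → ℂ) → ℂ := fun τ z =>
  (1 / (addOrderOf x : ℂ) ^ 2) *
    ∑ p : ZMod (addOrderOf x ^ 2) × ZMod (addOrderOf x ^ 2),
      L.translate (((p.1.cast : ℤ) : ℂ) • L.toC (L.rep x)) (((p.2.cast : ℤ) : ℂ) • L.toC (L.rep x))
        φ τ z

theorem translationMean_ofVec (x : L.disc) (F : ℍ → L.disc → ℂ) (τ : ℍ) (z : Fin n → ℂ) :
    L.translationMean x (L.ofVec F) τ z = (1 / (addOrderOf x : ℂ) ^ 2) *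
      ∑ l ∈ Finset.range (addOrderOf x ^ 2), ∑ m ∈ Finset.range (addOrderOf x ^ 2),
        L.translate (((l : ℤ) : ℂ) • L.toC (L.rep x)) (((m : ℤ) : ℂ) • L.toC (L.rep x))
          (L.ofVec F) τ z := by
  rw [translationMean, Fintype.sum_prod_type, ← ZMod.sum_range_natCast]
  congr 1
  refine Finset.sum_congr rfl fun l _ => ?_
  rw [← ZMod.sum_range_natCast]
  refine Finset.sum_congr rfl fun m _ => ?_
  exact congrFun (congrFun (L.translate_ofVec_congr F (by simp) (by simp)) τ) z

/-- Both sides carry `𝔢_y` to `𝔢_{y - lx}` with the phase `e(-μβ(x, y) + lμβ(x))`; conjugating the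
matrices inverts the phases of `schrodinger`. -/
theorem ofVec_schrodingerDual (x : L.disc) (F : ℍ → L.disc → ℂ) (l μ : ℤ) :
    L.ofVec (fun τ => (L.schrodingerDual x l μ 0).mulVec (F τ)) =
      L.translate (((-l : ℤ) : ℂ) • L.toC (L.rep x)) (((-μ : ℤ) : ℂ) • L.toC (L.rep x))
        (L.ofVec F) := by
  funext τ z
  rw [translate_ofVec, ofVec_apply]
  simp only [Matrix.mulVec, dotProduct, Finset.sum_mul]
  rw [Finset.sum_comm]
  refine Finset.sum_congr rfl fun y _ => ?_
  rw [translate_theta, mk_rep, Finset.sum_eq_single (y - l • x)]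
  · have h : L.schrodingerDual x l μ 0 (y - l • x) y =
        L.pair x y ^ (-μ) * L.quadChar x ^ (-l * -μ) := by
      rw [schrodingerDual, Matrix.map_apply, schrodinger, if_pos rfl, expTwoPiI_add,
        show ((0 : ℤ) : ℂ) - l * μ = ((-(l * μ) : ℤ) : ℂ) by push_cast; ring,
        expTwoPiI_int_mul, expTwoPiI_int_mul, ← pair, ← quadChar, map_mul, map_zpow₀, map_zpow₀,
        conj_pair, ← Complex.inv_eq_conj (L.norm_quadChar x), inv_zpow', inv_zpow']
      congr 2
      ring
    rw [h, show y - l • x = y + -l • x by rw [neg_zsmul, sub_eq_add_neg]]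
    ring
  · intro w _ hw
    rw [schrodingerDual, Matrix.map_apply, schrodinger, if_neg hw, map_zero, zero_mul, zero_mul]
  · exact fun h => absurd (Finset.mem_univ _) h

-- The signs in `ofVec_schrodingerDual` are absorbed by the substitution `p ↦ -p` in the sum over
-- residue pairs.
variable {L} in
theorem averaging_eq_translationMean (x : L.disc) (φ : L.JacobiForm k) {F : ℍ → L.disc → ℂ}
    (h : φ.1 = L.ofVec F) : averaging x φ = L.translationMean x φ.1 := by
  funext τ z
  rw [averaging, JacobiForm.toVec_eq φ h, translationMean, h,
    ← Equiv.sum_comp (Equiv.neg (ZMod (addOrderOf x ^ 2) × ZMod (addOrderOf x ^ 2))),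
    Fintype.sum_prod_type, ← ZMod.sum_range_natCast]
  congr 1
  refine Finset.sum_congr rfl fun l _ => ?_
  rw [← ZMod.sum_range_natCast]
  refine Finset.sum_congr rfl fun m _ => ?_
  rw [ofVec_schrodingerDual]
  exact congrFun (congrFun (L.translate_ofVec_congr F (by simp) (by simp)) τ) z

/-- `A` turns the translation by `(l, m)` into the one by `(l, m)A` and permutes the pairs mod
`N_x²`. The theta expansion of `φ|A` is needed for the translations to depend on residues only. -/
theorem slashMat_translationMean (x : L.disc) {φ : ℍ → (Fin n → ℂ) → ℂ} {A : SL(2, ℤ)}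
    {F : ℍ → L.disc → ℂ} (h : L.slashMat k φ A = L.ofVec F) :
    L.slashMat k (L.translationMean x φ) A = L.translationMean x (L.slashMat k φ A) := by
  funext τ z
  rw [slashMat_apply, translationMean, translationMean, mul_assoc, mul_assoc, Finset.sum_mul,
    ← Equiv.sum_comp (slEquiv (addOrderOf x ^ 2) A) fun p =>
      L.translate (((p.1.cast : ℤ) : ℂ) • L.toC (L.rep x)) (((p.2.cast : ℤ) : ℂ) • L.toC (L.rep x))
        (L.slashMat k φ A) τ z]
  congr 1
  refine Finset.sum_congr rfl fun p _ => ?_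
  rw [← mul_assoc, ← slashMat_apply, slashMat_translate, h, smul_smul, smul_smul, ← add_smul,
    smul_smul, smul_smul, ← add_smul]
  have h1 := L.translate_ofVec_congr F (x := x) (l := A 0 0 * (p.1.cast : ℤ) + A 1 0 * (p.2.cast : ℤ))
    (l' := ((slEquiv _ A p).1.cast : ℤ)) (m := A 0 1 * (p.1.cast : ℤ) + A 1 1 * (p.2.cast : ℤ))
    (m' := ((slEquiv _ A p).2.cast : ℤ)) (by simp [slEquiv]) (by simp [slEquiv])
  push_cast at h1
  rw [h1]

theorem mem_averagingIndex (x : L.disc) (l : ℕ) :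
    l ∈ L.averagingIndex x ↔ l ∈ Finset.range (addOrderOf x ^ 2) ∧ L.quadChar x ^ l = 1 := by
  classical
  rw [averagingIndex, Finset.mem_filter, ← zpow_natCast, quadChar, ← expTwoPiI_int_mul,
    expTwoPiI_eq_one_iff, quad_toC]
  refine and_congr_right fun _ => exists_congr fun m => ?_
  norm_cast

/-- `β(lx) ≡ l · lβ(x)` mod `ℤ`. -/
theorem isIsotropic_nsmul {x : L.disc} {l : ℕ} (hl : L.quadChar x ^ l = 1) :
    L.IsIsotropic (l • x) := by
  rw [← quadChar_eq_one_iff, ← natCast_zsmul, quadChar_zsmul, zpow_mul,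
    zpow_natCast (L.quadChar x), hl, one_zpow]

theorem sum_range_pow_of_pow_eq_one {u : ℂ} {M : ℕ} (hu : u ^ M = 1) [Decidable (u = 1)] :
    ∑ m ∈ Finset.range M, u ^ m = if u = 1 then (M : ℂ) else 0 := by
  split_ifs with h
  · simp [h]
  · rw [geom_sum_eq h, hu, sub_self, zero_div]

-- The translate of `ϑ_0` by `(l, m)` is `e(lmβ(x)) ϑ_{lx}`. The geometric sum over `m` is `N_x²`,
-- cancelling the prefactor, if `lβ(x) ∈ ℤ`, and zero otherwise.
open Classical in
theorem translationMean_theta_zero (x : L.disc) (τ : ℍ) (z : Fin n → ℂ) :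
    L.translationMean x (L.theta 0) τ z = ∑ l ∈ L.averagingIndex x, L.theta (l • x) τ z := by
  have hN : ((addOrderOf x : ℂ) ^ 2) ≠ 0 := by
    exact_mod_cast NeZero.ne (addOrderOf x ^ 2)
  have hI : L.averagingIndex x =
      (Finset.range (addOrderOf x ^ 2)).filter fun l => L.quadChar x ^ l = 1 := by
    ext l
    rw [mem_averagingIndex, Finset.mem_filter]
  rw [← ofVec_single, translationMean_ofVec, ofVec_single, hI, Finset.sum_filter, Finset.mul_sum]
  refine Finset.sum_congr rfl fun l _ => ?_
  have h1 : (L.quadChar x ^ l) ^ (addOrderOf x ^ 2) = 1 := by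
    rw [← pow_mul, mul_comm, pow_mul, quadChar_pow_addOrderOf_sq, one_pow]
  simp only [translate_theta, mk_rep, pair_zero_right, one_zpow, one_mul, zero_add, natCast_zsmul]
  rw [← Finset.sum_mul]
  simp only [← Nat.cast_mul, zpow_natCast, pow_mul]
  rw [sum_range_pow_of_pow_eq_one h1]
  split_ifs
  · rw [Nat.cast_pow, ← mul_assoc, one_div, inv_mul_cancel₀ hN, one_mul]
  · simp

theorem translationMean_eisenstein_zero (hk : (n : ℤ) + 4 < 2 * k) (x : L.disc) (τ : ℍ) (z : Fin n → ℂ) :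
    L.translationMean x (L.eisenstein k 0) τ z =
      ∑ l ∈ L.averagingIndex x, L.eisenstein k (l • x) τ z := by
  have h1 : ∀ A : SL(2, ℤ), L.translationMean x (L.slashMat k (L.theta 0) A) τ z =
      ∑ l ∈ L.averagingIndex x, L.slashMat k (L.theta (l • x)) A τ z := by
    intro A
    rw [← L.slashMat_translationMean x (L.slashMat_theta k 0 A), slashMat_apply,
      translationMean_theta_zero, Finset.sum_mul, Finset.sum_mul]
    rfl
  have h2 : HasSum (fun A : ModularCosets =>
      (1 / 2) * L.translationMean x (L.slashMat k (L.theta 0) (Quotient.out A)) τ z)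
      (L.translationMean x (L.eisenstein k 0) τ z) := by
    -- The averaging is a finite combination of values of `E_0` at the same `τ` and shifted
    -- arguments `w`, so it passes through the pointwise convergent series.
    have h : ∀ w, HasSum (fun A : ModularCosets =>
        (1 / 2) * L.slashMat k (L.theta 0) (Quotient.out A) τ w) (L.eisenstein k 0 τ w) := by
      intro w
      rw [L.eisenstein_apply k L.isIsotropic_zero]
      exact (L.hasSum_slashMat_theta hk 0 τ w).summable.hasSum.mul_left _
    refine ((hasSum_sum fun p _ => (h _).mul_right _).mul_left _).congr_fun fun A => ?_
    rw [translationMean, mul_left_comm, Finset.mul_sum]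
    simp only [translate, mul_assoc]
  have h3 : HasSum (fun A : ModularCosets =>
      (1 / 2) * L.translationMean x (L.slashMat k (L.theta 0) (Quotient.out A)) τ z)
      (∑ l ∈ L.averagingIndex x, L.eisenstein k (l • x) τ z) := by
    simp only [h1, Finset.mul_sum]
    refine hasSum_sum fun l hl => ?_
    rw [L.eisenstein_apply k (L.isIsotropic_nsmul ((L.mem_averagingIndex x l).mp hl).2)]
    exact (L.hasSum_slashMat_theta hk _ τ z).summable.hasSum.mul_left _
  exact h2.unique h3

end EvenLattice

end

theorem propositionP {n : ℕ} (L : EvenLattice n) (k : ℤ) (hk : (n : ℤ) + 4 < 2 * k)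
    (x : L.disc) :
    (∀ y : L.disc, L.IsIsotropic y → L.EisensteinConverges k y) ∧
    ∃ hE : L.IsJacobiForm k (L.eisenstein k 0),
      ∀ (τ : UpperHalfPlane) (z : Fin n → ℂ),
        EvenLattice.averaging x (⟨L.eisenstein k 0, hE⟩ : L.JacobiForm k) τ z =
          ∑ l ∈ L.averagingIndex x, L.eisenstein k (l • x) τ z := by
  have h0 := L.isIsotropic_zero
  refine ⟨fun y hy => L.eisensteinConverges hk hy, L.isJacobiForm_eisenstein hk h0, fun τ z => ?_⟩
  exact (congrFun (congrFun (EvenLattice.averaging_eq_translationMean x _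
    (L.eisenstein_eq_ofVec hk h0)) τ) z).trans (L.translationMean_eisenstein_zero hk x τ z)
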